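/- **Lemma 1.1.** Let $\alpha\in\mathbb{C}^*$. For $a=(a_1,a_2,a_3,a_4)\in\mathbb{C}^4$ let $$top(a)=\begin{pmatrix}\alpha&0\\0&\alpha^{-1}\end{pmatrix}\begin{pmatrix}1&0\\a_1&1\end{pmatrix}\begin{pmatrix}1&a_2\\0&1\end{pmatrix}\begin{pmatrix}1&0\\a_3&1\end{pmatrix}\begin{pmatrix}1&a_4\\0&1\end{pmatrix}$$ (the topological monodromy on $V(\infty)=\mathbb{C}e_1\oplus\mathbb{C}e_2$). The base changes $e_1,e_2\mapsto\lambda e_1,\lambda^{-1}e_2$ give an action of $\mathbb{G}_m$ with weights $2,-2,2,-2$ on $a_1,a_2,a_3,a_4$. Let $\mathcal{R}[s,\alpha]$ be the $\mathbb{C}$-scheme $\{a\in\mathbb{C}^4\setminus\{0\}\mid \mathrm{trace}\,top(a)=s\}/\mathbb{G}_m$, glued from the slices $a_j=1$, $j=1,\dots,4$ (it need not be separated). For $\beta\in\mathbb{C}^*$ let $\mathcal{R}^+(\beta,\alpha)$ be the $\mathbb{C}$-scheme of pairs $(a,L)$ modulo $\mathbb{G}_m$, where $a$ is as above with $s=\beta+\beta^{-1}$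 and $L\subset V(\infty)$ is a line with $top(a)|_L=\beta$. Let $\beta\in\{1,-1\}$. Then the morphism $\mathcal{R}^+(\beta,\alpha)\to\mathcal{R}[2\beta,\alpha]$, $(a,L)\mapsto a$, is the minimal resolution of $\mathcal{R}[2\beta,\alpha]$: it is proper and birational, $\mathcal{R}^+(\beta,\alpha)$ is smooth over $\mathbb{C}$, and every proper birational morphism $Z\to\mathcal{R}[2\beta,\alpha]$ with $Z$ smooth over $\mathbb{C}$ factors uniquely through it. Moreover the morphism is an isomorphism above every open subscheme of $\mathcal{R}[2\beta,\alpha]$ that is smooth over $\mathbb{C}$. If $\alpha\neq\beta$, then $\mathcal{R}[2\beta,\alpha]$ has exactly one singular point; if $\alpha=\beta$, it has exactly two singular points. -/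

import Mathlib

open CategoryTheory CategoryTheory.Limits AlgebraicGeometry Opposite

noncomputable section

/-! ## Quotients of affine schemes, minus a coordinate locus, by a diagonal torus action -/

/-- A `ℂ`-algebra `B` with elements `coord k` (in the examples they generate `B`, and all
relations between them are homogeneous) on which a torus acts diagonally, `coord k` being a
semi-invariant of weight `weight k` in the character group `D`.  The set `charts` of sets of
coordinates determines the invariant open subscheme
`U = ⋃ (S ∈ charts), {coord k ≠ 0 for all k ∈ S}` of `Spec B`.  On every chart all
weights are combinations of the weights of the invertible coordinates. -/
structure TorusAction (σ D B : Type) [AddCommGroup D] [CommRing B] [Algebra ℂ B] where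
  coord : σ → B
  weight : σ → D
  charts : Set (Set σ)
  charts_mono : ∀ {S T : Set σ}, S ∈ charts → S ⊆ T → T ∈ charts
  weight_mem : ∀ {S : Set σ}, S ∈ charts → ∀ k, weight k ∈ AddSubgroup.closure (weight '' S)

namespace TorusAction

variable {σ D B : Type} [AddCommGroup D] [CommRing B] [Algebra ℂ B]
variable {σ' D' B' : Type} [AddCommGroup D'] [CommRing B'] [Algebra ℂ B']

/-- The monomial in the coordinates with exponent (multiset of indices) `m`. -/
def mon (P : TorusAction σ D B) (m : Multiset σ) : B := (m.map P.coord).prod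

/-- The weight of the monomial with exponent `m`. -/
def deg (P : TorusAction σ D B) (m : Multiset σ) : D := (m.map P.weight).sum

/-- The multiplicative set generated by the coordinates in `S`. -/
def denoms (P : TorusAction σ D B) (S : Set σ) : Submonoid B :=
  Submonoid.closure (P.coord '' S)

/-- The coordinate ring `B[1 / coord k, k ∈ S]` of the open subscheme of `Spec B` where the
coordinates in `S` do not vanish. -/
abbrev Loc (P : TorusAction σ D B) (S : Set σ) : Type := Localization (P.denoms S)

/-- The invariant Laurent monomials: the fractions `mon m / mon n` of weight zero with
a denominator that involves only the coordinates in `S`. -/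
def invMonomials (P : TorusAction σ D B) (S : Set σ) : Set (P.Loc S) :=
  {u | ∃ m n : Multiset σ, (∀ k ∈ n, k ∈ S) ∧ P.deg m = P.deg n ∧
    u * algebraMap B (P.Loc S) (P.mon n) = algebraMap B (P.Loc S) (P.mon m)}

/-- The ring of torus invariants (the part of weight zero) of `B[1 / coord k, k ∈ S]`. -/
def invRing (P : TorusAction σ D B) (S : Set σ) : Subalgebra ℂ (P.Loc S) :=
  Algebra.adjoin ℂ (P.invMonomials S)

/-- An equivariant map `Spec B' ⟶ Spec B` which pulls back coordinates to coordinates and sends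
the open subscheme of the second action to that of the first. -/
structure Hom (P : TorusAction σ D B) (P' : TorusAction σ' D' B') where
  ring : B →ₐ[ℂ] B'
  idx : σ → σ'
  wt : D →+ D'
  ring_coord : ∀ k, ring (P.coord k) = P'.coord (idx k)
  wt_weight : ∀ k, wt (P.weight k) = P'.weight (idx k)
  preimage_mem : ∀ S ∈ P'.charts, idx ⁻¹' S ∈ P.charts

namespace Hom

variable {P : TorusAction σ D B} {P' : TorusAction σ' D' B'}

/-- The identity. -/
def id (P : TorusAction σ D B) : Hom P P where
  ring := AlgHom.id ℂ B
  idx := _root_.id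
  wt := AddMonoidHom.id D
  ring_coord _ := rfl
  wt_weight _ := rfl
  preimage_mem _ h := h

lemma denoms_le (F : Hom P P') {S : Set σ} {S' : Set σ'} (h : ∀ k ∈ S, F.idx k ∈ S') :
    P.denoms S ≤ (P'.denoms S').comap F.ring.toRingHom := by
  refine Submonoid.closure_le.mpr ?_
  rintro _ ⟨k, hk, rfl⟩
  change F.ring (P.coord k) ∈ P'.denoms S'
  rw [F.ring_coord]
  exact Submonoid.subset_closure ⟨_, h k hk, rfl⟩

/-- The induced map of localizations. -/
def loc (F : Hom P P') {S : Set σ} {S' : Set σ'} (h : ∀ k ∈ S, F.idx k ∈ S') :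
    P.Loc S →ₐ[ℂ] P'.Loc S' :=
  { IsLocalization.map (P'.Loc S') F.ring.toRingHom (F.denoms_le h) with
    commutes' := fun c => by
      change IsLocalization.map (P'.Loc S') F.ring.toRingHom (F.denoms_le h)
        (algebraMap ℂ (P.Loc S) c) = _
      rw [IsScalarTower.algebraMap_apply ℂ B (P.Loc S), IsLocalization.map_eq,
        IsScalarTower.algebraMap_apply ℂ B' (P'.Loc S')]
      congr 1
      exact F.ring.commutes c }

lemma loc_algebraMap (F : Hom P P') {S : Set σ} {S' : Set σ'} (h : ∀ k ∈ S, F.idx k ∈ S')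
    (b : B) : F.loc h (algebraMap B (P.Loc S) b) = algebraMap B' (P'.Loc S') (F.ring b) :=
  IsLocalization.map_eq (F.denoms_le h) b

lemma ring_mon (F : Hom P P') (m : Multiset σ) :
    F.ring (P.mon m) = P'.mon (m.map F.idx) := by
  simp only [mon, map_multiset_prod, Multiset.map_map]
  congr 1
  exact Multiset.map_congr rfl fun k _ => F.ring_coord k

lemma wt_deg (F : Hom P P') (m : Multiset σ) : F.wt (P.deg m) = P'.deg (m.map F.idx) := by
  simp only [deg, map_multiset_sum, Multiset.map_map]
  congr 1
  exact Multiset.map_congr rfl fun k _ => F.wt_weight k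

lemma invRing_le (F : Hom P P') {S : Set σ} {S' : Set σ'} (h : ∀ k ∈ S, F.idx k ∈ S') :
    P.invRing S ≤ (P'.invRing S').comap (F.loc h) := by
  refine Algebra.adjoin_le ?_
  rintro u ⟨m, n, hn, hd, hu⟩
  refine Algebra.subset_adjoin ⟨m.map F.idx, n.map F.idx, ?_, ?_, ?_⟩
  · intro k hk
    obtain ⟨l, hl, rfl⟩ := Multiset.mem_map.mp hk
    exact h l (hn l hl)
  · rw [← wt_deg, ← wt_deg, hd]
  · rw [← ring_mon, ← ring_mon, ← loc_algebraMap F h, ← loc_algebraMap F h]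
    exact (map_mul (F.loc h) _ _).symm.trans (congrArg (F.loc h) hu)

/-- The induced map of rings of invariants. -/
def inv (F : Hom P P') {S : Set σ} {S' : Set σ'} (h : ∀ k ∈ S, F.idx k ∈ S') :
    P.invRing S →ₐ[ℂ] P'.invRing S' :=
  ((F.loc h).comp (P.invRing S).val).codRestrict (P'.invRing S')
    fun x => F.invRing_le h x.2

lemma coe_inv (F : Hom P P') {S : Set σ} {S' : Set σ'} (h : ∀ k ∈ S, F.idx k ∈ S')
    (x : P.invRing S) : (F.inv h x : P'.Loc S') = F.loc h x := rfl

end Hom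

variable (P : TorusAction σ D B)

/-- The charts, ordered by inclusion of the sets of invertible coordinates. -/
abbrev Chart : Type := {S : Set σ // S ∈ P.charts}

/-- The restriction map between the rings of invariants of two charts. -/
def res {S T : Set σ} (h : S ⊆ T) : P.invRing S →ₐ[ℂ] P.invRing T :=
  (Hom.id P).inv fun _ hk => h hk

lemma loc_hom_ext {S : Set σ} {A : Type} [CommRing A] {f g : P.Loc S →+* A}
    (h : ∀ b, f (algebraMap B _ b) = g (algebraMap B _ b)) : f = g :=
  IsLocalization.ringHom_ext (P.denoms S) (RingHom.ext h)

lemma loc_id_id (S : Set σ) (x : P.Loc S) : (Hom.id P).loc (fun _ hk => hk) x = x := by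
  have : ((Hom.id P).loc (S := S) (S' := S) (fun _ hk => hk)).toRingHom = RingHom.id _ :=
    P.loc_hom_ext fun b => Hom.loc_algebraMap _ _ b
  exact congrArg (fun f => f x) this

lemma loc_loc {σ'' D'' B'' : Type} [AddCommGroup D''] [CommRing B''] [Algebra ℂ B'']
    {P : TorusAction σ D B} {P' : TorusAction σ' D' B'} {P'' : TorusAction σ'' D'' B''}
    (F : Hom P P') (G : Hom P' P'') (H : Hom P P'')
    (hring : ∀ b, G.ring (F.ring b) = H.ring b)
    {S : Set σ} {S' : Set σ'} {S'' : Set σ''} (h : ∀ k ∈ S, F.idx k ∈ S')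
    (h' : ∀ k ∈ S', G.idx k ∈ S'') (h'' : ∀ k ∈ S, H.idx k ∈ S'') (x : P.Loc S) :
    G.loc h' (F.loc h x) = H.loc h'' x := by
  have : (G.loc h').toRingHom.comp (F.loc h).toRingHom = (H.loc h'').toRingHom :=
    P.loc_hom_ext fun b => by
      change G.loc h' (F.loc h _) = H.loc h'' _
      rw [Hom.loc_algebraMap, Hom.loc_algebraMap, Hom.loc_algebraMap, hring]
  exact congrArg (fun f => f x) this

/-- The restriction map between the affine charts `Spec B[1 / coord k, k ∈ S]^inv`. -/
def specRes {S T : Set σ} (h : S ⊆ T) :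
    Spec (CommRingCat.of (P.invRing T)) ⟶ Spec (CommRingCat.of (P.invRing S)) :=
  Spec.map (CommRingCat.ofHom (P.res h).toRingHom)

lemma specRes_refl (S : Set σ) : P.specRes (subset_refl S) = 𝟙 _ := by
  refine (congrArg Spec.map (CommRingCat.hom_ext (RingHom.ext fun x => ?_))).trans (Spec.map_id _)
  exact Subtype.ext (P.loc_id_id S x.1)

lemma specRes_comp {S T U : Set σ} (h : S ⊆ T) (h' : T ⊆ U) :
    P.specRes h' ≫ P.specRes h = P.specRes (h.trans h') := by
  refine (Spec.map_comp _ _).symm.trans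
    (congrArg Spec.map (CommRingCat.hom_ext (RingHom.ext fun x => ?_)))
  exact Subtype.ext (loc_loc (Hom.id P) (Hom.id P) (Hom.id P) (fun _ => rfl)
      (fun _ hk => h hk) (fun _ hk => h' hk) (fun _ hk => h' (h hk)) x.1)

/-- The affine charts of the quotient, with their inclusions. -/
def diagram : P.Chartᵒᵖ ⥤ Scheme.{0} where
  obj S := Spec (CommRingCat.of (P.invRing S.unop.1))
  map g := P.specRes (leOfHom g.unop)
  map_id S := P.specRes_refl S.unop.1
  map_comp f g := (P.specRes_comp (leOfHom g.unop) (leOfHom f.unop)).symm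

lemma coe_res {S T : Set σ} (h : S ⊆ T) (x : P.invRing S) :
    (P.res h x : P.Loc T) = (Hom.id P).loc (fun _ hk => h hk) x.1 := rfl

lemma loc_id_algebraMap {S T : Set σ} (h : S ⊆ T) (b : B) :
    (Hom.id P).loc (fun _ hk => h hk) (algebraMap B (P.Loc S) b) = algebraMap B (P.Loc T) b :=
  Hom.loc_algebraMap _ _ b

lemma mon_mem {S : Set σ} {n : Multiset σ} (hn : ∀ k ∈ n, k ∈ S) : P.mon n ∈ P.denoms S := by
  refine Submonoid.multiset_prod_mem _ _ fun c hc => ?_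
  obtain ⟨k, hk, rfl⟩ := Multiset.mem_map.mp hc
  exact Submonoid.subset_closure ⟨k, hn k hk, rfl⟩

lemma mon_unit {S : Set σ} {n : Multiset σ} (hn : ∀ k ∈ n, k ∈ S) :
    IsUnit (algebraMap B (P.Loc S) (P.mon n)) :=
  IsLocalization.map_units _ (⟨_, P.mon_mem hn⟩ : P.denoms S)

lemma mon_add (m n : Multiset σ) : P.mon (m + n) = P.mon m * P.mon n := by simp [mon]

lemma deg_add (m n : Multiset σ) : P.deg (m + n) = P.deg m + P.deg n := by simp [deg]

lemma mon_nsmul (N : ℕ) (m : Multiset σ) : P.mon (N • m) = P.mon m ^ N := by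
  simp [mon, Multiset.map_nsmul, Multiset.prod_nsmul]

lemma deg_nsmul (N : ℕ) (m : Multiset σ) : P.deg (N • m) = N • P.deg m := by
  simp [deg, Multiset.map_nsmul, Multiset.sum_nsmul]

/-- The invariant fraction `mon m / mon n` on the chart `S`. -/
def frac (S : Set σ) (m n : Multiset σ) (hn : ∀ k ∈ n, k ∈ S) (hd : P.deg m = P.deg n) :
    P.invRing S :=
  ⟨IsLocalization.mk' (P.Loc S) (P.mon m) (⟨_, P.mon_mem hn⟩ : P.denoms S),
    Algebra.subset_adjoin ⟨m, n, hn, hd, IsLocalization.mk'_spec _ _ _⟩⟩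

lemma frac_spec (S : Set σ) (m n : Multiset σ) (hn : ∀ k ∈ n, k ∈ S) (hd : P.deg m = P.deg n) :
    (P.frac S m n hn hd : P.Loc S) * algebraMap B (P.Loc S) (P.mon n) =
      algebraMap B (P.Loc S) (P.mon m) := IsLocalization.mk'_spec _ _ _

lemma res_frac {S T : Set σ} (h : S ⊆ T) (m n : Multiset σ) (hn : ∀ k ∈ n, k ∈ S)
    (hd : P.deg m = P.deg n) :
    P.res h (P.frac S m n hn hd) = P.frac T m n (fun k hk => h (hn k hk)) hd := by
  refine Subtype.ext ((P.mon_unit fun k hk => h (hn k hk)).mul_right_cancel ?_)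
  rw [frac_spec, coe_res, ← P.loc_id_algebraMap h, ← P.loc_id_algebraMap h, ← map_mul, frac_spec]

/-- A weight-zero fraction whose numerator involves exactly the coordinates in `T`. -/
lemma exists_frac [Finite σ] {S T : Set σ} (hS : S ∈ P.charts) (hST : S ⊆ T) :
    ∃ m n : Multiset σ, (∀ k ∈ n, k ∈ S) ∧ (∀ k, k ∈ m ↔ k ∈ T) ∧ P.deg m = P.deg n := by
  have key : ∀ d ∈ AddSubgroup.closure (P.weight '' S), ∃ p q : Multiset σ,
      (∀ k ∈ p, k ∈ S) ∧ (∀ k ∈ q, k ∈ S) ∧ d + P.deg q = P.deg p := by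
    intro d hd
    induction hd using AddSubgroup.closure_induction with
    | mem x hx =>
      obtain ⟨k, hk, rfl⟩ := hx
      exact ⟨{k}, 0, by simpa using hk, by simp, by simp [deg]⟩
    | zero => exact ⟨0, 0, by simp, by simp, by simp⟩
    | add x y _ _ hx hy =>
      obtain ⟨p, q, hp, hq, h⟩ := hx
      obtain ⟨p', q', hp', hq', h'⟩ := hy
      refine ⟨p + p', q + q', ?_, ?_, ?_⟩
      · intro k hk
        exact (Multiset.mem_add.mp hk).elim (hp k) (hp' k)
      · intro k hk
        exact (Multiset.mem_add.mp hk).elim (hq k) (hq' k)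
      · rw [deg_add, deg_add, ← h, ← h']
        abel
    | neg x _ hx =>
      obtain ⟨p, q, hp, hq, h⟩ := hx
      refine ⟨q, p, hq, hp, ?_⟩
      rw [← h]
      abel
  have hT : P.deg T.toFinite.toFinset.val ∈ AddSubgroup.closure (P.weight '' S) := by
    refine AddSubgroup.multiset_sum_mem _ _ fun c hc => ?_
    obtain ⟨k, -, rfl⟩ := Multiset.mem_map.mp hc
    exact P.weight_mem hS k
  obtain ⟨p, q, hp, hq, h⟩ := key _ hT
  refine ⟨T.toFinite.toFinset.val + q, p, hp, fun k => ?_, ?_⟩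
  · have := hq k
    have := @hST k
    simp only [Multiset.mem_add, Finset.mem_val, Set.Finite.mem_toFinset]
    tauto
  · rw [deg_add, h]


lemma exists_add_eq_nsmul {T : Set σ} {a m : Multiset σ} (ha : ∀ k ∈ a, k ∈ T)
    (hm : ∀ k, k ∈ m ↔ k ∈ T) : ∃ c, a + c = a.card • m := by
  have : a ≤ a.card • m := by
    classical
    refine Multiset.le_iff_count.mpr fun k => ?_
    by_cases hk : k ∈ a
    · have h1 : 1 ≤ m.count k := Multiset.one_le_count_iff_mem.mpr ((hm k).mpr (ha k hk))
      rw [Multiset.count_nsmul]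
      exact (Multiset.count_le_card k a).trans (Nat.le_mul_of_pos_right _ h1)
    · simp [Multiset.count_eq_zero_of_notMem hk]
  obtain ⟨c, hc⟩ := Multiset.le_iff_exists_add.mp this
  exact ⟨c, hc.symm⟩

lemma exists_mon_of_mem_denoms {S : Set σ} {b : B} (hb : b ∈ P.denoms S) :
    ∃ n : Multiset σ, (∀ k ∈ n, k ∈ S) ∧ P.mon n = b := by
  induction hb using Submonoid.closure_induction with
  | mem x hx =>
    obtain ⟨k, hk, rfl⟩ := hx
    exact ⟨{k}, by simpa using hk, by simp [mon]⟩
  | one => exact ⟨0, by simp, by simp [mon]⟩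
  | mul x y _ _ hx hy =>
    obtain ⟨p, hp, rfl⟩ := hx
    obtain ⟨q, hq, rfl⟩ := hy
    exact ⟨p + q, fun k hk => (Multiset.mem_add.mp hk).elim (hp k) (hq k), P.mon_add p q⟩

/-- The restriction of invariants from a chart to a smaller chart is the localization at one
element. -/
lemma isLocalization_res {S T : Set σ} (h : S ⊆ T) (m n : Multiset σ) (hn : ∀ k ∈ n, k ∈ S)
    (hm : ∀ k, k ∈ m ↔ k ∈ T) (hd : P.deg m = P.deg n) :
    @IsLocalization.Away _ _ (P.frac S m n hn hd) (P.invRing T) _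
      (P.res h).toRingHom.toAlgebra := by
  let _ : Algebra (P.invRing S) (P.invRing T) := (P.res h).toRingHom.toAlgebra
  let f := P.frac S m n hn hd
  have hnT : ∀ k ∈ n, k ∈ T := fun k hk => h (hn k hk)
  have hmap : ∀ x, algebraMap (P.invRing S) (P.invRing T) x = P.res h x := fun _ => rfl
  have hfT : P.res h f = P.frac T m n hnT hd := P.res_frac h m n hn hd
  have hunit : IsUnit (P.res h f) := by
    rw [hfT]
    refine IsUnit.of_mul_eq_one (P.frac T n m (fun k hk => (hm k).mp hk) hd.symm)
      (Subtype.ext ?_)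
    refine (P.mon_unit hnT).mul_right_cancel ?_
    have h1 := P.frac_spec T m n hnT hd
    have h2 := P.frac_spec T n m (fun k hk => (hm k).mp hk) hd.symm
    simp only [MulMemClass.coe_mul, OneMemClass.coe_one, one_mul]
    rw [mul_right_comm, h1, mul_comm, h2]
  have hsurj : ∀ z : P.Loc T, z ∈ P.invRing T →
      ∃ (N : ℕ) (x : P.invRing S), z * (P.res h f : P.Loc T) ^ N = P.res h x := by
    intro z hz
    induction hz using Algebra.adjoin_induction with
    | mem z hz =>
      obtain ⟨p, q, hq, hpq, hz⟩ := hz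
      obtain ⟨c, hc⟩ := exists_add_eq_nsmul hq hm
      have hN : ∀ k ∈ q.card • n, k ∈ S := fun k hk => hn k (Multiset.mem_of_mem_nsmul hk)
      have hdeg : P.deg (p + c) = P.deg (q.card • n) := by
        rw [deg_add, hpq, ← deg_add, hc, deg_nsmul, deg_nsmul, hd]
      refine ⟨q.card, P.frac S (p + c) (q.card • n) hN hdeg, ?_⟩
      rw [P.res_frac h (p + c)]
      refine (P.mon_unit (fun k hk => h (hN k hk))).mul_right_cancel ?_
      rw [hfT, frac_spec, mon_nsmul, map_pow, mul_assoc, ← mul_pow, frac_spec, ← map_pow,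
        ← mon_nsmul, ← hc, mon_add, mon_add, map_mul, map_mul, ← hz]
      ring
    | algebraMap r =>
      exact ⟨0, algebraMap ℂ _ r, by rw [pow_zero, mul_one, (P.res h).commutes]; rfl⟩
    | add z w _ _ hz hw =>
      obtain ⟨N, x, hx⟩ := hz
      obtain ⟨M, y, hy⟩ := hw
      refine ⟨N + M, x * f ^ M + y * f ^ N, ?_⟩
      rw [map_add, map_mul, map_mul, map_pow, map_pow]
      push_cast
      rw [← hx, ← hy]
      ring
    | mul z w _ _ hz hw =>
      obtain ⟨N, x, hx⟩ := hz
      obtain ⟨M, y, hy⟩ := hw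
      refine ⟨N + M, x * y, ?_⟩
      rw [map_mul]
      push_cast
      rw [← hx, ← hy]
      ring
  have hker : ∀ x : P.invRing S, P.res h x = 0 → ∃ N : ℕ, f ^ N * x = 0 := by
    intro x hx
    obtain ⟨b, s, hbs⟩ := IsLocalization.exists_mk'_eq (P.denoms S) x.1
    have hb : algebraMap B (P.Loc S) b = x.1 * algebraMap B (P.Loc S) s := by
      rw [← hbs, IsLocalization.mk'_spec]
    have hb0 : algebraMap B (P.Loc T) b = 0 := by
      rw [← P.loc_id_algebraMap h, hb, map_mul, ← coe_res, hx]
      simp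
    obtain ⟨t, ht⟩ := (IsLocalization.map_eq_zero_iff (P.denoms T) (P.Loc T) b).mp hb0
    obtain ⟨q, hq, hqt⟩ := P.exists_mon_of_mem_denoms t.2
    obtain ⟨c, hc⟩ := exists_add_eq_nsmul hq hm
    have hx0 : algebraMap B (P.Loc S) (P.mon q) * x.1 = 0 := by
      refine (IsLocalization.map_units (P.Loc S) s).mul_right_cancel ?_
      rw [mul_assoc, ← hb, ← map_mul, hqt, ht, map_zero, zero_mul]
    refine ⟨q.card, Subtype.ext ?_⟩
    refine ((P.mon_unit hn).pow q.card).mul_right_cancel ?_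
    push_cast
    rw [mul_right_comm, ← mul_pow, frac_spec, ← map_pow, ← mon_nsmul, ← hc, mon_add, map_mul,
      mul_right_comm, hx0]
    simp
  refine ⟨?_, ?_, ?_⟩
  · rintro ⟨_, N, rfl⟩
    rw [hmap, map_pow]
    exact hunit.pow N
  · intro z
    obtain ⟨N, x, hx⟩ := hsurj z.1 z.2
    refine ⟨(x, ⟨f ^ N, N, rfl⟩), Subtype.ext ?_⟩
    rw [hmap, hmap, map_pow, ← hx]
    rfl
  · intro x y hxy
    rw [hmap, hmap] at hxy
    obtain ⟨N, hN⟩ := hker (x - y) (by rw [map_sub, hxy, sub_self])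
    exact ⟨⟨f ^ N, N, rfl⟩, by rwa [mul_sub, sub_eq_zero] at hN⟩

instance isOpenImmersion_diagram_map [Finite σ] {S T : P.Chartᵒᵖ} (g : S ⟶ T) :
    IsOpenImmersion (P.diagram.map g) := by
  have hTS : T.unop.1 ⊆ S.unop.1 := leOfHom g.unop
  obtain ⟨m, n, hn, hm, hd⟩ := P.exists_frac T.unop.2 hTS
  let _ : Algebra (P.invRing T.unop.1) (P.invRing S.unop.1) := (P.res hTS).toRingHom.toAlgebra
  have := P.isLocalization_res hTS m n hn hm hd
  exact IsOpenImmersion.of_isLocalization (P.frac T.unop.1 m n hn hd)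

lemma mem_range_diagram_map {S T : P.Chartᵒᵖ} (g : S ⟶ T) (m n : Multiset σ)
    (hn : ∀ k ∈ n, k ∈ T.unop.1) (hm : ∀ k, k ∈ m ↔ k ∈ S.unop.1) (hd : P.deg m = P.deg n)
    (x : PrimeSpectrum (P.invRing T.unop.1)) :
    (∃ y, P.diagram.map g y = x) ↔ P.frac T.unop.1 m n hn hd ∉ x.asIdeal := by
  have hTS : T.unop.1 ⊆ S.unop.1 := leOfHom g.unop
  let _ : Algebra (P.invRing T.unop.1) (P.invRing S.unop.1) := (P.res hTS).toRingHom.toAlgebra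
  have := P.isLocalization_res hTS m n hn hm hd
  have := PrimeSpectrum.localization_away_comap_range (P.invRing S.unop.1)
    (P.frac T.unop.1 m n hn hd)
  exact Set.ext_iff.mp this x

instance isLocallyDirected_diagram [Finite σ] :
    (P.diagram ⋙ Scheme.forget).IsLocallyDirected where
  cond := by
    intro S₁ S₂ S₀ g₁ g₂ x₁ x₂ hx
    have h₁ : S₀.unop.1 ⊆ S₁.unop.1 := leOfHom g₁.unop
    have h₂ : S₀.unop.1 ⊆ S₂.unop.1 := leOfHom g₂.unop
    let V : P.Chart := ⟨S₁.unop.1 ∪ S₂.unop.1, P.charts_mono S₁.unop.2 Set.subset_union_left⟩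
    let l₁ : op V ⟶ S₁ := (homOfLE (show S₁.unop ≤ V from Set.subset_union_left)).op
    let l₂ : op V ⟶ S₂ := (homOfLE (show S₂.unop ≤ V from Set.subset_union_right)).op
    change P.diagram.map g₁ x₁ = P.diagram.map g₂ x₂ at hx
    -- `D(f₁) ∩ D(f₂) = D(f₁ f₂)` in the chart `S₀`
    obtain ⟨m₁, n₁, hn₁, hm₁, hd₁⟩ := P.exists_frac S₀.unop.2 h₁
    obtain ⟨m₂, n₂, hn₂, hm₂, hd₂⟩ := P.exists_frac S₀.unop.2 h₂
    have hn : ∀ k ∈ n₁ + n₂, k ∈ S₀.unop.1 := fun k hk =>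
      (Multiset.mem_add.mp hk).elim (hn₁ k) (hn₂ k)
    have hm : ∀ k, k ∈ m₁ + m₂ ↔ k ∈ (op V).unop.1 := fun k => by
      rw [Multiset.mem_add, hm₁, hm₂]
      rfl
    have hd : P.deg (m₁ + m₂) = P.deg (n₁ + n₂) := by rw [deg_add, deg_add, hd₁, hd₂]
    have hmul : P.frac S₀.unop.1 (m₁ + m₂) (n₁ + n₂) hn hd =
        P.frac S₀.unop.1 m₁ n₁ hn₁ hd₁ * P.frac S₀.unop.1 m₂ n₂ hn₂ hd₂ := by
      refine Subtype.ext ((P.mon_unit hn).mul_right_cancel ?_)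
      rw [frac_spec, MulMemClass.coe_mul, mon_add, mon_add, map_mul, map_mul,
        mul_mul_mul_comm, frac_spec, frac_spec]
    have hV : ∃ y, P.diagram.map (l₁ ≫ g₁) y = P.diagram.map g₁ x₁ := by
      refine (P.mem_range_diagram_map (l₁ ≫ g₁) _ _ hn hm hd _).mpr ?_
      rw [hmul]
      refine fun hmem => ((P.diagram.map g₁ x₁).isPrime.mem_or_mem hmem).elim ?_ ?_
      · exact (P.mem_range_diagram_map g₁ m₁ n₁ hn₁ hm₁ hd₁ _).mp ⟨x₁, rfl⟩
      · exact (P.mem_range_diagram_map g₂ m₂ n₂ hn₂ hm₂ hd₂ _).mp ⟨x₂, hx.symm⟩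
    obtain ⟨y, hy⟩ := hV
    refine ⟨op V, l₁, l₂, y, ?_, ?_⟩
    · apply (P.diagram.map g₁).isOpenEmbedding.injective
      rw [← hy, Functor.map_comp]
      rfl
    · apply (P.diagram.map g₂).isOpenEmbedding.injective
      have : l₁ ≫ g₁ = l₂ ≫ g₂ := Subsingleton.elim _ _
      rw [this, Functor.map_comp] at hy
      exact hy.trans hx

/-- The quotient by the torus of the open subscheme given by the charts, obtained
by gluing the spectra of the rings of invariants of the charts. -/
def quotient [Finite σ] : Scheme.{0} := colimit P.diagram

/-- The inclusion of a chart in the quotient. -/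
def chartMap [Finite σ] {S : Set σ} (hS : S ∈ P.charts) :
    Spec (CommRingCat.of (P.invRing S)) ⟶ P.quotient :=
  colimit.ι P.diagram (op ⟨S, hS⟩)

lemma specRes_chartMap [Finite σ] {S T : Set σ} (hS : S ∈ P.charts) (hT : T ∈ P.charts)
    (h : S ⊆ T) : P.specRes h ≫ P.chartMap hS = P.chartMap hT :=
  colimit.w P.diagram (homOfLE (show (⟨S, hS⟩ : P.Chart) ≤ ⟨T, hT⟩ from h)).op

/-- Gluing of morphisms that are given on the charts. -/
def glue [Finite σ] {Z : Scheme.{0}}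
    (f : ∀ {S : Set σ}, S ∈ P.charts → (Spec (CommRingCat.of (P.invRing S)) ⟶ Z))
    (hf : ∀ {S T : Set σ} (hS : S ∈ P.charts) (hT : T ∈ P.charts) (h : S ⊆ T),
      P.specRes h ≫ f hS = f hT) : P.quotient ⟶ Z :=
  colimit.desc P.diagram
    { pt := Z
      ι :=
        { app := fun S => f S.unop.2
          naturality := fun S T g =>
            (hf T.unop.2 S.unop.2 (leOfHom g.unop)).trans (Category.comp_id _).symm } }

lemma chartMap_glue [Finite σ] {Z : Scheme.{0}}
    (f : ∀ {S : Set σ}, S ∈ P.charts → (Spec (CommRingCat.of (P.invRing S)) ⟶ Z))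
    (hf : ∀ {S T : Set σ} (hS : S ∈ P.charts) (hT : T ∈ P.charts) (h : S ⊆ T),
      P.specRes h ≫ f hS = f hT) {S : Set σ} (hS : S ∈ P.charts) :
    P.chartMap hS ≫ P.glue f hf = f hS :=
  colimit.ι_desc _ _

/-- The structure morphism of the quotient. -/
def quotientToSpec [Finite σ] : P.quotient ⟶ Spec (CommRingCat.of ℂ) :=
  P.glue (fun {S} _ => Spec.map (CommRingCat.ofHom (algebraMap ℂ (P.invRing S))))
    fun _ _ h => (Spec.map_comp _ _).symm.trans
      (congrArg Spec.map (CommRingCat.hom_ext (RingHom.ext fun c => (P.res h).commutes c)))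

/-- The map of quotients induced by an equivariant map. -/
def Hom.quotientMap [Finite σ] [Finite σ'] {P : TorusAction σ D B} {P' : TorusAction σ' D' B'}
    (F : Hom P P') : P'.quotient ⟶ P.quotient :=
  P'.glue
    (fun {S} hS => Spec.map (CommRingCat.ofHom
      (F.inv (S := F.idx ⁻¹' S) (S' := S) fun _ hk => hk).toRingHom) ≫
        P.chartMap (F.preimage_mem S hS))
    (by
      intro S T hS hT h
      have h' : F.idx ⁻¹' S ⊆ F.idx ⁻¹' T := fun _ hk => h hk
      rw [← P.specRes_chartMap (F.preimage_mem S hS) (F.preimage_mem T hT) h',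
        ← Category.assoc, ← Category.assoc]
      refine congrArg (· ≫ P.chartMap (F.preimage_mem S hS)) ?_
      refine (Spec.map_comp _ _).symm.trans (Eq.trans (congrArg Spec.map
        (CommRingCat.hom_ext (RingHom.ext fun x => Subtype.ext ?_))) (Spec.map_comp _ _))
      exact (loc_loc F (Hom.id P') F (fun _ => rfl) (fun _ hk => hk)
        (fun _ hk => h hk) (fun _ hk => h hk) x.1).trans
        (loc_loc (Hom.id P) F F (fun _ => rfl) (fun _ hk => h hk)
        (fun _ hk => hk) (fun _ hk => h hk) x.1).symm)

end TorusAction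
/-! ## The monodromy spaces -/

/-- The topological monodromy: the product of the formal monodromy `diag(α, 1/α)` and the four
Stokes matrices with entries `a₁, a₂, a₃, a₄` (here `a 0, a 1, a 2, a 3`), with respect to the
basis `e₁, e₂` of `V(∞)`. -/
def topMonodromy {A : Type} [CommRing A] [Algebra ℂ A] (α : ℂ) (a : Fin 4 → A) :
    Matrix (Fin 2) (Fin 2) A :=
  !![algebraMap ℂ A α, 0; 0, algebraMap ℂ A α⁻¹] * !![1, 0; a 0, 1] * !![1, a 1; 0, 1] *
    !![1, 0; a 2, 1] * !![1, a 3; 0, 1]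

/-- The equation `trace top = s` for the Stokes data. -/
def monodromyIdeal (s α : ℂ) : Ideal (MvPolynomial (Fin 4) ℂ) :=
  Ideal.span {(topMonodromy α MvPolynomial.X).trace - MvPolynomial.C s}

/-- The coordinate ring of `{a ∈ ℂ⁴ | trace top = s}`. -/
abbrev MonodromyRing (s α : ℂ) : Type := MvPolynomial (Fin 4) ℂ ⧸ monodromyIdeal s α

/-- The weights of the Stokes data: the base change `e₁, e₂ ↦ λ e₁, λ⁻¹ e₂` multiplies
`a₁, a₃` by `λ²` and `a₂, a₄` by `λ⁻²`. -/
def stokesWeight : Fin 4 → ℤ := ![2, -2, 2, -2]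

/-- The action of `𝔾_m` on the Stokes data `a ≠ 0` with `trace top = s`. -/
def monodromyAction (s α : ℂ) : TorusAction (Fin 4) ℤ (MonodromyRing s α) where
  coord k := Ideal.Quotient.mk _ (MvPolynomial.X k)
  weight := stokesWeight
  charts := {S | S.Nonempty}
  charts_mono h hST := h.mono hST
  weight_mem := by
    rintro S ⟨j, hj⟩ k
    have hmem : stokesWeight j ∈ AddSubgroup.closure (stokesWeight '' S) :=
      AddSubgroup.subset_closure ⟨j, hj, rfl⟩
    have : stokesWeight k = stokesWeight j ∨ stokesWeight k = - stokesWeight j := by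
      fin_cases j <;> fin_cases k <;> simp [stokesWeight]
    rcases this with h | h <;> rw [h]
    · exact hmem
    · exact neg_mem hmem

/-- The fibre `𝓡[s, α]` of the monodromy space: the Stokes data `a ∈ ℂ⁴ ∖ {0}` with
`trace top = s`, modulo `𝔾_m`; it is glued from the four slices `a_j = 1`. -/
def monodromySpace (s α : ℂ) : Scheme.{0} := (monodromyAction s α).quotient

/-- The structure morphism of `𝓡[s, α]`. -/
def monodromySpaceToSpec (s α : ℂ) : monodromySpace s α ⟶ Spec (CommRingCat.of ℂ) :=
  (monodromyAction s α).quotientToSpec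

/-- The Stokes data among the variables `(a, y)`. -/
def stokesVar (k : Fin 4) : MvPolynomial (Fin 4 ⊕ Fin 2) ℂ := MvPolynomial.X (Sum.inl k)

/-- The coordinates `(y₁, y₂)` of a vector `y₁ e₁ + y₂ e₂` of `V(∞)`. -/
def vectorVar (i : Fin 2) : MvPolynomial (Fin 4 ⊕ Fin 2) ℂ := MvPolynomial.X (Sum.inr i)

/-- The equations `trace top = β + β⁻¹` and `top y = β y`. -/
def levelIdeal (β α : ℂ) : Ideal (MvPolynomial (Fin 4 ⊕ Fin 2) ℂ) :=
  Ideal.span ({(topMonodromy α stokesVar).trace - MvPolynomial.C (β + β⁻¹)} ∪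
    Set.range fun i => (topMonodromy α stokesVar).mulVec vectorVar i -
      MvPolynomial.C β * vectorVar i)

/-- The coordinate ring of `{(a, y) ∈ ℂ⁴ × ℂ² | trace top = β + β⁻¹, top y = β y}`. -/
abbrev LevelRing (β α : ℂ) : Type := MvPolynomial (Fin 4 ⊕ Fin 2) ℂ ⧸ levelIdeal β α

/-- The weights of `(a, y)` for the product of the base changes `e₁, e₂ ↦ λ e₁, λ⁻¹ e₂`, which
multiply `y₁, y₂` by `λ⁻¹, λ`, and the homotheties of the vector `y`. -/
def levelWeight : Fin 4 ⊕ Fin 2 → ℤ × ℤ :=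
  Sum.elim (fun k => (stokesWeight k, 0)) ![(-1, 1), (1, 1)]

/-- The action of `𝔾_m × 𝔾_m` on the pairs `(a, y)`, `a ≠ 0`, `y ≠ 0`, with
`trace top = β + β⁻¹` and `top y = β y`. -/
def levelAction (β α : ℂ) : TorusAction (Fin 4 ⊕ Fin 2) (ℤ × ℤ) (LevelRing β α) where
  coord k := Ideal.Quotient.mk _ (MvPolynomial.X k)
  weight := levelWeight
  charts := {S | (∃ k : Fin 4, Sum.inl k ∈ S) ∧ ∃ i : Fin 2, Sum.inr i ∈ S}
  charts_mono h hST := ⟨h.1.imp fun _ hk => hST hk, h.2.imp fun _ hi => hST hi⟩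
  weight_mem := by
    rintro S ⟨⟨j, hj⟩, ⟨i, hi⟩⟩ k
    have h₁ : levelWeight (Sum.inl j) ∈ AddSubgroup.closure (levelWeight '' S) :=
      AddSubgroup.subset_closure ⟨_, hj, rfl⟩
    have h₂ : levelWeight (Sum.inr i) ∈ AddSubgroup.closure (levelWeight '' S) :=
      AddSubgroup.subset_closure ⟨_, hi, rfl⟩
    have h₃ : ((2, 0) : ℤ × ℤ) ∈ AddSubgroup.closure (levelWeight '' S) := by
      have : levelWeight (Sum.inl j) = (2, 0) ∨ levelWeight (Sum.inl j) = -(2, 0) := by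
        fin_cases j <;> simp [levelWeight, stokesWeight]
      rcases this with h | h <;> rw [h] at h₁
      · exact h₁
      · simpa using neg_mem h₁
    rcases k with k | k
    · have : levelWeight (Sum.inl k) = (2, 0) ∨ levelWeight (Sum.inl k) = -(2, 0) := by
        fin_cases k <;> simp [levelWeight, stokesWeight]
      rcases this with h | h <;> rw [h]
      · exact h₃
      · exact neg_mem h₃
    · have : levelWeight (Sum.inr k) = levelWeight (Sum.inr i) ∨
          levelWeight (Sum.inr k) = levelWeight (Sum.inr i) + (2, 0) ∨
          levelWeight (Sum.inr k) = levelWeight (Sum.inr i) - (2, 0) := by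
        fin_cases k <;> fin_cases i <;> simp [levelWeight]
      rcases this with h | h | h <;> rw [h]
      · exact h₂
      · exact add_mem h₂ h₃
      · exact sub_mem h₂ h₃

/-- The fibre `𝓡⁺(β, α)` of the monodromy space with level structure: the points of
`𝓡[β + β⁻¹, α]` together with a line `L = ℂ y` in `V(∞)` on which `top` acts as `β`. -/
def levelSpace (β α : ℂ) : Scheme.{0} := (levelAction β α).quotient

/-- The equivariant map `(a, y) ↦ a`. -/
def forgetLine (β α : ℂ) :
    TorusAction.Hom (monodromyAction (β + β⁻¹) α) (levelAction β α) where
  ring := Ideal.quotientMapₐ (levelIdeal β α) (MvPolynomial.rename Sum.inl) (by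
    refine Ideal.span_le.mpr ?_
    rintro _ rfl
    refine Ideal.subset_span (Or.inl ?_)
    simp [topMonodromy, stokesVar, Matrix.trace_fin_two])
  idx := Sum.inl
  wt := AddMonoidHom.inl ℤ ℤ
  ring_coord k := by
    change Ideal.Quotient.mk _ (MvPolynomial.rename Sum.inl (MvPolynomial.X k)) = _
    rw [MvPolynomial.rename_X]
    rfl
  wt_weight _ := rfl
  preimage_mem _ h := h.1

/-- The map `𝓡⁺(β, α) ⟶ 𝓡[β + β⁻¹, α]` that forgets the level structure. -/
def levelMap (β α : ℂ) : levelSpace β α ⟶ monodromySpace (β + β⁻¹) α :=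
  (forgetLine β α).quotientMap

/-! ## Resolutions of singularities -/

/-- A point of a `ℂ`-scheme is singular if no neighbourhood of it is smooth over `ℂ`. -/
def IsSingularPoint {Y : Scheme.{0}} (p : Y ⟶ Spec (CommRingCat.of ℂ)) (y : Y) : Prop :=
  ∀ U : Y.Opens, y ∈ U → ¬ Smooth (U.ι ≫ p)

/-- A resolution of a `ℂ`-scheme `Y`: a proper birational morphism from a scheme which is smooth
over `ℂ`. -/
structure IsResolution {X Y : Scheme.{0}} (p : Y ⟶ Spec (CommRingCat.of ℂ)) (f : X ⟶ Y) :
    Prop where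
  proper : IsProper f
  smooth : Smooth (f ≫ p)
  birational : ∃ U : Y.Opens, Dense (U : Set Y) ∧ Dense ((f ⁻¹ᵁ U : X.Opens) : Set X) ∧
    IsIso (f ∣_ U)

/-- The minimal resolution: a resolution through which every resolution factors uniquely. -/
structure IsMinimalResolution {X Y : Scheme.{0}} (p : Y ⟶ Spec (CommRingCat.of ℂ))
    (f : X ⟶ Y) : Prop where
  isResolution : IsResolution p f
  factors : ∀ {Z : Scheme.{0}} (g : Z ⟶ Y), IsResolution p g → ∃! h : Z ⟶ X, h ≫ f = g

end

/-! Put `N = top - β`. As `det top = 1`, `trace top = 2β` and `β² = 1`, the matrix `N` has trace and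
determinant zero, so `N² = 0`, and a point of `𝓡⁺` is a point of `𝓡` with a line in the kernel of
`N`. Where `N ≠ 0` the kernel is spanned by a column of `N`, so the map is an isomorphism there.
Where `N = 0` the fibre is a projective line. A line over the fraction field of a valuation ring
extends uniquely, so the map is proper (`KernelCharts.isProper`).

Smoothness of `𝓡⁺`: on a chart the eigenvector equations reduce to a single equation whose partial
derivatives have no common zero with `a ≠ 0`, so solutions lift along square-zero ideals
(`exists_lift_mulVec`). Birationality: every closed point of `𝓡⁺` over `N = 0` has a tangent vector
along which `N` does not stay zero (`exists_dualNumber_mulVec`), so the part over `N ≠ 0` is dense.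

Minimality: let `Z` be smooth and birational over `𝓡`, and let `A` be the local ring of a closed
point of `Z`. It is regular of dimension at most two, hence a GCD domain. Let `(x, y; z, -x)` be the
pulled back matrix and `x / y = q / p` in lowest terms. A lift to `𝓡⁺` needs a kernel vector with a
unit coordinate, and `(p, -q)` is one as soon as `p` or `q` is a unit. From `x² + yz = 0` one gets
`y = W p²`, `x = W p q`, `z = -W q²`. Suppose that `p` and `q` both lie in the maximal ideal. Adjoin
`t = q / p` to the coordinate ring of the slice. There `x = t y` and `z = -t² y`, so the ideal of `N
= 0` is generated by `y`, and the quotient by `y` embeds in a polynomial ring in `t` over a field.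
Thus `y` vanishes to order one along the exceptional curve. By birationality `p` is a quotient of
functions on the slice, and it has positive order, so `y = W p²` has order at least two, a
contradiction (`exists_unimodular_of_fractions`).

The same lifting, applied to a smooth open subscheme of `𝓡`, gives a section, so the map is an
isomorphism above it. Hence the singular points are exactly the zeros of `N`, because the map is not
injective over those. On the slice `a_j = 1` the equation `N = 0` has the single solution
`scalarStokes β α j`. It lies in slice `k` exactly when its `k`-th coordinate is nonzero. This holds
for all `k` if `α ≠ β`, so the four points coincide. If `α = β` it holds only when `k - j` is even,
which leaves two points. -/

section

/-! ### Divisibility in regular local rings of dimension at most two -/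

open IsLocalRing

/-- Nakayama's lemma shows that the colon ideal `J = (a) : b` is principal. The image of `J` modulo
`u` is generated by the class of some `d ∈ J`, and `u * s ∈ J` forces `s ∈ J` because the prime `u`
does not divide `a`. Hence `J = (d) + u J`. -/
theorem exists_dvd_iff_of_not_dvd {A : Type*} [CommRing A] [IsDomain A]
    [IsNoetherianRing A] [IsLocalRing A] {u : A} (hu : Prime u)
    [IsPrincipalIdealRing (A ⧸ Ideal.span {u})] {a : A} (ha : ¬ u ∣ a) (b : A) :
    ∃ d, ∀ r, a ∣ r * b ↔ d ∣ r := by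
  let J : Ideal A := (Ideal.span {a}).colon {b}
  have hJ : ∀ r, r ∈ J ↔ a ∣ r * b := fun r => by
    simp [J, Submodule.mem_colon, Ideal.mem_span_singleton]
  obtain ⟨e, he⟩ := (IsPrincipalIdealRing.principal (J.map (Ideal.Quotient.mk (Ideal.span {u})))).principal
  obtain ⟨d, hdJ, rfl⟩ := (Ideal.mem_map_iff_of_surjective _ Ideal.Quotient.mk_surjective).mp
    (show e ∈ J.map (Ideal.Quotient.mk (Ideal.span {u})) by
      rw [he]; exact Submodule.mem_span_singleton_self e)
  have hle : J ≤ Ideal.span {d} := by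
    refine Submodule.le_of_le_smul_of_le_jacobson_bot (I := Ideal.span {u})
      (IsNoetherian.noetherian J) ?_ ?_
    · rw [IsLocalRing.jacobson_eq_maximalIdeal _ bot_ne_top, Ideal.span_singleton_le_iff_mem]
      exact hu.not_isUnit
    · intro r hr
      have : Ideal.Quotient.mk (Ideal.span {u}) r ∈ J.map (Ideal.Quotient.mk (Ideal.span {u})) :=
        Ideal.mem_map_of_mem _ hr
      rw [he] at this
      obtain ⟨c, hc⟩ := Submodule.mem_span_singleton.mp this
      obtain ⟨c, rfl⟩ := Ideal.Quotient.mk_surjective c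
      rw [smul_eq_mul, ← map_mul, eq_comm, Ideal.Quotient.eq, Ideal.mem_span_singleton] at hc
      obtain ⟨s, hs⟩ := hc
      have hsJ : s ∈ J := by
        have h1 : u * s ∈ J := hs ▸ J.sub_mem hr (J.mul_mem_left c hdJ)
        obtain ⟨x, hx⟩ := (hJ _).mp h1
        obtain ⟨y, rfl⟩ := (hu.dvd_or_dvd (show u ∣ a * x from ⟨s * b, by rw [← hx]; ring⟩)).resolve_left ha
        refine (hJ _).mpr ⟨y, mul_left_cancel₀ hu.ne_zero ?_⟩
        linear_combination hx
      rw [show r = c * d + u * s by linear_combination hs]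
      exact Submodule.add_mem_sup (Ideal.mul_mem_left _ _ (Ideal.mem_span_singleton_self d))
        (Submodule.smul_mem_smul (Ideal.mem_span_singleton_self u) hsJ)
  refine ⟨d, fun r => ⟨fun h => Ideal.mem_span_singleton.mp (hle ((hJ r).mpr h)), ?_⟩⟩
  rintro ⟨s, rfl⟩
  obtain ⟨x, hx⟩ := (hJ d).mp hdJ
  exact ⟨s * x, by linear_combination s * hx⟩

/-- Powers of `u` are split off from `a` one at a time. Such a factor either cancels against `b` or
becomes a factor of `d`. -/
theorem exists_dvd_iff_of_quotient_principal {A : Type*} [CommRing A] [IsDomain A]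
    [IsNoetherianRing A] [IsLocalRing A] {u : A} (hu : Prime u)
    [IsPrincipalIdealRing (A ⧸ Ideal.span {u})] (a b : A) : ∃ d, ∀ r, a ∣ r * b ↔ d ∣ r := by
  by_cases ha : a = 0
  · subst ha
    by_cases hb : b = 0
    · exact ⟨1, by simp [hb]⟩
    · exact ⟨0, by simp [hb]⟩
  obtain ⟨n, a, hua, rfl⟩ := WfDvdMonoid.max_power_factor ha hu.irreducible
  clear ha
  induction n generalizing b with
  | zero => simpa using exists_dvd_iff_of_not_dvd hu hua b
  | succ n ih =>
    by_cases hb : u ∣ b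
    · obtain ⟨b, rfl⟩ := hb
      obtain ⟨d, hd⟩ := ih b
      refine ⟨d, fun r => ?_⟩
      rw [← hd, show u ^ (n + 1) * a = u * (u ^ n * a) by ring, mul_left_comm r,
        mul_dvd_mul_iff_left hu.ne_zero]
    · obtain ⟨d, hd⟩ := ih b
      refine ⟨u * d, fun r => ⟨fun h => ?_, ?_⟩⟩
      · rw [show u ^ (n + 1) * a = u * (u ^ n * a) by ring] at h
        obtain ⟨s, rfl⟩ := (hu.dvd_or_dvd ((dvd_mul_right _ _).trans h)).resolve_right hb
        rw [mul_assoc, mul_dvd_mul_iff_left hu.ne_zero, hd] at h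
        exact mul_dvd_mul_left u h
      · rintro ⟨s, rfl⟩
        rw [show u ^ (n + 1) * a = u * (u ^ n * a) by ring, mul_assoc, mul_assoc,
          mul_dvd_mul_iff_left hu.ne_zero, ← mul_assoc, hd]
        exact dvd_mul_right _ _

/-- If `d` generates the colon ideal `(a) : b`, then `d * b` is a least common multiple of `a` and
`b`. -/
theorem isGCDMonoid_of_quotient_principal {A : Type*} [CommRing A] [IsDomain A]
    [IsNoetherianRing A] [IsLocalRing A] {u : A} (hu : Prime u)
    [IsPrincipalIdealRing (A ⧸ Ideal.span {u})] : IsGCDMonoid A := by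
  classical
  refine ⟨gcdMonoidOfExistsLCM fun a b => ?_⟩
  by_cases hb : b = 0
  · refine ⟨0, fun d => ?_⟩
    subst hb
    simp only [zero_dvd_iff, and_iff_right_iff_imp]
    rintro rfl
    exact dvd_zero a
  obtain ⟨d, hd⟩ := exists_dvd_iff_of_quotient_principal hu a b
  refine ⟨d * b, fun r => ⟨?_, fun h => ⟨?_, (dvd_mul_left b d).trans h⟩⟩⟩
  · rintro ⟨h, s, rfl⟩
    rw [mul_comm d b]
    exact mul_dvd_mul_left b ((hd s).mp (by rwa [mul_comm]))
  · obtain ⟨s, rfl⟩ := h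
    rw [mul_right_comm]
    exact (hd _).mpr (dvd_mul_right d s)

/-- By Krull's intersection theorem a nonzero element is `u ^ n * c` with `u` not dividing `c`. A
product of two such elements has the same form, since `(u)` is prime, and it is nonzero, since `u`
is regular. -/
theorem isDomain_of_prime_span_of_isSMulRegular {A : Type*} [CommRing A] [IsNoetherianRing A]
    [IsLocalRing A] {u : A} (hu : IsSMulRegular A u) (hp : (Ideal.span {u}).IsPrime) :
    IsDomain A := by
  have hdvd : ∀ {a b : A}, u ∣ a * b → u ∣ a ∨ u ∣ b := fun {a b} h => by
    simpa [Ideal.mem_span_singleton] using hp.mem_or_mem (Ideal.mem_span_singleton.mpr h)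
  have key : ∀ a : A, a ≠ 0 → ∃ n c, ¬ u ∣ c ∧ a = u ^ n * c := by
    intro a ha
    by_contra! hcon
    have hall : ∀ n, u ^ n ∣ a := by
      intro n
      induction n with
      | zero => simp
      | succ n ih =>
        obtain ⟨c, rfl⟩ := ih
        by_cases hc : u ∣ c
        · obtain ⟨c, rfl⟩ := hc
          exact ⟨c, by ring⟩
        · exact absurd rfl (hcon n c hc)
    have : a ∈ ⨅ i, Ideal.span {u} ^ i := by
      simp only [Submodule.mem_iInf, Ideal.span_singleton_pow, Ideal.mem_span_singleton]
      exact hall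
    rw [Ideal.iInf_pow_eq_bot_of_isLocalRing _ hp.ne_top] at this
    exact ha this
  have : NoZeroDivisors A := ⟨fun {a b} hab => by
    by_contra! h
    obtain ⟨n, c, hc, rfl⟩ := key a h.1
    obtain ⟨m, d, hd, rfl⟩ := key b h.2
    have h0 : c * d = 0 := (hu.pow (n + m)) (by
      simp only [smul_eq_mul, mul_zero]
      rw [← hab]; ring)
    exact (hdvd (h0 ▸ dvd_zero u)).elim hc hd⟩
  exact NoZeroDivisors.to_isDomain A

theorem isPrincipalIdealRing_of_maximalIdeal_eq_span {A : Type*} [CommRing A] [IsDomain A]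
    [IsNoetherianRing A] [IsLocalRing A] {u : A} (h : maximalIdeal A = Ideal.span {u}) :
    IsPrincipalIdealRing A :=
  ((tfae_of_isNoetherianRing_of_isLocalRing_of_isDomain A).out 0 4 rfl rfl).mpr ⟨u, h⟩

theorem isDomain_and_isPrincipalIdealRing_of_isSMulRegular {A : Type*} [CommRing A]
    [IsNoetherianRing A] [IsLocalRing A] {u : A} (hu : IsSMulRegular A u)
    (h : maximalIdeal A = Ideal.span {u}) : IsDomain A ∧ IsPrincipalIdealRing A := by
  have := isDomain_of_prime_span_of_isSMulRegular hu (h ▸ inferInstance)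
  exact ⟨this, isPrincipalIdealRing_of_maximalIdeal_eq_span h⟩

theorem isWeaklyRegular_pair_iff {A : Type*} [CommRing A] {u v : A} :
    RingTheory.Sequence.IsWeaklyRegular A [u, v] ↔
      IsSMulRegular A u ∧ ∀ x, u ∣ v * x → u ∣ x := by
  rw [RingTheory.Sequence.isWeaklyRegular_cons_iff, RingTheory.Sequence.isWeaklyRegular_cons_iff]
  unfold QuotSMulTop
  rw [isSMulRegular_quotient_iff_mem_of_smul_mem]
  simp only [Submodule.mem_smul_pointwise_iff_exists, Submodule.mem_top, true_and, smul_eq_mul]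
  refine and_congr_right fun _ => ⟨fun h x hx => ?_, fun h => ⟨fun x hx => ?_, .nil _ _⟩⟩
  · obtain ⟨c, hc⟩ := hx
    obtain ⟨d, hd⟩ := h.1 x ⟨c, hc.symm⟩
    exact ⟨d, hd.symm⟩
  · obtain ⟨c, hc⟩ := hx
    obtain ⟨d, hd⟩ := h x ⟨c, hc.symm⟩
    exact ⟨d, hd.symm⟩

/-- The maximal ideal of `A / u` is generated by the regular element `v`, so `A / u` is a principal
ideal domain. This makes `u` prime, and the criterion on colon ideals applies. -/
theorem isDomain_and_isGCDMonoid_of_isWeaklyRegular {A : Type*} [CommRing A] [IsNoetherianRing A]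
    [IsLocalRing A] {u v : A} (h : RingTheory.Sequence.IsWeaklyRegular A [u, v])
    (hm : maximalIdeal A = Ideal.span {u, v}) : IsDomain A ∧ IsGCDMonoid A := by
  obtain ⟨hu, hv⟩ := isWeaklyRegular_pair_iff.mp h
  have hum : u ∈ maximalIdeal A := hm ▸ Ideal.subset_span (by simp)
  let I : Ideal A := Ideal.span {u}
  have hI : I ≠ ⊤ := by
    simpa [I, Ideal.span_singleton_eq_top] using hum
  have : Nontrivial (A ⧸ I) := Ideal.Quotient.nontrivial_iff.mpr hI
  have : IsLocalRing (A ⧸ I) := .of_surjective' _ Ideal.Quotient.mk_surjective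
  have hv : IsSMulRegular (A ⧸ I) (Ideal.Quotient.mk I v) := by
    intro x y hxy
    obtain ⟨x, rfl⟩ := Ideal.Quotient.mk_surjective x
    obtain ⟨y, rfl⟩ := Ideal.Quotient.mk_surjective y
    simp only [smul_eq_mul, ← map_mul] at hxy
    rw [Ideal.Quotient.eq, Ideal.mem_span_singleton] at hxy ⊢
    exact hv _ (by rwa [mul_sub])
  have hmI : maximalIdeal (A ⧸ I) = Ideal.span {Ideal.Quotient.mk I v} := by
    have : maximalIdeal (A ⧸ I) = (maximalIdeal A).map (Ideal.Quotient.mk I) :=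
      (IsLocalRing.map_maximalIdeal_of_surjective _ Ideal.Quotient.mk_surjective).symm
    rw [this, hm, Ideal.map_span, Set.image_pair, Ideal.Quotient.eq_zero_iff_mem.mpr
      (Ideal.mem_span_singleton_self u)]
    simp [Ideal.span_insert]
  obtain ⟨h1, h2⟩ := isDomain_and_isPrincipalIdealRing_of_isSMulRegular hv hmI
  have hp : I.IsPrime := (Ideal.Quotient.isDomain_iff_prime I).mp h1
  have := isDomain_of_prime_span_of_isSMulRegular hu hp
  have hu0 : u ≠ 0 := by
    rintro rfl
    exact one_ne_zero (hu (a₁ := 1) (a₂ := 0) (by simp))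
  exact ⟨this, isGCDMonoid_of_quotient_principal ((Ideal.span_singleton_prime hu0).mp hp)⟩


/-! ### Local rings at closed points of étale algebras over affine space -/

theorem MvPolynomial.sub_aeval_mem {R σ : Type*} [CommRing R] {I : Ideal (MvPolynomial σ R)}
    {y : σ → MvPolynomial σ R} (h : ∀ i, X i - y i ∈ I) (f : MvPolynomial σ R) :
    f - aeval y f ∈ I := by
  have : Ideal.Quotient.mkₐ R I = (Ideal.Quotient.mkₐ R I).comp (aeval y) :=
    MvPolynomial.algHom_ext fun i => by
      simpa using Ideal.Quotient.eq.mpr (h i)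
  exact Ideal.Quotient.eq.mp (DFunLike.congr_fun this f)

theorem MvPolynomial.vanishingIdeal_singleton_eq_span {K σ : Type*} [Field K] (c : σ → K) :
    vanishingIdeal K {c} = Ideal.span (Set.range fun i => X i - C (c i)) := by
  refine le_antisymm (fun f hf => ?_) (Ideal.span_le.mpr ?_)
  · have := sub_aeval_mem (I := Ideal.span (Set.range fun i => X i - C (c i)))
      (y := fun i => C (c i)) (fun i => Ideal.subset_span ⟨i, rfl⟩) f
    have h0 : aeval (fun i => (C (c i) : MvPolynomial σ K)) f = C (aeval c f) := by
      rw [aeval_def, ← algebraMap_eq, ← MvPolynomial.aeval_def]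
      exact MvPolynomial.aeval_algebraMap_apply (MvPolynomial σ K) c f
    rwa [h0, (mem_vanishingIdeal_singleton_iff _ _).mp hf, map_zero, sub_zero] at this
  · rintro _ ⟨i, rfl⟩
    exact (mem_vanishingIdeal_singleton_iff _ _).mpr (by simp)

theorem MvPolynomial.isWeaklyRegular_X_sub_C {K : Type*} [Field K] (c : Fin 2 → K) :
    RingTheory.Sequence.IsWeaklyRegular (MvPolynomial (Fin 2) K)
      [X (0 : Fin 2) - C (c 0), X (1 : Fin 2) - C (c 1)] := by
  have hne : ∀ i, (X i - C (c i) : MvPolynomial (Fin 2) K) ≠ 0 := fun i h => by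
    simpa using congrArg (eval (fun j => c j + 1)) h
  refine isWeaklyRegular_pair_iff.mpr ⟨(IsRegular.of_ne_zero (hne 0)).left.isSMulRegular, ?_⟩
  -- Reduction modulo `X 0 - C (c 0)` is substitution of `c 0` for `X 0`, so divisibility becomes
  -- vanishing in a domain.
  let y : Fin 2 → MvPolynomial (Fin 2) K := ![C (c 0), X 1]
  have hy : ∀ f, X 0 - C (c 0) ∣ f ↔ aeval y f = 0 := fun f => by
    constructor
    · rintro ⟨g, rfl⟩
      simp [y]
    · intro h
      have := sub_aeval_mem (I := Ideal.span {X 0 - C (c 0)}) (y := y) (fun i => by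
        fin_cases i
        · exact Ideal.subset_span (by simp [y])
        · simp [y]) f
      rwa [h, sub_zero, Ideal.mem_span_singleton] at this
  intro f hf
  rw [hy, map_mul] at hf
  rw [hy]
  refine (mul_eq_zero.mp hf).resolve_left ?_
  simpa [y, aeval_C] using hne 1

/-- By the Nullstellensatz `P` lies over the maximal ideal of a point `c`. An étale algebra is
unramified, so that ideal generates the maximal ideal upstairs. -/
theorem exists_maximalIdeal_eq_span_of_etale {R : Type*} [CommRing R] [Algebra ℂ R]
    {n : ℕ} [Algebra (MvPolynomial (Fin n) ℂ) R] [IsScalarTower ℂ (MvPolynomial (Fin n) ℂ) R]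
    [Algebra.Etale (MvPolynomial (Fin n) ℂ) R] (P : Ideal R) [P.IsMaximal] :
    ∃ c : Fin n → ℂ, maximalIdeal (Localization.AtPrime P) = Ideal.span (Set.range fun i =>
      algebraMap (MvPolynomial (Fin n) ℂ) (Localization.AtPrime P)
        (MvPolynomial.X i - MvPolynomial.C (c i))) := by
  let B := MvPolynomial (Fin n) ℂ
  let A := Localization.AtPrime P
  let p : Ideal B := P.comap (algebraMap B R)
  have hft : Algebra.FiniteType B R := inferInstance
  have hfC : Algebra.FiniteType ℂ R := Algebra.FiniteType.trans (S := B) inferInstance hft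
  have hp : p.IsMaximal := by
    let _ : Field (R ⧸ P) := Ideal.Quotient.field P
    have : Algebra.FiniteType ℂ (R ⧸ P) := inferInstance
    have : Module.Finite ℂ (R ⧸ P) := finite_of_finite_type_of_isJacobsonRing ℂ (R ⧸ P)
    have : Algebra.IsIntegral B (R ⧸ P) := Algebra.IsIntegral.tower_top (R := ℂ)
    have := Ideal.isMaximal_comap_of_isIntegral_of_isMaximal (R := B) (⊥ : Ideal (R ⧸ P))
    have he : p = Ideal.comap (algebraMap B (R ⧸ P)) ⊥ := by
      rw [IsScalarTower.algebraMap_eq B R (R ⧸ P), ← Ideal.comap_comap, ← RingHom.ker_eq_comap_bot,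
        Ideal.Quotient.algebraMap_eq, Ideal.mk_ker]
    rwa [he]
  obtain ⟨c, hc⟩ := MvPolynomial.isMaximal_iff_eq_vanishingIdeal_singleton.mp hp
  rw [MvPolynomial.vanishingIdeal_singleton_eq_span] at hc
  have : P.LiesOver p := ⟨rfl⟩
  let _ := Localization.AtPrime.algebraOfLiesOver p P
  have hm := ((Algebra.isUnramifiedAt_iff_map_eq B p P).mp inferInstance).2
  rw [hc, Ideal.map_span, ← Set.range_comp] at hm
  exact ⟨c, hm.symm⟩

/-- The functions `X i - c i` form a regular sequence in the polynomial ring and stay one by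
flatness. They generate the maximal ideal, so the local ring is a field, a principal ideal domain or
a two-dimensional regular ring, according to `n`. -/
theorem isDomain_and_isGCDMonoid_localization_of_etale {R : Type*} [CommRing R] [Algebra ℂ R]
    {n : ℕ} [Algebra (MvPolynomial (Fin n) ℂ) R] [IsScalarTower ℂ (MvPolynomial (Fin n) ℂ) R]
    [Algebra.Etale (MvPolynomial (Fin n) ℂ) R] (hn : n ≤ 2) (P : Ideal R) [P.IsMaximal] :
    IsDomain (Localization.AtPrime P) ∧ IsGCDMonoid (Localization.AtPrime P) := by
  have hNR : IsNoetherianRing R :=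
    Algebra.FiniteType.isNoetherianRing (MvPolynomial (Fin n) ℂ) R
  have hNA : IsNoetherianRing (Localization.AtPrime P) :=
    IsLocalization.isNoetherianRing P.primeCompl _ hNR
  have : Module.Flat R (Localization.AtPrime P) := IsLocalization.flat _ P.primeCompl
  have hflat : Module.Flat (MvPolynomial (Fin n) ℂ) (Localization.AtPrime P) :=
    Module.Flat.trans _ R _
  have principal : IsDomain (Localization.AtPrime P) ∧
      IsPrincipalIdealRing (Localization.AtPrime P) →
      IsDomain (Localization.AtPrime P) ∧ IsGCDMonoid (Localization.AtPrime P) := by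
    rintro ⟨_, _⟩
    exact ⟨inferInstance, inferInstance⟩
  obtain ⟨c, hc⟩ := exists_maximalIdeal_eq_span_of_etale (n := n) P
  obtain rfl | rfl | rfl : n = 0 ∨ n = 1 ∨ n = 2 := by omega
  · rw [Set.range_eq_empty, Ideal.span_empty] at hc
    let _ : Field (Localization.AtPrime P) := (isField_iff_maximalIdeal_eq.mpr hc).toField
    exact principal ⟨inferInstance, inferInstance⟩
  · rw [Set.range_unique] at hc
    refine principal (isDomain_and_isPrincipalIdealRing_of_isSMulRegular ?_ hc)
    have h0 : (MvPolynomial.X 0 - MvPolynomial.C (c 0) : MvPolynomial (Fin 1) ℂ) ≠ 0 := fun h => by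
      simpa using congrArg (MvPolynomial.eval (fun j => c j + 1)) h
    exact (IsRegular.of_ne_zero h0).left.isSMulRegular.of_flat
  · have hw := RingTheory.Sequence.IsWeaklyRegular.of_flat (S := Localization.AtPrime P)
      (MvPolynomial.isWeaklyRegular_X_sub_C c)
    refine isDomain_and_isGCDMonoid_of_isWeaklyRegular hw ?_
    rw [hc]
    congr 1
    ext x
    simp [Fin.exists_fin_two, eq_comm]
-- Bounding the number of étale coordinates by transcendence degree
-- The field `κ` is algebraic over the algebra generated by the `m + 1` elements `b`. If its
-- transcendence degree were at least `m + 1`, then `b` would be a transcendence basis.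
theorem le_of_algebraicIndependent_of_not_algebraicIndependent {F κ : Type*} [Field F] [Field κ]
    [Algebra F κ] {m n : ℕ} {b : Fin (m + 1) → κ} (hb : ¬ AlgebraicIndependent F b)
    (hfrac : ∀ z : κ, ∃ r ∈ Algebra.adjoin F (Set.range b), ∃ s ∈ Algebra.adjoin F (Set.range b),
      s ≠ 0 ∧ s * z = r)
    {x : Fin n → κ} (hx : AlgebraicIndependent F x) : n ≤ m := by
  by_contra! hn
  have : Algebra.IsAlgebraic (Algebra.adjoin F (Set.range b)) κ := ⟨fun z => by
    obtain ⟨r, hr, s, hs, hs0, h⟩ := hfrac z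
    refine ⟨Polynomial.C ⟨s, hs⟩ * Polynomial.X - Polynomial.C ⟨r, hr⟩, fun h0 => hs0 ?_, ?_⟩
    · have := congrArg (fun q => Polynomial.coeff q 1) h0
      simpa [Polynomial.coeff_C] using congrArg Subtype.val this
    · simp [h]⟩
  refine hb (Algebra.IsAlgebraic.isTranscendenceBasis_of_lift_le_trdeg_of_finite F b ?_).1
  have := hx.lift_cardinalMk_le_trdeg
  refine le_trans ?_ this
  simpa using mod_cast hn

/-- Over a flat algebra a nonzero polynomial is a nonzerodivisor, whereas the elements of a minimal
prime are zero divisors. -/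
theorem algebraicIndependent_of_flat {F R κ : Type*} [Field F] [CommRing R] [Field κ] {n : ℕ}
    [Algebra (MvPolynomial (Fin n) F) R] [Module.Flat (MvPolynomial (Fin n) F) R]
    [Algebra F R] [IsScalarTower F (MvPolynomial (Fin n) F) R]
    [Algebra F κ] (f : R →ₐ[F] κ) (hf : RingHom.ker f ∈ minimalPrimes R) :
    AlgebraicIndependent F fun i => f (algebraMap (MvPolynomial (Fin n) F) R (MvPolynomial.X i)) := by
  let g := IsScalarTower.toAlgHom F (MvPolynomial (Fin n) F) R
  have h : MvPolynomial.aeval (fun i => f (g (MvPolynomial.X i))) = f.comp g :=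
    MvPolynomial.algHom_ext fun i => by rw [MvPolynomial.aeval_X]; rfl
  change Function.Injective (MvPolynomial.aeval (fun i => f (g (MvPolynomial.X i))))
  rw [h, injective_iff_map_eq_zero]
  intro q hq
  by_contra hq0
  have hreg : IsSMulRegular R (g q) := (IsRegular.of_ne_zero hq0).left.isSMulRegular.of_flat
  have hmem : g q ∈ RingHom.ker f := hq
  refine notMem_nonZeroDivisors_of_mem_mem_minimalPrimes hmem hf
    (mem_nonZeroDivisors_iff_right.mpr fun y hy => hreg ?_)
  change g q * y = g q * 0
  rw [mul_comm, hy, mul_zero]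

/-! ### Kernel vectors with a unit coordinate over factorial local rings -/

/-- Gauss's lemma: `p X - q` is primitive because `p` and `q` are coprime. -/
theorem Polynomial.dvd_of_eval₂_div_eq_zero {A K : Type*} [CommRing A] [IsDomain A] [IsGCDMonoid A]
    [Field K] [Algebra A K] [IsFractionRing A K] {p q : A} (hp : p ≠ 0) (hpq : IsRelPrime p q)
    {F : Polynomial A} (hF : F.eval₂ (algebraMap A K) (algebraMap A K q / algebraMap A K p) = 0) :
    Polynomial.C p * Polynomial.X - Polynomial.C q ∣ F := by
  have hp' : algebraMap A K p ≠ 0 := by simpa using hp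
  have hprim : (Polynomial.C p * Polynomial.X - Polynomial.C q).IsPrimitive := by
    intro r hr
    rw [Polynomial.C_dvd_iff_dvd_coeff] at hr
    refine hpq ?_ ?_
    · simpa [Polynomial.coeff_C] using hr 1
    · simpa using hr 0
  refine hprim.dvd_of_fraction_map_dvd_fraction_map (K := K) ?_
  rw [← Polynomial.eval_map, ← Polynomial.IsRoot.def, ← Polynomial.dvd_iff_isRoot] at hF
  refine dvd_trans ?_ hF
  refine ⟨Polynomial.C (algebraMap A K p)⁻¹, ?_⟩
  rw [Polynomial.map_sub, Polynomial.map_mul, Polynomial.map_C, Polynomial.map_X, Polynomial.map_C,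
    sub_mul, mul_right_comm, ← Polynomial.C_mul, mul_inv_cancel₀ hp', ← Polynomial.C_mul,
    Polynomial.C_1, one_mul, div_eq_mul_inv]

/-- This splits off the order of vanishing along the exceptional curve. The range of `E` is a
Noetherian domain through which `σ` factors, and the kernel of the induced map consists of the
multiples of the non-unit `E (C ν)`. A nonzero element is divisible by only finitely many powers of
a non-unit, and the last quotient is not killed by `σ`. -/
theorem exists_pow_mul_of_residue {R K k : Type*} [CommRing R] [IsNoetherianRing R] [Field K]
    [Field k] {E : Polynomial R →+* K} {σ : Polynomial R →+* Polynomial k} {ν : R}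
    (hν : σ (Polynomial.C ν) = 0) (hker : ∀ F, E F = 0 → σ F = 0)
    (hdvd : ∀ F, σ F = 0 → ∃ G, E F = E (Polynomial.C ν) * E G) {F : Polynomial R} (hF : E F ≠ 0) :
    ∃ n G, σ G ≠ 0 ∧ E F = E (Polynomial.C ν) ^ n * E G := by
  let C' := E.range
  have : IsNoetherianRing C' := inferInstance
  let ν' : C' := ⟨E (Polynomial.C ν), _, rfl⟩
  let F' : C' := ⟨E F, _, rfl⟩
  have hunit : ¬ IsUnit ν' := by
    intro h
    obtain ⟨⟨_, G, rfl⟩, hG⟩ := h.exists_right_inv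
    have h1 := hker (Polynomial.C ν * G - 1) (by
      rw [map_sub, map_mul, map_one]; exact sub_eq_zero.mpr (congrArg Subtype.val hG))
    rw [map_sub, map_mul, hν, zero_mul, map_one, zero_sub, neg_eq_zero] at h1
    exact one_ne_zero h1
  obtain ⟨n, ⟨_, G, rfl⟩, hG, hFG⟩ := WfDvdMonoid.max_power_factor' (a₀ := F') (x := ν')
    (fun h => hF (congrArg Subtype.val h)) hunit
  refine ⟨n, G, fun h => hG ?_, congrArg Subtype.val hFG⟩
  obtain ⟨H, hH⟩ := hdvd G h
  exact ⟨⟨E H, _, rfl⟩, Subtype.ext hH⟩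

/-- With `ψ x / ψ y = q / p` in lowest terms the vector is `(p, -q)`. If both coordinates were
non-units, `ψ y` would be `W * p ^ 2` with `p` of positive order along the exceptional curve of the
blow-up of `R` in `(x, y, z)`, while the order of `y` there is one. -/
theorem exists_unimodular_of_fractions {R A : Type*} [CommRing R] [IsNoetherianRing R] [CommRing A]
    [IsDomain A] [IsLocalRing A] [IsGCDMonoid A] (ψ : R →+* A) {x y z : R}
    (hdet : x * x + y * z = 0) (hne : ψ y ≠ 0)
    (hres : ∀ r, ψ r ∈ maximalIdeal A → r ∈ Ideal.span {x, y, z})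
    (hfrac : ∀ a, ∃ r c, ψ r ≠ 0 ∧ ψ r * a = ψ c) :
    ∃ v w : A, (IsUnit v ∨ IsUnit w) ∧ ψ x * v + ψ y * w = 0 ∧ ψ z * v - ψ x * w = 0 := by
  obtain ⟨q, p, g, hpq, hx, hy⟩ : ∃ q p g : A, IsRelPrime p q ∧ ψ x = g * q ∧ ψ y = g * p := by
    obtain ⟨_⟩ := ‹IsGCDMonoid A›
    obtain ⟨q, p, h1, h2, h3⟩ := extract_gcd (ψ x) (ψ y)
    exact ⟨q, p, _, ((gcd_isUnit_iff_isRelPrime).mp h3).symm, h1, h2⟩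
  have hg : g ≠ 0 := by rintro rfl; simp [hy] at hne
  have hp : p ≠ 0 := by rintro rfl; simp [hy] at hne
  have hd : ψ x * ψ x + ψ y * ψ z = 0 := by rw [← map_mul, ← map_mul, ← map_add, hdet, map_zero]
  have h1 : g * (q * q) = - (p * ψ z) := by
    refine mul_left_cancel₀ hg ?_
    rw [hx, hy] at hd
    linear_combination hd
  -- The determinant gives `g * q² = -(p * ψ z)`, and `p` is coprime to `q²`. Hence `ψ x = W p q`,
  -- `ψ y = W p²` and `ψ z = -W q²`.
  obtain ⟨W, rfl⟩ : p ∣ g := by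
    refine (hpq.mul_right hpq).dvd_of_dvd_mul_right ?_
    exact ⟨- ψ z, by rw [h1]; ring⟩
  have hz : ψ z = - (W * q * q) := mul_left_cancel₀ hp (by linear_combination h1)
  refine ⟨p, - q, ?_, by rw [hx, hy]; ring, by rw [hx, hz]; ring⟩
  by_contra hunit
  simp only [IsUnit.neg_iff, not_or] at hunit
  obtain ⟨hpu, hqu⟩ := hunit
  have hpm : p ∈ maximalIdeal A := hpu
  have hqm : q ∈ maximalIdeal A := hqu
  let K := FractionRing A
  let k := ResidueField A
  let t : K := algebraMap A K q / algebraMap A K p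
  have hpK : algebraMap A K p ≠ 0 := by simpa using hp
  have htp : algebraMap A K p * t = algebraMap A K q := mul_div_cancel₀ _ hpK
  let E' : Polynomial A →+* K := Polynomial.eval₂RingHom (algebraMap A K) t
  let σ' : Polynomial A →+* Polynomial k := Polynomial.mapRingHom (residue A)
  have hE'C : ∀ a, E' (Polynomial.C a) = algebraMap A K a := fun a => by simp [E']
  -- The kernel of evaluation at `t = q / p` consists of multiples of `p X - q`, whose coefficients
  -- lie in the maximal ideal. So reduction of coefficients is well defined on the values.
  have hker' : ∀ F, E' F = 0 → σ' F = 0 := fun F hF => by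
    obtain ⟨G, rfl⟩ := Polynomial.dvd_of_eval₂_div_eq_zero hp hpq hF
    simp [σ', (residue_eq_zero_iff p).mpr hpm, (residue_eq_zero_iff q).mpr hqm]
  let E : Polynomial R →+* K := E'.comp (Polynomial.mapRingHom ψ)
  let σ : Polynomial R →+* Polynomial k := σ'.comp (Polynomial.mapRingHom ψ)
  have hEC : ∀ r, E (Polynomial.C r) = algebraMap A K (ψ r) := fun r => by simp [E, hE'C]
  have hσy : residue A (ψ y) = 0 := by
    rw [hy]; simp [(residue_eq_zero_iff p).mpr hpm]
  -- After `t` is adjoined, `x = t y` and `z = -t² y`, so the ideal `(x, y, z)` becomes generated by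
  -- `y`.
  have hsp : ∀ r ∈ Ideal.span {x, y, z}, ∃ G, E (Polynomial.C r) = E (Polynomial.C y) * E G := by
    intro r hr
    have ht : E Polynomial.X = t := by simp [E, E']
    obtain ⟨a, b, hb, rfl⟩ := Ideal.mem_span_insert.mp hr
    obtain ⟨c, d, hd, rfl⟩ := Ideal.mem_span_insert.mp hb
    obtain ⟨e, rfl⟩ := Ideal.mem_span_singleton'.mp hd
    refine ⟨Polynomial.C a * Polynomial.X + Polynomial.C c -
      Polynomial.C e * Polynomial.X * Polynomial.X, ?_⟩
    simp only [map_add, map_sub, map_mul, ht, hEC, hx, hy, hz]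
    simp only [map_neg, map_mul, ← htp]
    ring
  have hdvd : ∀ F, σ F = 0 → ∃ G, E F = E (Polynomial.C y) * E G := by
    intro F hF
    have hc : ∀ n, ∃ G, E (Polynomial.C (F.coeff n)) = E (Polynomial.C y) * E G := fun n => by
      have := congrArg (fun H => Polynomial.coeff H n) hF
      refine hsp _ (hres _ ((residue_eq_zero_iff _).mp ?_))
      simpa only [σ, σ', RingHom.comp_apply, Polynomial.coe_mapRingHom, Polynomial.coeff_map,
        Polynomial.coeff_zero] using this
    choose G hG using hc
    refine ⟨∑ n ∈ F.support, G n * Polynomial.X ^ n, ?_⟩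
    conv_lhs => rw [F.as_sum_support_C_mul_X_pow]
    rw [map_sum, map_sum, Finset.mul_sum]
    refine Finset.sum_congr rfl fun n _ => ?_
    rw [map_mul, map_mul, hG, mul_assoc]
  have hstrip := fun {F : Polynomial R} => exists_pow_mul_of_residue (E := E) (σ := σ) (ν := y)
    (by simp [σ, σ', hσy]) (fun F hF => hker' _ hF) hdvd (F := F)
  -- Birationality: `p` is a quotient `c / r` of elements of `R`, so its order along the exceptional
  -- curve is `n - m`.
  obtain ⟨r, c, hr, hrc⟩ := hfrac p
  have hr' : E (Polynomial.C r) ≠ 0 := by rw [hEC]; simpa using hr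
  have hc' : E (Polynomial.C c) ≠ 0 := by rw [hEC, ← hrc]; simpa using ⟨hr, hp⟩
  obtain ⟨m, F, hF, hrF⟩ := hstrip hr'
  obtain ⟨n, G, hG, hcG⟩ := hstrip hc'
  rw [hEC, ← hrc, map_mul, ← hEC r, hrF, hEC] at hcG
  have hν : algebraMap A K (ψ y) ≠ 0 := by simpa using hne
  have hσ : ∀ H, σ H = σ' (H.map ψ) := fun _ => rfl
  have hE : ∀ H, E H = E' (H.map ψ) := fun _ => rfl
  obtain hnm | ⟨e, rfl⟩ : n ≤ m ∨ ∃ e, n = m + (e + 1) := by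
    rcases le_or_gt n m with h | h
    · exact .inl h
    · exact .inr ⟨n - m - 1, by omega⟩
  -- If `n ≤ m`, then `G` takes the same value at `t` as a multiple of `p`, so its reduction
  -- vanishes.
  · obtain ⟨e, rfl⟩ := Nat.exists_eq_add_of_le hnm
    have h0 : E' (Polynomial.C (ψ y) ^ e * F.map ψ * Polynomial.C p - G.map ψ) = 0 := by
      refine mul_left_cancel₀ (pow_ne_zero n hν) ?_
      simp only [map_sub, map_mul, map_pow, hE'C, ← hE]
      linear_combination hcG
    have h2 := hker' _ h0
    have hpσ : σ' (Polynomial.C p) = 0 := by simp [σ', (residue_eq_zero_iff p).mpr hpm]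
    rw [map_sub, map_mul, hpσ, mul_zero, zero_sub, neg_eq_zero] at h2
    exact hG h2
  · have hEF : E F * algebraMap A K p = algebraMap A K (ψ y) ^ (e + 1) * E G :=
      mul_left_cancel₀ (pow_ne_zero m hν) (by linear_combination hcG)
    have hyK : algebraMap A K (ψ y) = algebraMap A K p ^ 2 * algebraMap A K W := by
      rw [← map_pow, ← map_mul, hy]; ring_nf
    -- If `p` has order `e + 1 > 0`, squaring `F p = y ^ (e + 1) G` and cancelling `y = W p²` leaves
    -- a factor `y ^ (2 e + 1)` in `F²`, whose reduction must then vanish.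
    have h0 : E' (F.map ψ ^ 2 - Polynomial.C W * Polynomial.C (ψ y) ^ (2 * e + 1) * G.map ψ ^ 2)
        = 0 := by
      refine mul_left_cancel₀ hν ?_
      simp only [map_sub, map_mul, map_pow, hE'C, ← hE]
      have : algebraMap A K (ψ y) * E F ^ 2 =
          algebraMap A K W * (E F * algebraMap A K p) ^ 2 := by rw [hyK]; ring
      rw [mul_sub, this, hEF]
      ring
    have h2 := hker' _ h0
    have hνσ : σ' (Polynomial.C (ψ y)) = 0 := by simp [σ', hσy]
    rw [map_sub, map_mul, map_mul, map_pow σ' (Polynomial.C (ψ y)), hνσ, zero_pow (by omega),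
      mul_zero, zero_mul, sub_zero, map_pow, sq_eq_zero_iff] at h2
    exact hF h2

end

/-! ### Local rings of smooth algebras birational to a surface -/

section

open IsLocalRing

/-- A smooth algebra is locally étale over affine space. The étale coordinates stay independent in
the fraction field of `R / q`, for a minimal prime `q` inside `P`. By `hfrac` the images of the
dependent elements `b` generate that field, which bounds `n`. -/
theorem exists_etale_le_of_smooth {R R₁ : Type*} [CommRing R] [Algebra ℂ R] [Algebra.Smooth ℂ R]
    [CommRing R₁] [Algebra ℂ R₁] (φ : R₁ →ₐ[ℂ] R) {m : ℕ} {b : Fin (m + 1) → R₁}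
    (hb : Algebra.adjoin ℂ (Set.range b) = ⊤) (hdep : ¬ AlgebraicIndependent ℂ b)
    (P : Ideal R) [P.IsPrime]
    (hfrac : ∀ q ∈ minimalPrimes R, ∀ a, ∃ r s : R₁, φ s ∉ q ∧ φ s * a - φ r ∈ q) :
    ∃ f ∉ P, ∃ n ≤ m, ∃ (_ : Algebra (MvPolynomial (Fin n) ℂ) (Localization.Away f)),
      IsScalarTower ℂ (MvPolynomial (Fin n) ℂ) (Localization.Away f) ∧
      Algebra.Etale (MvPolynomial (Fin n) ℂ) (Localization.Away f) := by
  obtain ⟨f, hf, n, _, h1, h2⟩ := Algebra.IsSmoothAt.exists_isStandardEtale_mvPolynomial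
    (R := ℂ) (p := P)
  have h2' : Algebra.Etale (MvPolynomial (Fin n) ℂ) (Localization.Away f) := inferInstance
  refine ⟨f, hf, n, ?_, _, h1, h2'⟩
  obtain ⟨q, hq, hqP⟩ := Ideal.exists_minimalPrimes_le (show (⊥ : Ideal R) ≤ P from bot_le)
  have hqp : q.IsPrime := hq.1.1
  let κ := FractionRing (R ⧸ q)
  let π : R →ₐ[ℂ] κ := (IsScalarTower.toAlgHom ℂ (R ⧸ q) κ).comp (Ideal.Quotient.mkₐ ℂ q)
  have hπ : ∀ a, π a = 0 ↔ a ∈ q := fun a => by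
    change algebraMap (R ⧸ q) κ (Ideal.Quotient.mk q a) = 0 ↔ _
    rw [FaithfulSMul.algebraMap_eq_zero_iff, Ideal.Quotient.eq_zero_iff_mem]
  have hfu : ∀ y : Submonoid.powers f, IsUnit (π y) := by
    rintro ⟨_, k, rfl⟩
    rw [map_pow]
    exact ((isUnit_iff_ne_zero).mpr fun h => hf (hqP ((hπ f).mp h))).pow k
  let g : Localization.Away f →ₐ[ℂ] κ := IsLocalization.liftAlgHom (M := Submonoid.powers f) hfu
  have hg : ∀ a, g (algebraMap R _ a) = π a := fun a => by
    simp [g]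
  have hker : RingHom.ker g ∈ minimalPrimes (Localization.Away f) := by
    refine ⟨⟨RingHom.ker_isPrime g, bot_le⟩, fun J hJ hJg => ?_⟩
    have := hJ.1
    have h3 : J.comap (algebraMap R (Localization.Away f)) ≤ q := fun a ha => by
      rw [← hπ, ← hg]; exact hJg ha
    have h4 := hq.2 ⟨Ideal.IsPrime.comap _, bot_le⟩ h3
    intro y hy
    obtain ⟨a, s, rfl⟩ := IsLocalization.exists_mk'_eq (Submonoid.powers f) y
    have h5 : π a = 0 := by
      rw [← hg, ← IsLocalization.mk'_spec (Localization.Away f) a s, map_mul,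
        RingHom.mem_ker.mp hy, zero_mul]
    exact IsLocalization.mk'_mem_iff.mpr (h4 ((hπ a).mp h5))
  have hind := algebraicIndependent_of_flat (n := n) g hker
  refine le_of_algebraicIndependent_of_not_algebraicIndependent
    (b := fun i => π (φ (b i))) ?_ ?_ hind
  · intro h
    exact hdep (AlgebraicIndependent.of_comp (f := π.comp φ) h)
  · have hmem : ∀ r, π (φ r) ∈ Algebra.adjoin ℂ (Set.range fun i => π (φ (b i))) := fun r => by
      have : r ∈ Algebra.adjoin ℂ (Set.range b) := hb ▸ Algebra.mem_top
      have : π (φ r) ∈ (Algebra.adjoin ℂ (Set.range b)).map (π.comp φ) := ⟨r, this, rfl⟩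
      rw [AlgHom.map_adjoin (π.comp φ), ← Set.range_comp] at this
      exact this
    intro y
    obtain ⟨a, s, hs, rfl⟩ := IsFractionRing.div_surjective (A := R ⧸ q) y
    obtain ⟨a, rfl⟩ := Ideal.Quotient.mk_surjective a
    obtain ⟨s, rfl⟩ := Ideal.Quotient.mk_surjective s
    obtain ⟨r₁, s₁, h1, e1⟩ := hfrac q hq a
    obtain ⟨r₂, s₂, h2, e2⟩ := hfrac q hq s
    have hs' : π s ≠ 0 := by
      rw [Ne, hπ, ← Ideal.Quotient.eq_zero_iff_mem]
      exact nonZeroDivisors.ne_zero hs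
    rw [← hπ, map_sub, map_mul, sub_eq_zero] at e1 e2
    rw [← hπ] at h1 h2
    refine ⟨_, hmem (r₁ * s₂), _, hmem (s₁ * r₂), ?_, ?_⟩
    · rw [map_mul, map_mul, ← e2]
      exact mul_ne_zero h1 (mul_ne_zero h2 hs')
    · change _ * (π a / π s) = _
      rw [map_mul, map_mul, map_mul, map_mul, ← e2, ← e1]
      linear_combination (π (φ s₁) * π (φ s₂)) * mul_div_cancel₀ (π a) hs'

theorem IsGCDMonoid.of_mulEquiv {A B : Type*} [CommRing A] [CommRing B] (e : A ≃* B)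
    [IsDomain B] [h : IsGCDMonoid A] : IsGCDMonoid B := by
  refine isGCDMonoid_iff_exists_lcm.mpr ⟨inferInstance, fun a b => ?_⟩
  obtain ⟨c, hc⟩ := (isGCDMonoid_iff_exists_lcm.mp h).2 (e.symm a) (e.symm b)
  refine ⟨e c, fun d => ?_⟩
  have := hc (e.symm d)
  rwa [map_dvd_iff, map_dvd_iff, ← map_dvd_iff e (a := c), e.apply_symm_apply] at this

theorem isDomain_and_isGCDMonoid_localization_of_smooth {R R₁ : Type*} [CommRing R] [Algebra ℂ R]
    [Algebra.Smooth ℂ R] [CommRing R₁] [Algebra ℂ R₁] (φ : R₁ →ₐ[ℂ] R) {b : Fin 3 → R₁}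
    (hb : Algebra.adjoin ℂ (Set.range b) = ⊤) (hdep : ¬ AlgebraicIndependent ℂ b)
    (P : Ideal R) [P.IsMaximal]
    (hfrac : ∀ q ∈ minimalPrimes R, ∀ a, ∃ r s : R₁, φ s ∉ q ∧ φ s * a - φ r ∈ q) :
    IsDomain (Localization.AtPrime P) ∧ IsGCDMonoid (Localization.AtPrime P) := by
  obtain ⟨f, hf, n, hn, _, h1, h2⟩ := exists_etale_le_of_smooth φ hb hdep P hfrac
  let R' := Localization.Away f
  have hdisj : Disjoint (Submonoid.powers f : Set R) P := by
    refine Set.disjoint_left.mpr ?_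
    rintro _ ⟨k, rfl⟩ hk
    exact hf (Ideal.IsPrime.mem_of_pow_mem inferInstance k hk)
  let P' : Ideal R' := P.map (algebraMap R R')
  have hP'p : P'.IsPrime := IsLocalization.isPrime_of_isPrime_disjoint (.powers f) _ P inferInstance hdisj
  have hcomap : P'.comap (algebraMap R R') = P :=
    IsLocalization.under_map_of_isPrime_disjoint (.powers f) _ inferInstance hdisj
  -- The Jacobson property keeps `P` maximal in the localization at `f`, as the étale criterion
  -- needs a closed point.
  have : IsJacobsonRing R := isJacobsonRing_of_finiteType (A := ℂ)
  have hP' : P'.IsMaximal := (IsLocalization.isMaximal_iff_isMaximal_disjoint R' f P').mpr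
    ⟨by change (P'.comap _).IsMaximal; rwa [hcomap], by change f ∉ P'.comap _; rwa [hcomap]⟩
  obtain ⟨hd, hG⟩ := isDomain_and_isGCDMonoid_localization_of_etale hn P'
  have hloc : IsLocalization.AtPrime (Localization.AtPrime P') P := by
    have := IsLocalization.isLocalization_isLocalization_atPrime_isLocalization (.powers f)
      (Localization.AtPrime P') P'
    simpa only [hcomap] using this
  let e : Localization.AtPrime P' ≃ₐ[R] Localization.AtPrime P :=
    IsLocalization.algEquiv P.primeCompl _ _
  have hd' : IsDomain (Localization.AtPrime P) := e.symm.toMulEquiv.isDomain _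
  exact ⟨hd', IsGCDMonoid.of_mulEquiv e.toMulEquiv⟩

/-- A kernel vector of `(x, y; z, -x)` with a unit coordinate is found over the local ring at `P`
and then spread out: `s` kills the discrepancy between equations in the local ring and in `R`. -/
theorem exists_unimodular_of_smooth {R R₁ : Type*} [CommRing R] [Algebra ℂ R]
    [Algebra.Smooth ℂ R] [CommRing R₁] [Algebra ℂ R₁] (φ : R₁ →ₐ[ℂ] R) {b : Fin 3 → R₁}
    (hb : Algebra.adjoin ℂ (Set.range b) = ⊤) (hdep : ¬ AlgebraicIndependent ℂ b)
    (P : Ideal R) [P.IsMaximal] {x y z : R₁} (hdet : x * x + y * z = 0)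
    (hres : ∀ r, ∃ c : ℂ, r - algebraMap ℂ R₁ c ∈ Ideal.span {x, y, z})
    (hfrac : ∀ q ∈ minimalPrimes R, ∀ a, ∃ r s : R₁, φ s ∉ q ∧ φ s * a - φ r ∈ q)
    (hne : ∀ q ∈ minimalPrimes R, φ y ∉ q ∨ φ z ∉ q) :
    ∃ v w s : R, (v ∉ P ∨ w ∉ P) ∧ s ∉ P ∧ s * (φ x * v + φ y * w) = 0 ∧
      s * (φ z * v - φ x * w) = 0 := by
  obtain ⟨hd, hG⟩ := isDomain_and_isGCDMonoid_localization_of_smooth φ hb hdep P hfrac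
  let A := Localization.AtPrime P
  have hft : Algebra.FiniteType ℂ R₁ := ⟨⟨(Set.finite_range b).toFinset, by simpa using hb⟩⟩
  have hN : IsNoetherianRing R₁ := Algebra.FiniteType.isNoetherianRing ℂ R₁
  let q : Ideal R := RingHom.ker (algebraMap R A)
  have hqp : q.IsPrime := RingHom.ker_isPrime _
  have hq0 : ∀ a, algebraMap R A a = 0 ↔ a ∈ q := fun a => Iff.rfl
  have hq : q ∈ minimalPrimes R := by
    obtain ⟨q', hq', hqq⟩ := Ideal.exists_minimalPrimes_le (show (⊥ : Ideal R) ≤ q from bot_le)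
    have hq'p : q'.IsPrime := hq'.1.1
    have : q' ≤ P := fun a ha => by
      by_contra haP
      have := (hq0 a).mpr (hqq ha)
      exact (IsLocalization.map_units A (⟨a, haP⟩ : P.primeCompl)).ne_zero this
    have : q ≤ q' := fun a ha => by
      obtain ⟨s, hs⟩ := (IsLocalization.map_eq_zero_iff P.primeCompl A a).mp ((hq0 a).mpr ha)
      exact (hq'p.mem_or_mem (hs ▸ zero_mem q')).resolve_left fun h => s.2 (this h)
    rwa [le_antisymm this hqq]
  let ψ : R₁ →+* A := (algebraMap R A).comp φ
  have hψ : ∀ r, ψ r = algebraMap R A (φ r) := fun _ => rfl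
  obtain ⟨v, w, hvw, e1, e2⟩ : ∃ v w : A, (IsUnit v ∨ IsUnit w) ∧
      ψ x * v + ψ y * w = 0 ∧ ψ z * v - ψ x * w = 0 := by
    -- If `y = 0`, then also `x = 0` and `(0, 1)` works. If an off-diagonal entry is a unit, a
    -- column of the matrix works. Otherwise all entries lie in the maximal ideal and the order
    -- argument applies.
    by_cases hy : ψ y = 0
    · have hx : ψ x = 0 := by
        have : ψ x * ψ x + ψ y * ψ z = 0 := by rw [← map_mul, ← map_mul, ← map_add, hdet, map_zero]
        rw [hy, zero_mul, add_zero] at this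
        exact mul_self_eq_zero.mp this
      exact ⟨0, 1, .inr isUnit_one, by simp [hy], by simp [hx]⟩
    · by_cases hyz : ψ y ∈ maximalIdeal A ∧ ψ z ∈ maximalIdeal A
      · refine exists_unimodular_of_fractions ψ hdet hy (fun r hr => ?_) (fun a => ?_)
        · obtain ⟨c, hc⟩ := hres r
          have hxm : ψ x ∈ maximalIdeal A := by
            have h1 : ψ x * ψ x + ψ y * ψ z = 0 := by
              rw [← map_mul, ← map_mul, ← map_add, hdet, map_zero]
            refine (Ideal.IsPrime.mem_or_mem (maximalIdeal.isMaximal A).isPrime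
              (?_ : ψ x * ψ x ∈ _)).elim id id
            rw [eq_neg_of_add_eq_zero_left h1]
            exact neg_mem (Ideal.mul_mem_right _ _ hyz.1)
          have hle : Ideal.span {x, y, z} ≤ (maximalIdeal A).comap ψ := by
            rw [Ideal.span_le]
            rintro _ (rfl | rfl | rfl)
            exacts [hxm, hyz.1, hyz.2]
          have h2 : ψ (algebraMap ℂ R₁ c) ∈ maximalIdeal A := by
            have := sub_mem hr (show ψ (r - algebraMap ℂ R₁ c) ∈ _ from hle hc)
            rwa [map_sub, sub_sub_cancel] at this
          by_cases hc0 : c = 0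
          · simpa [hc0] using hc
          · exact absurd (((isUnit_iff_ne_zero.mpr hc0).map (algebraMap ℂ R₁)).map ψ) h2
        · obtain ⟨a, d, rfl⟩ := IsLocalization.exists_mk'_eq P.primeCompl a
          obtain ⟨r₁, s₁, h1, e1⟩ := hfrac q hq a
          obtain ⟨r₂, s₂, h2, e2⟩ := hfrac q hq d
          rw [← hq0, map_sub, map_mul, sub_eq_zero] at e1 e2
          rw [← hq0] at h1 h2
          have hd0 : algebraMap R A d ≠ 0 := (IsLocalization.map_units A d).ne_zero
          refine ⟨s₁ * r₂, r₁ * s₂, ?_, ?_⟩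
          · rw [map_mul, hψ, hψ, ← e2]
            exact mul_ne_zero h1 (mul_ne_zero h2 hd0)
          · rw [map_mul, map_mul, hψ, hψ, hψ, hψ, ← e2, ← e1]
            rw [← IsLocalization.mk'_spec A a d]
            ring
      · have h1 : ψ x * ψ x + ψ y * ψ z = 0 := by
          rw [← map_mul, ← map_mul, ← map_add, hdet, map_zero]
        rcases not_and_or.mp hyz with hu | hu
        · exact ⟨ψ y, - ψ x, .inl (by simpa using hu), by ring, by linear_combination h1⟩
        · exact ⟨ψ x, ψ z, .inr (by simpa using hu), by linear_combination h1, by ring⟩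
  obtain ⟨v, w, d, rfl, rfl⟩ : ∃ (v' w' : R) (d : P.primeCompl), v = IsLocalization.mk' A v' d ∧
      w = IsLocalization.mk' A w' d := by
    obtain ⟨v, d₁, rfl⟩ := IsLocalization.exists_mk'_eq P.primeCompl v
    obtain ⟨w, d₂, rfl⟩ := IsLocalization.exists_mk'_eq P.primeCompl w
    refine ⟨v * d₂, w * d₁, d₁ * d₂, ?_, ?_⟩
    · exact (IsLocalization.mk'_cancel _ _ _).symm
    · rw [mul_comm d₁ d₂]
      exact (IsLocalization.mk'_cancel _ _ _).symm
  have hu : ∀ a : R, IsUnit (IsLocalization.mk' A a d) → a ∉ P := fun a ha h => by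
    have h1 := (IsLocalization.AtPrime.isUnit_mk'_iff A P a d).mp ha
    exact h1 h
  have hz : ∀ a : R, algebraMap R A a = 0 → ∃ s ∉ P, s * a = 0 := fun a ha => by
    obtain ⟨s, hs⟩ := (IsLocalization.map_eq_zero_iff P.primeCompl A a).mp ha
    exact ⟨s, s.2, hs⟩
  have hd' := IsLocalization.map_units A d
  obtain ⟨s₁, hs₁, e1⟩ := hz (φ x * v + φ y * w) (by
    rw [map_add, map_mul, map_mul, ← IsLocalization.mk'_spec A v d,
      ← IsLocalization.mk'_spec A w d]
    simp only [hψ] at e1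
    linear_combination algebraMap R A d * e1)
  obtain ⟨s₂, hs₂, e2⟩ := hz (φ z * v - φ x * w) (by
    rw [map_sub, map_mul, map_mul, ← IsLocalization.mk'_spec A v d,
      ← IsLocalization.mk'_spec A w d]
    simp only [hψ] at e2
    linear_combination algebraMap R A d * e2)
  refine ⟨v, w, s₁ * s₂, hvw.imp (hu v) (hu w), fun h => (Ideal.IsPrime.mem_or_mem inferInstance
    h).elim hs₁ hs₂, ?_, ?_⟩
  · linear_combination s₂ * e1
  · linear_combination s₁ * e2

end

/-! ### Local constructions with morphisms of schemes -/

namespace AlgebraicGeometry.Scheme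

theorem hom_ext_of_exists_isOpenImmersion {W S : Scheme.{0}} {h₁ h₂ : W ⟶ S}
    (H : ∀ w : W, ∃ (V : Scheme.{0}) (i : V ⟶ W) (_ : IsOpenImmersion i), w ∈ Set.range i ∧
      i ≫ h₁ = i ≫ h₂) : h₁ = h₂ := by
  refine hom_ext_of_forall _ _ fun w => ?_
  obtain ⟨V, i, _, hw, e⟩ := H w
  refine ⟨i.opensRange, hw, ?_⟩
  rw [← Hom.isoOpensRange_inv_comp i, Category.assoc, Category.assoc, e]

/-- Local lifts agree on overlaps because uniqueness is assumed on every open subscheme, so they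
glue. -/
theorem exists_lift_of_locally {X Y W : Scheme.{0}} (f : X ⟶ Y) (g : W ⟶ Y)
    (hex : ∀ w : W, ∃ (V : Scheme.{0}) (i : V ⟶ W) (_ : IsOpenImmersion i), w ∈ Set.range i ∧
      ∃ h : V ⟶ X, h ≫ f = i ≫ g)
    (huniq : ∀ (V : Scheme.{0}) (i : V ⟶ W) [IsOpenImmersion i] (h h' : V ⟶ X),
      h ≫ f = i ≫ g → h' ≫ f = i ≫ g → h = h') : ∃! h : W ⟶ X, h ≫ f = g := by
  choose V i hi hw h hh using hex
  let 𝒰 : W.OpenCover := {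
    I₀ := W, X := V, f := i
    mem₀ := by
      rw [presieve₀_mem_precoverage_iff]
      exact ⟨fun x ↦ ⟨x, hw x⟩, hi⟩ }
  have hcomp : ∀ x y, pullback.fst (𝒰.f x) (𝒰.f y) ≫ h x = pullback.snd (𝒰.f x) (𝒰.f y) ≫ h y := by
    intro x y
    have := hi x
    have := hi y
    have : IsOpenImmersion (𝒰.f y) := hi y
    have : IsOpenImmersion (𝒰.f x) := hi x
    refine huniq _ (pullback.fst (𝒰.f x) (𝒰.f y) ≫ 𝒰.f x) _ _ ?_ ?_
    · rw [Category.assoc, hh, Category.assoc]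
    · rw [Category.assoc, hh, pullback.condition, Category.assoc]
  refine ⟨𝒰.glueMorphisms h hcomp, ?_, fun h' e => ?_⟩
  · refine Cover.hom_ext 𝒰 _ _ fun x => ?_
    rw [Cover.ι_glueMorphisms_assoc, hh]
  · have := fun V i (_ : IsOpenImmersion i) => huniq V i
    refine huniq W (𝟙 W) _ _ (by rw [e, Category.id_comp]) ?_
    rw [Category.id_comp]
    refine Cover.hom_ext 𝒰 _ _ fun x => ?_
    rw [Cover.ι_glueMorphisms_assoc, hh]

/-- This reduces questions about morphisms into a chart to ring homomorphisms, inside a prescribed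
neighbourhood `O`. -/
theorem exists_Spec_factor {W S : Scheme.{0}} (h : W ⟶ S) {A : CommRingCat.{0}} (c : Spec A ⟶ S)
    [IsOpenImmersion c] (O : W.Opens) {w : W} (hO : w ∈ O) (hw : h w ∈ Set.range c) :
    ∃ (B : CommRingCat.{0}) (i : Spec B ⟶ W) (_ : IsOpenImmersion i) (ρ : A ⟶ B),
      w ∈ Set.range i ∧ Set.range i ⊆ O ∧ i ≫ h = Spec.map ρ ≫ c := by
  obtain ⟨B, i, hi, hw', hr⟩ := exists_affine_mem_range_and_range_subset
    (X := W) (x := w) (U := O ⊓ h ⁻¹ᵁ c.opensRange) ⟨hO, hw⟩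
  have hc : Set.range (i ≫ h) ⊆ Set.range c := by
    rintro _ ⟨x, rfl⟩
    rw [Hom.comp_apply]
    exact (hr ⟨x, rfl⟩).2
  refine ⟨B, i, hi, Spec.preimage (IsOpenImmersion.lift c (i ≫ h) hc), hw',
    fun x hx => (hr hx).1, ?_⟩
  rw [Spec.map_preimage, IsOpenImmersion.lift_fac]

theorem exists_Spec_factor₂ {W S S' : Scheme.{0}} (h : W ⟶ S) (h' : W ⟶ S')
    {A A' : CommRingCat.{0}} (c : Spec A ⟶ S) (c' : Spec A' ⟶ S')
    [IsOpenImmersion c] [IsOpenImmersion c'] (O : W.Opens) {w : W} (hO : w ∈ O)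
    (hw : h w ∈ Set.range c) (hw' : h' w ∈ Set.range c') :
    ∃ (B : CommRingCat.{0}) (i : Spec B ⟶ W) (_ : IsOpenImmersion i) (ρ : A ⟶ B) (ρ' : A' ⟶ B),
      w ∈ Set.range i ∧ Set.range i ⊆ O ∧ i ≫ h = Spec.map ρ ≫ c ∧ i ≫ h' = Spec.map ρ' ≫ c' := by
  obtain ⟨B, i, hi, ρ, h1, h2, h3⟩ := exists_Spec_factor h c (O ⊓ h' ⁻¹ᵁ c'.opensRange)
    ⟨hO, hw'⟩ hw
  have hc : Set.range (i ≫ h') ⊆ Set.range c' := by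
    rintro _ ⟨x, rfl⟩
    rw [Hom.comp_apply]
    exact (h2 ⟨x, rfl⟩).2
  refine ⟨B, i, hi, ρ, Spec.preimage (IsOpenImmersion.lift c' (i ≫ h') hc), h1,
    fun x hx => (h2 hx).1, h3, ?_⟩
  rw [Spec.map_preimage, IsOpenImmersion.lift_fac]

theorem isIso_morphismRestrict_of_section {X Y : Scheme.{0}} (f : X ⟶ Y) (U : Y.Opens)
    (s : U.toScheme ⟶ X) (hs : s ≫ f = U.ι) (h : f ∣_ U ≫ s = (f ⁻¹ᵁ U).ι) : IsIso (f ∣_ U) := by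
  have hr : Set.range s ⊆ Set.range (f ⁻¹ᵁ U).ι := by
    rw [Opens.range_ι]
    rintro _ ⟨x, rfl⟩
    change f (s x) ∈ U
    rw [← Hom.comp_apply, hs]
    exact x.2
  refine ⟨IsOpenImmersion.lift (f ⁻¹ᵁ U).ι s hr, ?_, ?_⟩
  · rw [← cancel_mono (f ⁻¹ᵁ U).ι, Category.assoc, IsOpenImmersion.lift_fac, h, Category.id_comp]
  · rw [← cancel_mono U.ι, Category.assoc, morphismRestrict_ι, IsOpenImmersion.lift_fac_assoc, hs,
      Category.id_comp]

theorem isUnit_of_forall_notMem {B : CommRingCat.{0}} {b : B}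
    (h : ∀ q : Spec B, b ∉ q.asIdeal) : IsUnit b := by
  by_contra hb
  obtain ⟨m, hm, hbm⟩ := exists_max_ideal_of_mem_nonunits hb
  exact h ⟨m, hm.isPrime⟩ hbm

theorem exists_Spec_map_eq {R : CommRingCat.{0}} (p : Spec R) :
    ∃ (κ : CommRingCat.{0}) (ρ : R ⟶ κ) (pt : Spec κ), Spec.map ρ pt = p ∧
      ∀ a ∈ p.asIdeal, ρ a = 0 := by
  let I : Ideal R := p.asIdeal
  have hI : I.IsPrime := p.isPrime
  refine ⟨CommRingCat.of (R ⧸ I), CommRingCat.ofHom (Ideal.Quotient.mk I),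
    (⟨⊥, Ideal.isPrime_bot⟩ : PrimeSpectrum (R ⧸ I)), ?_, fun a ha => ?_⟩
  · refine PrimeSpectrum.ext (Ideal.ext fun a => ?_)
    exact Ideal.Quotient.eq_zero_iff_mem (I := I)
  · exact Ideal.Quotient.eq_zero_iff_mem.mpr ha

theorem injOn_preimage_of_isIso {X Y : Scheme.{0}} (f : X ⟶ Y) (U : Y.Opens) [IsIso (f ∣_ U)]
    {x₁ x₂ : X} (h : f x₁ = f x₂) (hU : f x₁ ∈ U) : x₁ = x₂ := by
  obtain ⟨z₁, rfl⟩ : ∃ z : (f ⁻¹ᵁ U).toScheme, (f ⁻¹ᵁ U).ι z = x₁ := ⟨⟨x₁, hU⟩, rfl⟩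
  obtain ⟨z₂, rfl⟩ : ∃ z : (f ⁻¹ᵁ U).toScheme, (f ⁻¹ᵁ U).ι z = x₂ := ⟨⟨x₂, show f x₂ ∈ U by rwa [← h]⟩, rfl⟩
  congr 1
  apply (f ∣_ U).isOpenEmbedding.injective
  apply U.ι.isOpenEmbedding.injective
  rw [← Hom.comp_apply, ← Hom.comp_apply, morphismRestrict_ι, Hom.comp_apply, Hom.comp_apply]
  exact h

end AlgebraicGeometry.Scheme

/-! ### The scheme of kernel lines of a nilpotent matrix -/

/-- Charts exhibiting a morphism as the projective line bundle of kernels of a nilpotent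
`2 × 2` matrix: over `Spec (base j)` the scheme `X` is covered by two affine charts, on which the
kernel is spanned by a vector whose `i`-th coordinate is `1` and whose other coordinate is the
slope. -/
structure KernelCharts {X Y : Scheme.{0}} (f : X ⟶ Y) (J : Type) where
  base : J → CommRingCat.{0}
  line : J → Fin 2 → CommRingCat.{0}
  baseMap : ∀ j, Spec (base j) ⟶ Y
  lineMap : ∀ j i, Spec (line j i) ⟶ X
  ring : ∀ j i, base j ⟶ line j i
  mat : ∀ j, Matrix (Fin 2) (Fin 2) (base j)
  slope : ∀ j i, line j i
  isOpenImmersion_baseMap : ∀ j, IsOpenImmersion (baseMap j)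
  isOpenImmersion_lineMap : ∀ j i, IsOpenImmersion (lineMap j i)
  exists_mem_range_baseMap : ∀ y, ∃ j, y ∈ Set.range (baseMap j)
  lineMap_comp : ∀ j i, lineMap j i ≫ f = Spec.map (ring j i) ≫ baseMap j
  exists_mem_range_lineMap : ∀ j x, f x ∈ Set.range (baseMap j) → ∃ i, x ∈ Set.range (lineMap j i)
  mat_trace : ∀ j, mat j 0 0 + mat j 1 1 = 0
  mat_det : ∀ j, mat j 0 0 * mat j 1 1 = mat j 0 1 * mat j 1 0
  slope_spec : ∀ j i l, ring j i (mat j l i) + ring j i (mat j l i.rev) * slope j i = 0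
  slope_lift : ∀ j i (B : CommRingCat.{0}) (ρ : base j ⟶ B) (s : B),
    (∀ l, ρ (mat j l i) + ρ (mat j l i.rev) * s = 0) →
      ∃ τ : line j i ⟶ B, ring j i ≫ τ = ρ ∧ τ (slope j i) = s
  slope_generates : ∀ j i a, ∃ P : Polynomial (base j), P.eval₂ (ring j i).hom (slope j i) = a
  mem_range_rev : ∀ j i (q : Spec (line j i)),
    lineMap j i q ∈ Set.range (lineMap j i.rev) ↔ slope j i ∉ q.asIdeal
  overlap : ∀ j i (B : CommRingCat.{0}) (τ : line j i ⟶ B) (τ' : line j i.rev ⟶ B),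
    ring j i ≫ τ = ring j i.rev ≫ τ' → τ (slope j i) * τ' (slope j i.rev) = 1 →
      Spec.map τ ≫ lineMap j i = Spec.map τ' ≫ lineMap j i.rev

namespace KernelCharts
open AlgebraicGeometry.Scheme

variable {X Y : Scheme.{0}} {f : X ⟶ Y} {J : Type} (C : KernelCharts f J)

attribute [instance] isOpenImmersion_baseMap isOpenImmersion_lineMap

include C

theorem slope_ext {j : J} {i : Fin 2} {B : CommRingCat.{0}} {τ τ' : C.line j i ⟶ B}
    (h : C.ring j i ≫ τ = C.ring j i ≫ τ') (hs : τ (C.slope j i) = τ' (C.slope j i)) : τ = τ' := by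
  ext a
  obtain ⟨P, rfl⟩ := C.slope_generates j i a
  rw [Polynomial.hom_eval₂, Polynomial.hom_eval₂]
  have h' : τ.hom.comp (C.ring j i).hom = τ'.hom.comp (C.ring j i).hom := congrArg (·.hom) h
  have hs' : τ.hom (C.slope j i) = τ'.hom (C.slope j i) := hs
  rw [h', hs']

/-- Dividing a kernel vector by its unit coordinate gives the slope of a point of the chart. -/
theorem exists_lift_of_mulVec {j : J} {B : CommRingCat.{0}} (ρ : C.base j ⟶ B) (v : Fin 2 → B)
    (i : Fin 2) (hv : IsUnit (v i)) (h : ∀ l, ρ (C.mat j l i) * v i + ρ (C.mat j l i.rev) * v i.rev = 0) :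
    ∃ h : Spec B ⟶ X, h ≫ f = Spec.map ρ ≫ C.baseMap j := by
  obtain ⟨u, hu⟩ := hv.exists_right_inv
  obtain ⟨τ, hτ, -⟩ := C.slope_lift j i B ρ (u * v i.rev) fun l => by
    linear_combination u * h l - ρ (C.mat j l i) * hu
  exact ⟨Spec.map τ ≫ C.lineMap j i, by
    rw [Category.assoc, C.lineMap_comp, ← Category.assoc, ← Spec.map_comp, hτ]⟩

/-- The matrix squares to zero. -/
theorem mat_sq (j : J) (l m k : Fin 2) :
    C.mat j l k * C.mat j k m + C.mat j l k.rev * C.mat j k.rev m = 0 := by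
  have h1 := C.mat_trace j
  have h2 := C.mat_det j
  have h3 : C.mat j 1 1 = - C.mat j 0 0 := eq_neg_of_add_eq_zero_right h1
  rw [h3] at h2
  fin_cases l <;> fin_cases m <;> fin_cases k <;> simp [h3] <;> 
    first | linear_combination -h2 | ring

/-- The open set where the matrix does not vanish. -/
noncomputable def locus : Y.Opens := ⨆ (j : J) (l : Fin 2) (m : Fin 2),
  C.baseMap j ''ᵁ (PrimeSpectrum.basicOpen (C.mat j l m))

theorem mem_locus {y : Y} : y ∈ C.locus ↔
    ∃ (j : J) (p : Spec (C.base j)) (l m : Fin 2), C.baseMap j p = y ∧ C.mat j l m ∉ p.asIdeal := by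
  simp only [locus, TopologicalSpace.Opens.mem_iSup]
  constructor
  · rintro ⟨j, l, m, p, hp, rfl⟩
    exact ⟨j, p, l, m, rfl, hp⟩
  · rintro ⟨j, p, l, m, rfl, hp⟩
    exact ⟨j, l, m, p, hp, rfl⟩

/-- In chart `m` the `m`-th column is minus the slope times the other column. If that column has a
nonzero entry, the slope is nonzero and the point also lies in the other chart. -/
theorem mem_range_lineMap_rev {j : J} {x : X} {p : Spec (C.base j)} (hx : f x = C.baseMap j p)
    {l m : Fin 2} (h : C.mat j l m ∉ p.asIdeal) : x ∈ Set.range (C.lineMap j m.rev) := by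
  obtain ⟨i, q, rfl⟩ := C.exists_mem_range_lineMap j x ⟨p, hx.symm⟩
  by_cases hi : i = m
  · subst hi
    rw [C.mem_range_rev]
    intro hs
    have hq : Spec.map (C.ring j i) q = p := by
      apply (C.baseMap j).isOpenEmbedding.injective
      rw [← hx, ← Hom.comp_apply, ← Hom.comp_apply, C.lineMap_comp]
    refine h ?_
    rw [← hq]
    change C.ring j i (C.mat j l i) ∈ q.asIdeal
    rw [eq_neg_of_add_eq_zero_left (C.slope_spec j i l)]
    exact neg_mem (Ideal.mul_mem_left _ _ hs)
  · have : i = m.rev := by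
      fin_cases i <;> fin_cases m <;> first | rfl | exact absurd rfl hi
    subst this
    exact ⟨q, rfl⟩

theorem isUnit_of_range_subset {j : J} {l m : Fin 2} {B : CommRingCat.{0}} {W : Scheme.{0}}
    {g : W ⟶ Y} {i : Spec B ⟶ W} {ρ : C.base j ⟶ B}
    (hi : Set.range i ⊆ g ⁻¹ᵁ (C.baseMap j ''ᵁ (PrimeSpectrum.basicOpen (C.mat j l m))))
    (h : i ≫ g = Spec.map ρ ≫ C.baseMap j) : IsUnit (ρ (C.mat j l m)) := by
  refine isUnit_of_forall_notMem fun q hq => ?_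
  obtain ⟨p, hp, e⟩ : g (i q) ∈ C.baseMap j ''ᵁ (PrimeSpectrum.basicOpen (C.mat j l m)) := hi ⟨q, rfl⟩
  rw [← Hom.comp_apply, h, Hom.comp_apply] at e
  obtain rfl := (C.baseMap j).isOpenEmbedding.injective e
  exact hp hq

/-- In the chart `m.rev` the slope satisfies a linear equation with leading coefficient the entry
`(l, m)`, so it is determined wherever that entry is a unit. -/
theorem hom_ext_of_mem_locus {W : Scheme.{0}} {h₁ h₂ : W ⟶ X} (h : h₁ ≫ f = h₂ ≫ f)
    (hW : ∀ w, (h₁ ≫ f) w ∈ C.locus) : h₁ = h₂ := by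
  refine hom_ext_of_exists_isOpenImmersion fun w => ?_
  obtain ⟨j, p, l, m, hp, hN⟩ := C.mem_locus.mp (hW w)
  obtain ⟨B, i, hi, τ₁, τ₂, h1, h2, h3, h4⟩ := exists_Spec_factor₂ h₁ h₂ (C.lineMap j m.rev)
    (C.lineMap j m.rev) (w := w)
    ((h₁ ≫ f) ⁻¹ᵁ (C.baseMap j ''ᵁ (PrimeSpectrum.basicOpen (C.mat j l m)))) ⟨p, hN, hp⟩
    (C.mem_range_lineMap_rev (by rw [← Hom.comp_apply, hp]) hN)
    (C.mem_range_lineMap_rev (by rw [← Hom.comp_apply, hp, h]) hN)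
  refine ⟨_, i, hi, h1, ?_⟩
  rw [h3, h4]
  have h5 : i ≫ h₁ ≫ f = Spec.map (C.ring j m.rev ≫ τ₁) ≫ C.baseMap j := by
    rw [← Category.assoc, h3, Category.assoc, C.lineMap_comp, Spec.map_comp, Category.assoc]
  have h6 : i ≫ h₁ ≫ f = Spec.map (C.ring j m.rev ≫ τ₂) ≫ C.baseMap j := by
    rw [h, ← Category.assoc, h4, Category.assoc, C.lineMap_comp, Spec.map_comp, Category.assoc]
  have h7 : C.ring j m.rev ≫ τ₁ = C.ring j m.rev ≫ τ₂ := by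
    rw [h5, cancel_mono] at h6
    exact Spec.map_injective h6
  have hu := C.isUnit_of_range_subset h2 h5
  have e1 := congrArg τ₁ (C.slope_spec j m.rev l)
  have e2 := congrArg τ₂ (C.slope_spec j m.rev l)
  rw [map_add, map_mul, map_zero, Fin.rev_rev, ← CommRingCat.comp_apply, ← CommRingCat.comp_apply]
    at e1 e2
  rw [← h7] at e2
  rw [C.slope_ext h7 (hu.mul_left_cancel (by linear_combination e1 - e2))]

theorem isIso_restrict_locus : IsIso (f ∣_ C.locus) := by
  have hex : ∀ w : C.locus.toScheme, ∃ (V : Scheme.{0}) (i : V ⟶ C.locus.toScheme)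
      (_ : IsOpenImmersion i), w ∈ Set.range i ∧ ∃ h : V ⟶ X, h ≫ f = i ≫ C.locus.ι := fun w => by
    obtain ⟨j, p, l, m, hp, hN⟩ := C.mem_locus.mp w.2
    obtain ⟨B, i, hi, ρ, h1, h2, h3⟩ := exists_Spec_factor C.locus.ι (C.baseMap j) (w := w)
      (C.locus.ι ⁻¹ᵁ (C.baseMap j ''ᵁ (PrimeSpectrum.basicOpen (C.mat j l m)))) ⟨p, hN, hp⟩ ⟨p, hp⟩
    refine ⟨_, i, hi, h1, ?_⟩
    rw [h3]
    -- As the matrix squares to zero, its `m`-th column is a kernel vector, and its entry in row `l`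
    -- is a unit here.
    refine C.exists_lift_of_mulVec ρ (fun k => ρ (C.mat j k m)) l (C.isUnit_of_range_subset h2 h3)
      fun k => ?_
    simpa using congrArg ρ (C.mat_sq j k m l)
  obtain ⟨s, hs, -⟩ := exists_lift_of_locally f C.locus.ι hex (fun V i _ h h' e e' =>
    C.hom_ext_of_mem_locus (e.trans e'.symm) fun v => by
      rw [e, Hom.comp_apply]
      exact (i v).2)
  refine isIso_morphismRestrict_of_section f _ s hs (C.hom_ext_of_mem_locus ?_ fun w => ?_)
  · rw [Category.assoc, hs, morphismRestrict_ι]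
  · rw [Category.assoc, hs, Hom.comp_apply]
    exact ((f ∣_ C.locus) w).2

/-- Over a zero of the matrix every line is allowed. The two coordinate lines have slope zero in
their charts and differ, since slope zero excludes membership in the other chart. -/
theorem exists_ne_of_mem {j : J} (p : Spec (C.base j)) (hp : ∀ l m, C.mat j l m ∈ p.asIdeal) :
    ∃ x₁ x₂ : X, x₁ ≠ x₂ ∧ f x₁ = C.baseMap j p ∧ f x₂ = C.baseMap j p := by
  obtain ⟨κ, ρ, pt, hpt, hρ⟩ := exists_Spec_map_eq p
  have key : ∀ i, ∃ q : Spec (C.line j i), C.slope j i ∈ q.asIdeal ∧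
      f (C.lineMap j i q) = C.baseMap j p := fun i => by
    obtain ⟨τ, h1, h2⟩ := C.slope_lift j i κ ρ 0 fun l => by
      rw [hρ _ (hp l i), zero_add, mul_zero]
    refine ⟨Spec.map τ pt, ?_, ?_⟩
    · change τ _ ∈ pt.asIdeal
      rw [h2]
      exact zero_mem _
    · rw [← Hom.comp_apply, C.lineMap_comp, ← hpt, ← h1, Spec.map_comp]
      rfl
  obtain ⟨q₀, h0, e0⟩ := key 0
  obtain ⟨q₁, h1, e1⟩ := key 1
  refine ⟨_, _, fun h => ?_, e0, e1⟩
  exact (C.mem_range_rev j 0 q₀).mp ⟨q₁, h.symm⟩ h0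

/-- Vanishing of the matrix is independent of the chart. No transition formula is needed: fibres
over the locus are single points, while over a zero of the matrix there are two. -/
theorem baseMap_mem_locus {j : J} (p : Spec (C.base j)) :
    C.baseMap j p ∈ C.locus ↔ ∃ l m, C.mat j l m ∉ p.asIdeal := by
  refine ⟨fun h => ?_, fun ⟨l, m, h⟩ => C.mem_locus.mpr ⟨j, p, l, m, rfl, h⟩⟩
  by_contra! hp
  obtain ⟨x₁, x₂, hne, h1, h2⟩ := C.exists_ne_of_mem p hp
  have := C.isIso_restrict_locus
  exact hne (injOn_preimage_of_isIso f C.locus (h1.trans h2.symm) (by rwa [h1]))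

end KernelCharts

namespace AlgebraicGeometry.Scheme

theorem exists_eq_Spec_map_comp {R : CommRingCat.{0}} [IsLocalRing R] {S : Scheme.{0}}
    (g : Spec R ⟶ S) {A : CommRingCat.{0}} (c : Spec A ⟶ S) [IsOpenImmersion c]
    (h : g (IsLocalRing.closedPoint R) ∈ Set.range c) : ∃ ρ : A ⟶ R, g = Spec.map ρ ≫ c := by
  have hr : Set.range g ⊆ Set.range c := by
    rintro _ ⟨x, rfl⟩
    have := preimage_eq_top_of_closedPoint_mem (f := g) (U := c.opensRange) h
    exact (show x ∈ g ⁻¹ᵁ c.opensRange by rw [this]; trivial)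
  refine ⟨Spec.preimage (IsOpenImmersion.lift c g hr), ?_⟩
  rw [Spec.map_preimage, IsOpenImmersion.lift_fac]

theorem apply_mem_range_of_comp_eq {V W X Y : Scheme.{0}} {f : X ⟶ Y} {g : V ⟶ X} {g' : V ⟶ W}
    {c : W ⟶ Y} (h : g ≫ f = g' ≫ c) (v : V) : f (g v) ∈ Set.range c :=
  ⟨g' v, by rw [← Hom.comp_apply, ← Hom.comp_apply, h]⟩

end AlgebraicGeometry.Scheme

/-! ### Properness by the valuative criterion -/

namespace KernelCharts
open AlgebraicGeometry.Scheme

variable {X Y : Scheme.{0}} {f : X ⟶ Y} {J : Type} (C : KernelCharts f J)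
include C

theorem ring_comp_eq {j : J} {i : Fin 2} {B : CommRingCat.{0}} {τ : C.line j i ⟶ B}
    {ρ : C.base j ⟶ B} {g : Spec B ⟶ X} (hg : g = Spec.map τ ≫ C.lineMap j i)
    (h : g ≫ f = Spec.map ρ ≫ C.baseMap j) : C.ring j i ≫ τ = ρ := by
  rw [hg, Category.assoc, C.lineMap_comp, ← Category.assoc, ← Spec.map_comp, cancel_mono] at h
  exact Spec.map_injective h

theorem slope_rev_lift {j : J} {i : Fin 2} {B : CommRingCat.{0}} (τ : C.line j i ⟶ B) {s : B}
    (hs : τ (C.slope j i) * s = 1) : ∃ τ' : C.line j i.rev ⟶ B,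
      C.ring j i.rev ≫ τ' = C.ring j i ≫ τ ∧ τ' (C.slope j i.rev) = s := by
  refine C.slope_lift j i.rev B (C.ring j i ≫ τ) s fun l => ?_
  have e := congrArg τ (C.slope_spec j i l)
  rw [map_add, map_mul, map_zero] at e
  rw [Fin.rev_rev, CommRingCat.comp_apply, CommRingCat.comp_apply]
  linear_combination s * e - τ (C.ring j i (C.mat j l i.rev)) * hs

theorem slope_mul_slope {j : J} {i : Fin 2} {K : Type} [Field K] (τ : C.line j i ⟶ CommRingCat.of K)
    (τ' : C.line j i.rev ⟶ CommRingCat.of K)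
    (h : Spec.map τ ≫ C.lineMap j i = Spec.map τ' ≫ C.lineMap j i.rev) :
    τ (C.slope j i) * τ' (C.slope j i.rev) = 1 := by
  let pt : Spec (CommRingCat.of K) := (⊥ : PrimeSpectrum K)
  have h0 : τ (C.slope j i) ≠ 0 := by
    have h1 := (C.mem_range_rev j i (Spec.map τ pt)).mp
      ⟨Spec.map τ' pt, by rw [← Hom.comp_apply, ← Hom.comp_apply, h]⟩
    exact h1
  have hs : τ (C.slope j i) * (τ (C.slope j i) : K)⁻¹ = 1 := mul_inv_cancel₀ (G₀ := K) h0
  obtain ⟨τ'', h1, h2⟩ := C.slope_rev_lift τ (s := (τ (C.slope j i) : K)⁻¹) hs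
  have h3 := C.overlap j i _ τ τ'' h1.symm (by rw [h2]; exact hs)
  rw [h, cancel_mono] at h3
  obtain rfl := Spec.map_injective h3
  rw [h2]
  exact hs

theorem valuativeCriterion_existence : ValuativeCriterion.Existence f := by
  rintro ⟨R, K, i₁, i₂, ⟨w⟩⟩
  have : IsLocalRing (CommRingCat.of R) := inferInstanceAs (IsLocalRing R)
  have : IsLocalRing (CommRingCat.of K) := inferInstanceAs (IsLocalRing K)
  let a : CommRingCat.of R ⟶ CommRingCat.of K := CommRingCat.ofHom (algebraMap R K)
  have ha : Function.Injective a := IsFractionRing.injective R K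
  obtain ⟨j, hj⟩ := C.exists_mem_range_baseMap (i₂ (IsLocalRing.closedPoint (CommRingCat.of R)))
  obtain ⟨ρ, hρ⟩ := exists_eq_Spec_map_comp i₂ (C.baseMap j) hj
  have hw : i₁ ≫ f = Spec.map (ρ ≫ a) ≫ C.baseMap j := by
    rw [w, hρ, Spec.map_comp, Category.assoc]
  obtain ⟨i, hi⟩ := C.exists_mem_range_lineMap j (i₁ (IsLocalRing.closedPoint (CommRingCat.of K)))
    (apply_mem_range_of_comp_eq hw _)
  obtain ⟨τ, hτ⟩ := exists_eq_Spec_map_comp i₁ (C.lineMap j i) hi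
  have hτρ := C.ring_comp_eq hτ hw
  have hlift : ∀ (i' : Fin 2) (τ' : C.line j i' ⟶ CommRingCat.of K),
      C.ring j i' ≫ τ' = ρ ≫ a → i₁ = Spec.map τ' ≫ C.lineMap j i' →
      ∀ r : R, a r = τ' (C.slope j i') → ∃ l : Spec (CommRingCat.of R) ⟶ X,
        Spec.map a ≫ l = i₁ ∧ l ≫ f = i₂ := by
    intro i' τ' h1 h2 r hr
    obtain ⟨τ₀, h3, h4⟩ := C.slope_lift j i' _ ρ r fun l => ha (by
      have := congrArg τ' (C.slope_spec j i' l)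
      rw [map_add, map_mul, map_zero, ← CommRingCat.comp_apply, ← CommRingCat.comp_apply, h1] at this
      rw [map_add, map_mul, map_zero, hr]
      exact this)
    refine ⟨Spec.map τ₀ ≫ C.lineMap j i', ?_, ?_⟩
    · rw [h2, ← Category.assoc, ← Spec.map_comp]
      congr 2
      refine C.slope_ext ?_ ?_
      · rw [← Category.assoc, h3, h1]
      · rw [CommRingCat.comp_apply, h4, hr]
    · rw [Category.assoc, C.lineMap_comp, ← Category.assoc, ← Spec.map_comp, h3, hρ]
  obtain ⟨l, h1, h2⟩ : ∃ l : Spec (CommRingCat.of R) ⟶ X, Spec.map a ≫ l = i₁ ∧ l ≫ f = i₂ := by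
    -- The slope or its inverse is integral, so the line extends in the present chart or in the
    -- opposite one.
    rcases ValuationRing.isInteger_or_isInteger R (τ (C.slope j i) : K) with ⟨r, hr⟩ | ⟨r, hr⟩
    · exact hlift i τ hτρ hτ r hr
    · by_cases h0 : (τ (C.slope j i) : K) = 0
      · exact hlift i τ hτρ hτ 0 (by rw [map_zero]; exact h0.symm)
      · have hs : τ (C.slope j i) * (τ (C.slope j i) : K)⁻¹ = 1 := mul_inv_cancel₀ (G₀ := K) h0
        obtain ⟨τ', h1, h2⟩ := C.slope_rev_lift τ (s := (τ (C.slope j i) : K)⁻¹) hs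
        have h3 := C.overlap j i _ τ τ' h1.symm (by rw [h2]; exact hs)
        exact hlift i.rev τ' (h1.trans hτρ) (hτ.trans h3) r (hr.trans h2.symm)
  exact ⟨⟨⟨l, h1, h2⟩⟩⟩

theorem valuativeCriterion_uniqueness : ValuativeCriterion.Uniqueness f := by
  rintro ⟨R, K, i₁, i₂, ⟨w⟩⟩
  have : IsLocalRing (CommRingCat.of R) := inferInstanceAs (IsLocalRing R)
  let a : CommRingCat.of R ⟶ CommRingCat.of K := CommRingCat.ofHom (algebraMap R K)
  have ha : Function.Injective a := IsFractionRing.injective R K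
  constructor
  rintro ⟨l₁, h1, h1'⟩ ⟨l₂, h2, h2'⟩
  ext : 1
  change Spec.map a ≫ l₁ = i₁ at h1
  change Spec.map a ≫ l₂ = i₁ at h2
  change l₁ ≫ f = i₂ at h1'
  change l₂ ≫ f = i₂ at h2'
  change l₁ = l₂
  obtain ⟨j, hj⟩ := C.exists_mem_range_baseMap (i₂ (IsLocalRing.closedPoint (CommRingCat.of R)))
  obtain ⟨ρ, hρ⟩ := exists_eq_Spec_map_comp i₂ (C.baseMap j) hj
  obtain ⟨k, hk⟩ := C.exists_mem_range_lineMap j (l₁ (IsLocalRing.closedPoint (CommRingCat.of R)))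
    (apply_mem_range_of_comp_eq (h1'.trans hρ) _)
  obtain ⟨k', hk'⟩ := C.exists_mem_range_lineMap j (l₂ (IsLocalRing.closedPoint (CommRingCat.of R)))
    (apply_mem_range_of_comp_eq (h2'.trans hρ) _)
  obtain ⟨τ₁, e1⟩ := exists_eq_Spec_map_comp l₁ (C.lineMap j k) hk
  obtain ⟨τ₂, e2⟩ := exists_eq_Spec_map_comp l₂ (C.lineMap j k') hk'
  have r1 := C.ring_comp_eq e1 (h1'.trans hρ)
  have r2 := C.ring_comp_eq e2 (h2'.trans hρ)
  have h3 : Spec.map (τ₁ ≫ a) ≫ C.lineMap j k = Spec.map (τ₂ ≫ a) ≫ C.lineMap j k' := by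
    rw [Spec.map_comp, Spec.map_comp, Category.assoc, Category.assoc, ← e1, ← e2, h1, h2]
  -- In the same chart the slopes agree in `K`, hence in `R`. In opposite charts their product is
  -- one in `K`, hence in `R`, and the overlap condition applies.
  by_cases hkk : k' = k
  · subst hkk
    rw [cancel_mono] at h3
    have h4 := Spec.map_injective h3
    rw [e1, e2, C.slope_ext (r1.trans r2.symm) (ha ?_)]
    exact congrArg (fun τ => τ (C.slope j k')) h4
  · have : k' = k.rev := by
      fin_cases k <;> fin_cases k' <;> first | rfl | exact absurd rfl hkk
    subst this
    rw [e1, e2]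
    refine C.overlap j k _ τ₁ τ₂ (r1.trans r2.symm) (ha ?_)
    rw [map_mul, map_one]
    exact C.slope_mul_slope _ _ h3

/-- Finiteness of the atlas and Noetherian base rings supply the quasi-compactness and
quasi-separatedness that the valuative criterion does not give. -/
theorem isProper [Finite J] [∀ j, IsNoetherianRing (C.base j)] (p : Y ⟶ Spec (CommRingCat.of ℂ))
    [LocallyOfFiniteType (f ≫ p)] : IsProper f := by
  have : LocallyOfFiniteType f := locallyOfFiniteType_of_comp f p
  have hX : IsLocallyNoetherian X := LocallyOfFiniteType.isLocallyNoetherian (f ≫ p)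
  have hY : IsLocallyNoetherian Y := by
    let 𝒰 : Y.OpenCover := {
      I₀ := J, X := fun j => Spec (C.base j), f := C.baseMap
      mem₀ := by
        rw [presieve₀_mem_precoverage_iff]
        exact ⟨C.exists_mem_range_baseMap, inferInstance⟩ }
    exact (isLocallyNoetherian_iff_openCover 𝒰).mpr fun j =>
      inferInstanceAs (IsLocallyNoetherian (Spec (C.base j)))
  have : CompactSpace X := by
    refine ⟨?_⟩
    have : (Set.univ : Set X) = ⋃ (j : J) (i : Fin 2), Set.range (C.lineMap j i) := by
      refine (Set.eq_univ_of_forall fun x => ?_).symm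
      obtain ⟨j, hj⟩ := C.exists_mem_range_baseMap (f x)
      obtain ⟨i, hi⟩ := C.exists_mem_range_lineMap j x hj
      exact Set.mem_iUnion₂.mpr ⟨j, i, hi⟩
    rw [this]
    exact isCompact_iUnion fun j => isCompact_iUnion fun i =>
      isCompact_range (C.lineMap j i).continuous
  exact IsProper.of_valuativeCriterion f (ValuativeCriterion.iff.mpr
    ⟨C.valuativeCriterion_existence, C.valuativeCriterion_uniqueness⟩)

theorem surjective : Function.Surjective f := by
  intro y
  by_cases hy : y ∈ C.locus
  · have := C.isIso_restrict_locus
    obtain ⟨x, hx⟩ := (f ∣_ C.locus).surjective ⟨y, hy⟩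
    refine ⟨(f ⁻¹ᵁ C.locus).ι x, ?_⟩
    rw [← Hom.comp_apply, ← morphismRestrict_ι, Hom.comp_apply, hx]
    rfl
  · obtain ⟨j, p, rfl⟩ := C.exists_mem_range_baseMap y
    rw [C.baseMap_mem_locus] at hy
    push Not at hy
    obtain ⟨x, -, -, hx, -⟩ := C.exists_ne_of_mem p hy
    exact ⟨x, hx⟩

end KernelCharts

/-! ### Reducedness of smooth algebras and dense open sets -/

/-- By flatness `R` embeds in its base change to the fraction field of `B`, which is étale over a
field and so reduced. -/
theorem Algebra.Etale.isReduced {B R : Type*} [CommRing B] [IsDomain B] [CommRing R] [Algebra B R]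
    [Algebra.Etale B R] : IsReduced R := by
  let F := FractionRing B
  have h : IsReduced (TensorProduct B F R) :=
    Algebra.FormallyUnramified.isReduced_of_field F (TensorProduct B F R)
  exact isReduced_of_injective
    (Algebra.TensorProduct.includeRight : R →ₐ[B] TensorProduct B F R)
    (Algebra.TensorProduct.includeRight_injective (IsFractionRing.injective B F))

theorem Algebra.Smooth.isReduced (K : Type*) {R : Type*} [Field K] [CommRing R] [Algebra K R]
    [Algebra.Smooth K R] : IsReduced R := by
  refine ⟨fun a ha => ?_⟩
  by_contra h0
  have hI : Ideal.span {a} ≠ ⊥ := by simpa using h0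
  -- At a maximal ideal containing the annihilator of `a`, the nilpotent `a` survives localization,
  -- contradicting the étale case.
  obtain ⟨P, hP, hle⟩ := (Ideal.ne_top_iff_exists_maximal (I := (Ideal.span {a}).annihilator)).mp
    (by rw [Ne, Submodule.annihilator_eq_top_iff]; exact hI)
  obtain ⟨f, hf, n, _, h1, h2⟩ := Algebra.IsSmoothAt.exists_isStandardEtale_mvPolynomial
    (R := K) (p := P)
  have : Algebra.Etale (MvPolynomial (Fin n) K) (Localization.Away f) := inferInstance
  have hred := Algebra.Etale.isReduced (B := MvPolynomial (Fin n) K) (R := Localization.Away f)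
  have hz : algebraMap R (Localization.Away f) a = 0 := (ha.map _).eq_zero
  obtain ⟨⟨_, k, rfl⟩, hk⟩ := (IsLocalization.map_eq_zero_iff (Submonoid.powers f) _ a).mp hz
  refine hf (hP.isPrime.mem_of_pow_mem k (hle ?_))
  rw [Submodule.mem_annihilator_span_singleton]
  exact hk

/-- Choose `b` outside `q` and inside all other minimal primes. The dense set `U` meets the basic
open set of `b`, and any point there is a specialization of `q`. -/
theorem PrimeSpectrum.mem_of_mem_minimalPrimes {B : Type*} [CommRing B] [IsNoetherianRing B]
    {U : Set (PrimeSpectrum B)} (hU : IsOpen U) (hd : Dense U) {q : PrimeSpectrum B}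
    (hq : q.asIdeal ∈ minimalPrimes B) : q ∈ U := by
  classical
  let s := (minimalPrimes.finite_of_isNoetherianRing B).toFinset.erase q.asIdeal
  have hs : ¬ s.inf id ≤ q.asIdeal := fun h => by
    obtain ⟨q', hq', hle⟩ := (Ideal.IsPrime.inf_le' q.isPrime).mp h
    simp only [s, Finset.mem_erase, Set.Finite.mem_toFinset] at hq'
    exact hq'.1 (le_antisymm hle (hq.2 hq'.2.1 hle))
  obtain ⟨b, hb, hbq⟩ := SetLike.not_le_iff_exists.mp hs
  obtain ⟨r, hr, hrU⟩ := hd.inter_open_nonempty (PrimeSpectrum.basicOpen b)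
    (PrimeSpectrum.basicOpen b).isOpen ⟨q, hbq⟩
  obtain ⟨q', hq', hle⟩ := Ideal.exists_minimalPrimes_le (show (⊥ : Ideal B) ≤ r.asIdeal from bot_le)
  have h1 : q' = q.asIdeal := by
    by_contra hne
    have : q' ∈ s := by
      simp only [s, Finset.mem_erase, Set.Finite.mem_toFinset]
      exact ⟨hne, hq'⟩
    exact hr (hle ((Finset.inf_le this : s.inf id ≤ q') hb))
  have : q ⤳ r := (PrimeSpectrum.le_iff_specializes q r).mp (show q.asIdeal ≤ r.asIdeal from h1 ▸ hle)
  exact this.mem_open hU hrU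

namespace AlgebraicGeometry.Scheme

theorem exists_smooth_of_isOpenImmersion {Z : Scheme.{0}} (q : Z ⟶ Spec (CommRingCat.of ℂ))
    [Smooth q] {B : CommRingCat.{0}} (i : Spec B ⟶ Z) [IsOpenImmersion i] :
    ∃ a : ℂ →+* B, i ≫ q = Spec.map (CommRingCat.ofHom a) ∧ a.Smooth := by
  refine ⟨(Spec.preimage (i ≫ q)).hom, (Spec.map_preimage _).symm, ?_⟩
  rw [← HasRingHomProperty.Spec_iff (P := @Smooth), Spec.map_preimage]
  infer_instance

theorem isReduced_of_smooth {Z : Scheme.{0}} (q : Z ⟶ Spec (CommRingCat.of ℂ))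
    [Smooth q] : IsReduced Z := by
  have : ∀ z : Z, _root_.IsReduced (Z.presheaf.stalk z) := fun z => by
    obtain ⟨B, i, hi, ⟨x, rfl⟩, -⟩ := exists_affine_mem_range_and_range_subset
      (X := Z) (x := z) (U := ⊤) trivial
    obtain ⟨a, -, ha⟩ := exists_smooth_of_isOpenImmersion q i
    let _ := a.toAlgebra
    have : Algebra.Smooth ℂ B := ha
    have := Algebra.Smooth.isReduced ℂ (R := B)
    exact isReduced_of_injective (i.stalkMap x).hom
      (ConcreteCategory.bijective_of_isIso (i.stalkMap x)).1
  exact isReduced_of_isReduced_stalk Z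

theorem eq_top_of_closedPoints {Z : Scheme.{0}} [JacobsonSpace Z] (U : Z.Opens)
    (h : ∀ z : Z, IsClosed {z} → z ∈ U) (z : Z) : z ∈ U := by
  by_contra hz
  obtain ⟨w, hw, hc⟩ := jacobsonSpace_iff_locallyClosed.mp (inferInstance : JacobsonSpace Z)
    ((U : Set Z)ᶜ) ⟨z, hz⟩ U.isOpen.isClosed_compl.isLocallyClosed
  exact hw (h w hc)

end AlgebraicGeometry.Scheme

/-! ### The universal property and the singular locus -/

namespace KernelCharts
open AlgebraicGeometry.Scheme

variable {X Y : Scheme.{0}} {f : X ⟶ Y} {J : Type} (C : KernelCharts f J)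

/-- The base rings are `ℂ`-algebras with three algebraically dependent generators, and the
vanishing locus of the matrix has at most one point in every chart, with residue field `ℂ`. -/
structure IsSurfaceOver (p : Y ⟶ Spec (CommRingCat.of ℂ)) : Prop where
  exists_algebra : ∀ j, ∃ a : ℂ →+* C.base j, C.baseMap j ≫ p = Spec.map (CommRingCat.ofHom a) ∧
    (letI := a.toAlgebra
     ∃ b : Fin 3 → C.base j, Algebra.adjoin ℂ (Set.range b) = ⊤ ∧ ¬ AlgebraicIndependent ℂ b) ∧
    ∀ r, ∃ c : ℂ, r - a c ∈ Ideal.span {C.mat j 0 0, C.mat j 0 1, C.mat j 1 0}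

variable {C} {p : Y ⟶ Spec (CommRingCat.of ℂ)}

theorem IsSurfaceOver.isNoetherianRing (hC : C.IsSurfaceOver p) (j : J) :
    IsNoetherianRing (C.base j) := by
  obtain ⟨a, -, ⟨b, hb, -⟩, -⟩ := hC.exists_algebra j
  let _ := a.toAlgebra
  have hft : Algebra.FiniteType ℂ (C.base j) := ⟨⟨(Set.finite_range b).toFinset, by simpa using hb⟩⟩
  exact Algebra.FiniteType.isNoetherianRing ℂ _

/-- An open immersion is surjective on stalks, so near a point of `O` every function on `Z` is a
fraction of functions pulled back from the chart of `Y`. -/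
theorem exists_fraction {Z : Scheme.{0}} {g : Z ⟶ Y} {O : Z.Opens} (hg : IsOpenImmersion (O.ι ≫ g))
    {j : J} {B : CommRingCat.{0}} {i : Spec B ⟶ Z} [IsOpenImmersion i] {ρ : C.base j ⟶ B}
    (h : i ≫ g = Spec.map ρ ≫ C.baseMap j) (q : Spec B) (hq : i q ∈ O) (b : B) :
    ∃ r s, ρ s ∉ q.asIdeal ∧ ρ s * b - ρ r ∈ q.asIdeal := by
  obtain ⟨B', i', hi', ρ', ⟨q', rfl⟩, h2, h3⟩ := exists_Spec_factor (i ≫ g) (C.baseMap j) (w := q)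
    (i ⁻¹ᵁ O) hq (apply_mem_range_of_comp_eq h _)
  obtain ⟨e, rfl⟩ : ∃ e, i' = Spec.map e := ⟨Spec.preimage i', (Spec.map_preimage i').symm⟩
  have hρ' : ρ' = ρ ≫ e := by
    rw [h, ← Category.assoc, ← Spec.map_comp, cancel_mono] at h3
    exact (Spec.map_injective h3).symm
  have hr : Set.range (Spec.map e ≫ i) ⊆ Set.range O.ι := by
    rw [Opens.range_ι]
    rintro _ ⟨x, rfl⟩
    exact h2 ⟨x, rfl⟩
  have h4 : Spec.map ρ' ≫ C.baseMap j = IsOpenImmersion.lift O.ι (Spec.map e ≫ i) hr ≫ O.ι ≫ g := by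
    rw [IsOpenImmersion.lift_fac_assoc, ← h3, Category.assoc]
  have h5 : IsOpenImmersion (Spec.map ρ' ≫ C.baseMap j) := h4 ▸ inferInstance
  have h6 : IsOpenImmersion (Spec.map ρ') := IsOpenImmersion.of_comp _ (C.baseMap j)
  have h7 : ρ'.hom.SurjectiveOnStalks := SurjectiveOnStalks.Spec_iff.mp inferInstance
  have hq'p : q'.asIdeal.IsPrime := q'.isPrime
  obtain ⟨x, r, c, hc, hr, e1⟩ := (RingHom.surjective_localRingHom_iff (f := ρ'.hom) q'.asIdeal).mp
    (h7 q'.asIdeal hq'p) (e b)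
  refine ⟨x, r, fun hh => hr ?_, ?_⟩
  · rw [hρ']
    exact hh
  · change e (ρ r * b - ρ x) ∈ q'.asIdeal
    refine (hq'p.mem_or_mem (?_ : c * e (ρ r * b - ρ x) ∈ _)).resolve_left hc
    rw [hρ'] at e1
    have e2 : c * e (ρ r) * e b = c * e (ρ x) := e1
    rw [map_sub, map_mul, show c * (e (ρ r) * e b - e (ρ x)) = 0 by linear_combination e2]
    exact zero_mem _

/-- On an affine neighbourhood the pulled back matrix has a kernel vector with a coordinate not
vanishing at `z`. After that coordinate and `s` are inverted, the vector defines a lift. -/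
theorem exists_lift_of_isClosed (hC : C.IsSurfaceOver p) {Z : Scheme.{0}} (g : Z ⟶ Y)
    [hs : Smooth (g ≫ p)] {O : Z.Opens} (hO : Dense (O : Set Z)) (hg : IsOpenImmersion (O.ι ≫ g))
    (hOl : ∀ z ∈ O, g z ∈ C.locus) (z : Z) (hz : IsClosed {z}) :
    ∃ (V : Scheme.{0}) (i : V ⟶ Z) (_ : IsOpenImmersion i), z ∈ Set.range i ∧
      ∃ h : V ⟶ X, h ≫ f = i ≫ g := by
  obtain ⟨j, hj⟩ := C.exists_mem_range_baseMap (g z)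
  obtain ⟨B, i, hi, ρ, ⟨P, rfl⟩, -, h1⟩ := exists_Spec_factor g (C.baseMap j) ⊤ trivial hj
  obtain ⟨a, ha, ⟨b, hb, hdep⟩, hres⟩ := hC.exists_algebra j
  have hP : P.asIdeal.IsMaximal := by
    refine (PrimeSpectrum.isClosed_singleton_iff_isMaximal (R := B) P).mp ?_
    have := hz.preimage i.continuous
    rwa [← Set.image_singleton, Set.preimage_image_eq _ i.isOpenEmbedding.injective] at this
  have hsm : (ρ.hom.comp a).Smooth := by
    obtain ⟨a', h2, h3⟩ := exists_smooth_of_isOpenImmersion (g ≫ p) i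
    have : CommRingCat.ofHom a' = CommRingCat.ofHom a ≫ ρ := Spec.map_injective (by
      rw [← h2, ← Category.assoc, h1, Category.assoc, ha, Spec.map_comp])
    have h4 : a' = ρ.hom.comp a := congrArg (·.hom) this
    rwa [h4] at h3
  let _ : Algebra ℂ (C.base j) := a.toAlgebra
  let _ : Algebra ℂ B := (ρ.hom.comp a).toAlgebra
  have hsm' : Algebra.Smooth ℂ B := hsm
  let φ : C.base j →ₐ[ℂ] B := { ρ.hom with commutes' := fun _ => rfl }
  have hφ : ∀ r, φ r = ρ r := fun _ => rfl
  have hNB : IsNoetherianRing B := Algebra.FiniteType.isNoetherianRing ℂ B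
  have htr : C.mat j 1 1 = - C.mat j 0 0 := eq_neg_of_add_eq_zero_right (C.mat_trace j)
  -- Generic points of the neighbourhood lie in the dense set `O`, where `g` is an open immersion
  -- and the matrix is nonzero.
  have hmem : ∀ q : Spec B, q.asIdeal ∈ minimalPrimes B → i q ∈ O := fun q hq =>
    PrimeSpectrum.mem_of_mem_minimalPrimes (U := i ⁻¹' O) (O.isOpen.preimage i.continuous)
      (hO.preimage i.isOpenEmbedding.isOpenMap) hq
  have hne : ∀ q : Spec B, q.asIdeal ∈ minimalPrimes B → ∃ l m, ρ (C.mat j l m) ∉ q.asIdeal := by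
    intro q hq
    have h2 := hOl _ (hmem q hq)
    rw [← Hom.comp_apply, h1, Hom.comp_apply, C.baseMap_mem_locus] at h2
    exact h2
  have hPp : P.asIdeal.IsPrime := P.isPrime
  obtain ⟨v, w, s, hvw, hsP, e1, e2⟩ := exists_unimodular_of_smooth φ hb hdep P.asIdeal
    (x := C.mat j 0 0) (y := C.mat j 0 1) (z := C.mat j 1 0)
    (by
      have := C.mat_det j
      rw [htr] at this
      linear_combination -this) hres
    (fun q hq b => exists_fraction hg h1 ⟨q, hq.1.1⟩ (hmem _ hq) b)
    (fun q hq => by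
      obtain ⟨l, m, hlm⟩ := hne ⟨q, hq.1.1⟩ hq
      change φ (C.mat j l m) ∉ q at hlm
      by_contra! hyz
      have hx : φ (C.mat j 0 0) ∈ q := by
        refine (hq.1.1.mem_or_mem (?_ : φ (C.mat j 0 0) * φ (C.mat j 0 0) ∈ q)).elim id id
        have := congrArg φ (C.mat_det j)
        rw [htr, map_mul, map_mul, map_neg] at this
        rw [show φ (C.mat j 0 0) * φ (C.mat j 0 0) = - (φ (C.mat j 0 1) * φ (C.mat j 1 0)) by
          linear_combination -this]
        exact neg_mem (Ideal.mul_mem_right _ _ hyz.1)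
      refine hlm ?_
      fin_cases l <;> fin_cases m
      exacts [hx, hyz.1, hyz.2, by
        change φ (C.mat j 1 1) ∈ q
        rw [htr, map_neg]
        exact neg_mem hx])
  rw [hφ, hφ] at e1 e2
  have key : ∀ k : Fin 2, ![v, w] k ∉ P.asIdeal →
      ∃ (V : Scheme.{0}) (i' : V ⟶ Z) (_ : IsOpenImmersion i'), i P ∈ Set.range i' ∧
        ∃ h : V ⟶ X, h ≫ f = i' ≫ g := by
    intro k hk
    let t : B := s * ![v, w] k
    have ht : t ∉ P.asIdeal := fun h => (hPp.mem_or_mem h).elim hsP hk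
    let e : B ⟶ CommRingCat.of (Localization.Away t) := CommRingCat.ofHom (algebraMap B _)
    have he : IsOpenImmersion (Spec.map e) := IsOpenImmersion.of_isLocalization t
    have hunit : IsUnit (e s * e (![v, w] k)) := by
      rw [← map_mul]
      exact IsLocalization.Away.algebraMap_isUnit (S := Localization.Away t) t
    refine ⟨_, Spec.map e ≫ i, inferInstance, ?_, ?_⟩
    · obtain ⟨x, hx⟩ : P ∈ Set.range (Spec.map e) :=
        (PrimeSpectrum.localization_away_comap_range (Localization.Away t) t).symm ▸ ht
      exact ⟨x, by rw [Hom.comp_apply, hx]⟩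
    · obtain ⟨h, hh⟩ := C.exists_lift_of_mulVec (ρ ≫ e) (fun m => e (![v, w] m)) k
        (isUnit_of_mul_isUnit_right hunit) fun l => by
          have h0 : s * (ρ (C.mat j l k) * ![v, w] k + ρ (C.mat j l k.rev) * ![v, w] k.rev) = 0 := by
            fin_cases l <;> fin_cases k <;> simp [htr]
            · linear_combination e1
            · linear_combination e1
            · linear_combination e2
            · linear_combination e2
          refine (isUnit_of_mul_isUnit_left hunit).mul_left_cancel ?_
          rw [mul_zero, CommRingCat.comp_apply, CommRingCat.comp_apply, ← map_mul, ← map_mul,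
            ← map_add, ← map_mul, h0, map_zero]
      refine ⟨h, ?_⟩
      rw [hh, Category.assoc, h1, Spec.map_comp, Category.assoc]
  rcases hvw with h | h
  · exact key 0 h
  · exact key 1 h

theorem isOpenImmersion_ι_comp {X Y : Scheme.{0}} (g : X ⟶ Y) {U : Y.Opens} [IsIso (g ∣_ U)]
    {O : X.Opens} (hO : O ≤ g ⁻¹ᵁ U) : IsOpenImmersion (O.ι ≫ g) := by
  rw [← X.homOfLE_ι hO, Category.assoc, ← morphismRestrict_ι]
  infer_instance

theorem dense_preimage_inf {X Y : Scheme.{0}} (g : X ⟶ Y) {U V : Y.Opens} [IsIso (g ∣_ U)]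
    (hU : Dense ((g ⁻¹ᵁ U : X.Opens) : Set X)) (hV : Dense (V : Set Y)) :
    Dense ((g ⁻¹ᵁ (U ⊓ V) : X.Opens) : Set X) := by
  rw [dense_iff_inter_open] at hU ⊢
  intro W hW hne
  obtain ⟨x, hxW, hxU⟩ := hU W hW hne
  have := isOpenImmersion_ι_comp g (le_refl (g ⁻¹ᵁ U))
  have ho : IsOpen (((g ⁻¹ᵁ U).ι ≫ g) '' ((g ⁻¹ᵁ U).ι ⁻¹' W)) :=
    ((g ⁻¹ᵁ U).ι ≫ g).isOpenEmbedding.isOpenMap _ (hW.preimage (g ⁻¹ᵁ U).ι.continuous)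
  obtain ⟨_, ⟨z, hz, rfl⟩, hzV⟩ := hV.inter_open_nonempty _ ho ⟨_, ⟨⟨x, hxU⟩, hxW, rfl⟩⟩
  exact ⟨z.1, hz, z.2, hzV⟩

/-- Lifts near closed points suffice because `Z` is a Jacobson space. Two lifts agree on the dense
part over the locus, hence everywhere, as the source is reduced and `f` is separated. -/
theorem IsSurfaceOver.existsUnique_lift [Finite J] (hC : C.IsSurfaceOver p) (hf : IsProper f)
    (hd : Dense (C.locus : Set Y)) {Z : Scheme.{0}} (g : Z ⟶ Y) [Smooth (g ≫ p)] {U : Y.Opens}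
    (hU : Dense ((g ⁻¹ᵁ U : Z.Opens) : Set Z)) [IsIso (g ∣_ U)] : ∃! h : Z ⟶ X, h ≫ f = g := by
  let O : Z.Opens := g ⁻¹ᵁ (U ⊓ C.locus)
  have hO : Dense (O : Set Z) := dense_preimage_inf g hU hd
  have hg : IsOpenImmersion (O.ι ≫ g) := isOpenImmersion_ι_comp (U := U) g fun _ hz => hz.1
  have hJ : JacobsonSpace Z := LocallyOfFiniteType.jacobsonSpace (g ≫ p)
  refine exists_lift_of_locally f g ?_ ?_
  · let W : Z.Opens := sSup {W | ∃ (V : Scheme.{0}) (i : V ⟶ Z) (_ : IsOpenImmersion i),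
      W = i.opensRange ∧ ∃ h : V ⟶ X, h ≫ f = i ≫ g}
    intro z
    have hz := eq_top_of_closedPoints W (fun z hz => by
      obtain ⟨V, i, hi, hzi, h⟩ := exists_lift_of_isClosed hC g hO hg (fun z hz => hz.2) z hz
      exact TopologicalSpace.Opens.mem_sSup.mpr ⟨_, ⟨V, i, hi, rfl, h⟩, hzi⟩) z
    obtain ⟨_, ⟨V, i, hi, rfl, h⟩, hzi⟩ := TopologicalSpace.Opens.mem_sSup.mp hz
    exact ⟨V, i, hi, hzi, h⟩
  · intro V i _ h h' e e'
    have : Smooth (i ≫ g ≫ p) := inferInstance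
    have : IsReduced V := isReduced_of_smooth (i ≫ g ≫ p)
    have : IsDominant (i ⁻¹ᵁ O).ι := ⟨by
      rw [DenseRange, Opens.range_ι]
      exact hO.preimage i.isOpenEmbedding.isOpenMap⟩
    refine ext_of_isDominant_of_isSeparated f (e.trans e'.symm) (i ⁻¹ᵁ O).ι
      (C.hom_ext_of_mem_locus (by rw [Category.assoc, Category.assoc, e, e']) fun w => ?_)
    rw [Category.assoc, e]
    exact w.2.2

theorem IsSurfaceOver.isIso_restrict [Finite J] (hC : C.IsSurfaceOver p) (hf : IsProper f)
    (hs : Smooth (f ≫ p)) (hd : Dense ((f ⁻¹ᵁ C.locus : X.Opens) : Set X))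
    (hdY : Dense (C.locus : Set Y)) (U : Y.Opens) [Smooth (U.ι ≫ p)] : IsIso (f ∣_ U) := by
  have h1 : U.ι ⁻¹ᵁ U = ⊤ := by
    ext x
    simp
  have h2 : IsIso (U.ι ∣_ U) := by
    have h3 : U.ι ∣_ U = (U.ι ⁻¹ᵁ U).ι := by rw [← cancel_mono U.ι, morphismRestrict_ι]
    rw [h3, h1]
    exact (topIso _).isIso_hom
  -- The inclusion of a smooth open set is itself birational onto its image, so it lifts to a
  -- section of `f` over `U`.
  obtain ⟨s, hs, -⟩ := hC.existsUnique_lift hf hdY U.ι (U := U) (by rw [h1]; exact dense_univ)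
  refine isIso_morphismRestrict_of_section f U s hs ?_
  have : IsReduced (f ⁻¹ᵁ U).toScheme :=
    isReduced_of_smooth ((f ⁻¹ᵁ U).ι ≫ f ≫ p)
  let O : (f ⁻¹ᵁ U).toScheme.Opens := (f ⁻¹ᵁ U).ι ⁻¹ᵁ (f ⁻¹ᵁ C.locus)
  have : IsDominant O.ι := ⟨by
    rw [DenseRange, Opens.range_ι]
    exact hd.preimage (f ⁻¹ᵁ U).ι.isOpenEmbedding.isOpenMap⟩
  have e : (f ∣_ U ≫ s) ≫ f = (f ⁻¹ᵁ U).ι ≫ f := by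
    rw [Category.assoc, hs, morphismRestrict_ι]
  refine ext_of_isDominant_of_isSeparated f e O.ι
    (C.hom_ext_of_mem_locus (by simpa only [Category.assoc] using congrArg (O.ι ≫ ·) e) fun w => ?_)
  rw [Category.assoc, e]
  exact w.2

theorem IsSurfaceOver.isMinimalResolution [Finite J] (hC : C.IsSurfaceOver p)
    (hs : Smooth (f ≫ p)) (hd : Dense ((f ⁻¹ᵁ C.locus : X.Opens) : Set X)) :
    IsMinimalResolution p f ∧ (∀ U : Y.Opens, Smooth (U.ι ≫ p) → IsIso (f ∣_ U)) ∧
      ∀ y, IsSingularPoint p y ↔ y ∉ C.locus := by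
  have := hC.isNoetherianRing
  have hf : IsProper f := C.isProper p
  have hdY : Dense (C.locus : Set Y) := by
    refine (C.surjective.denseRange.dense_image f.continuous hd).mono ?_
    rintro _ ⟨x, hx, rfl⟩
    exact hx
  have hiso : ∀ U : Y.Opens, Smooth (U.ι ≫ p) → IsIso (f ∣_ U) := fun U hU =>
    hC.isIso_restrict hf hs hd hdY U
  refine ⟨⟨⟨hf, hs, C.locus, hdY, hd, C.isIso_restrict_locus⟩, fun g hg => ?_⟩, hiso, fun y => ?_⟩
  · obtain ⟨U, -, hU, _⟩ := hg.birational
    have := hg.smooth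
    exact hC.existsUnique_lift hf hdY g hU
  · constructor
    · intro h hy
      refine h C.locus hy ?_
      have := C.isIso_restrict_locus
      have e : C.locus.ι ≫ p = inv (f ∣_ C.locus) ≫ (f ⁻¹ᵁ C.locus).ι ≫ f ≫ p := by
        rw [← morphismRestrict_ι_assoc, IsIso.inv_hom_id_assoc]
      rw [e]
      infer_instance
    -- On a smooth neighbourhood `f` would be an isomorphism, yet the fibre over a zero of the
    -- matrix has two points.
    · intro hy U hyU hU
      have := hiso U hU
      obtain ⟨j, q, rfl⟩ := C.exists_mem_range_baseMap y
      rw [C.baseMap_mem_locus] at hy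
      push Not at hy
      obtain ⟨x₁, x₂, hne, h1, h2⟩ := C.exists_ne_of_mem q hy
      exact hne (injOn_preimage_of_isIso f U (h1.trans h2.symm) (by rwa [h1]))

end KernelCharts

/-! ### Slices of torus quotients -/

namespace TorusAction

variable {σ D B : Type} [AddCommGroup D] [CommRing B] [Algebra ℂ B] (P : TorusAction σ D B)

instance isOpenImmersion_chartMap [Finite σ] {S : Set σ} (hS : S ∈ P.charts) :
    IsOpenImmersion (P.chartMap hS) :=
  inferInstanceAs (IsOpenImmersion (colimit.ι P.diagram (op ⟨S, hS⟩)))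

theorem exists_chartMap_eq [Finite σ] (x : P.quotient) :
    ∃ (S : Set σ) (hS : S ∈ P.charts) (q : Spec (CommRingCat.of (P.invRing S))),
      P.chartMap hS q = x := by
  obtain ⟨S, q, hq⟩ := Scheme.IsLocallyDirected.ι_jointly_surjective P.diagram x
  exact ⟨S.unop.1, S.unop.2, q, hq⟩

theorem range_chartMap_subset [Finite σ] {S T : Set σ} (hS : S ∈ P.charts) (hT : T ∈ P.charts)
    (h : S ⊆ T) : Set.range (P.chartMap hT) ⊆ Set.range (P.chartMap hS) := by
  rintro _ ⟨q, rfl⟩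
  exact ⟨P.specRes h q, by rw [← Scheme.Hom.comp_apply, P.specRes_chartMap hS hT h]⟩

/-- The intersection of the charts `S` and `T` is the chart `S ∪ T`, which is the basic open set of
an invariant fraction with numerator supported on `S ∪ T`. -/
theorem chartMap_mem_range_iff [Finite σ] {S T : Set σ} (hS : S ∈ P.charts) (hT : T ∈ P.charts)
    (q : Spec (CommRingCat.of (P.invRing S))) (m n : Multiset σ) (hn : ∀ k ∈ n, k ∈ S)
    (hm : ∀ k, k ∈ m ↔ k ∈ S ∪ T) (hd : P.deg m = P.deg n) :
    P.chartMap hS q ∈ Set.range (P.chartMap hT) ↔ P.frac S m n hn hd ∉ q.asIdeal := by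
  have hST : S ∪ T ∈ P.charts := P.charts_mono hS Set.subset_union_left
  let g : op (⟨S ∪ T, hST⟩ : P.Chart) ⟶ op ⟨S, hS⟩ :=
    (homOfLE (show (⟨S, hS⟩ : P.Chart) ≤ ⟨S ∪ T, hST⟩ from Set.subset_union_left)).op
  refine Iff.trans ?_ (P.mem_range_diagram_map g m n hn hm hd q)
  constructor
  · rintro ⟨q', h⟩
    obtain ⟨U, g₁, g₂, x, -, h2⟩ := (Scheme.IsLocallyDirected.ι_eq_ι_iff P.diagram
      (i := op ⟨T, hT⟩) (j := op ⟨S, hS⟩)).mp h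
    have hU : S ∪ T ⊆ U.unop.1 := Set.union_subset (leOfHom g₂.unop) (leOfHom g₁.unop)
    let l : U ⟶ op (⟨S ∪ T, hST⟩ : P.Chart) :=
      (homOfLE (show (⟨S ∪ T, hST⟩ : P.Chart) ≤ U.unop from hU)).op
    refine ⟨P.diagram.map l x, ?_⟩
    rw [← h2, show g₂ = l ≫ g from Subsingleton.elim _ _, Functor.map_comp]
    rfl
  · rintro ⟨y, rfl⟩
    have h1 := colimit.w P.diagram g
    refine ⟨P.specRes Set.subset_union_right y, ?_⟩
    change _ = (P.diagram.map g ≫ colimit.ι P.diagram (op ⟨S, hS⟩)) y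
    rw [h1]
    exact (Scheme.Hom.comp_apply (P.specRes Set.subset_union_right) (P.chartMap hT) y).symm.trans
      (congrArg (fun φ : Spec (CommRingCat.of (P.invRing (S ∪ T))) ⟶ P.quotient => φ y)
        (P.specRes_chartMap hT hST Set.subset_union_right))

theorem Hom.inv_frac {σ' D' B' : Type} [AddCommGroup D'] [CommRing B'] [Algebra ℂ B']
    {P : TorusAction σ D B} {P' : TorusAction σ' D' B'} (F : Hom P P') {S : Set σ} {S' : Set σ'}
    (h : ∀ k ∈ S, F.idx k ∈ S') (m n : Multiset σ) (hn : ∀ k ∈ n, k ∈ S) (hd : P.deg m = P.deg n)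
    (hn' : ∀ k ∈ n.map F.idx, k ∈ S') (hd' : P'.deg (m.map F.idx) = P'.deg (n.map F.idx)) :
    F.inv h (P.frac S m n hn hd) = P'.frac S' (m.map F.idx) (n.map F.idx) hn' hd' := by
  refine Subtype.ext ((P'.mon_unit hn').mul_right_cancel ?_)
  rw [frac_spec, coe_inv, ← F.ring_mon, ← F.ring_mon, ← F.loc_algebraMap h, ← F.loc_algebraMap h,
    ← map_mul, frac_spec]

/-- The map of quotients is defined through the chart of the full preimage of `S'`. Compatibility
with restriction allows any smaller `S`. -/
theorem Hom.chartMap_quotientMap {σ' D' B' : Type} [AddCommGroup D'] [CommRing B'] [Algebra ℂ B']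
    [Finite σ] [Finite σ'] {P : TorusAction σ D B} {P' : TorusAction σ' D' B'} (F : Hom P P')
    {S : Set σ} {S' : Set σ'} (hS : S ∈ P.charts) (hS' : S' ∈ P'.charts)
    (h : ∀ k ∈ S, F.idx k ∈ S') :
    P'.chartMap hS' ≫ F.quotientMap =
      Spec.map (CommRingCat.ofHom (F.inv h).toRingHom) ≫ P.chartMap hS := by
  have h' : S ⊆ F.idx ⁻¹' S' := h
  refine Eq.trans (b := Spec.map (CommRingCat.ofHom (F.inv (S := F.idx ⁻¹' S') (S' := S')
    fun _ hk => hk).toRingHom) ≫ P.chartMap (F.preimage_mem S' hS')) (colimit.ι_desc _ _) ?_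
  rw [← P.specRes_chartMap hS (F.preimage_mem S' hS') h', ← Category.assoc]
  refine congrArg (· ≫ P.chartMap hS) ?_
  refine (Spec.map_comp _ _).symm.trans
    (congrArg Spec.map (CommRingCat.hom_ext (RingHom.ext fun x => Subtype.ext ?_)))
  exact loc_loc (Hom.id P) F F (fun _ => rfl) (fun k hk => h k hk) (fun _ hk => hk) h x.1

/-- Exponents of monomials in the coordinates of `S` by which every coordinate can be made
invariant, so that the invariant ring of the chart `S` becomes the coordinate ring of the slice
`coord k = 1`, `k ∈ S`. -/
structure Slice (S : Set σ) where
  num : σ → Multiset σ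
  den : σ → Multiset σ
  num_mem : ∀ k, ∀ l ∈ num k, l ∈ S
  den_mem : ∀ k, ∀ l ∈ den k, l ∈ S
  deg_eq : ∀ k, P.deg (k ::ₘ num k) = P.deg (den k)
  num_eq : ∀ k ∈ S, num k = 0
  den_eq : ∀ k ∈ S, den k = {k}
  balanced : ∀ m n, P.deg m = P.deg n → m.bind num + n.bind den = n.bind num + m.bind den

namespace Slice

variable {P} {S : Set σ} (s : P.Slice S)

/-- The invariant coordinates. -/
noncomputable def coord (k : σ) : P.invRing S :=
  P.frac S (k ::ₘ s.num k) (s.den k) (s.den_mem k) (s.deg_eq k)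

theorem coord_mul (k : σ) : (s.coord k : P.Loc S) * algebraMap B _ (P.mon (s.den k)) =
    algebraMap B _ (P.coord k) * algebraMap B _ (P.mon (s.num k)) := by
  rw [coord, frac_spec, ← map_mul]
  congr 1
  simp [mon]

theorem coord_eq_one {k : σ} (hk : k ∈ S) : s.coord k = 1 := by
  refine Subtype.ext ((P.mon_unit (s.den_mem k)).mul_right_cancel ?_)
  rw [coord_mul, s.num_eq k hk, s.den_eq k hk]
  simp [mon]

theorem prod_coord_mul (m : Multiset σ) :
    ((m.map s.coord).prod : P.invRing S) * algebraMap B (P.Loc S) (P.mon (m.bind s.den)) =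
      algebraMap B _ (P.mon m) * algebraMap B _ (P.mon (m.bind s.num)) := by
  induction m using Multiset.induction_on with
  | empty => simp [mon]
  | cons k m ih =>
    have h := s.coord_mul k
    simp only [Multiset.map_cons, Multiset.prod_cons, Multiset.cons_bind, mon_add, map_mul,
      MulMemClass.coe_mul]
    rw [mul_mul_mul_comm, h, ih]
    rw [show P.mon (k ::ₘ m) = P.coord k * P.mon m by simp [mon], map_mul]
    ring

/-- Invariant fractions in terms of the invariant coordinates. -/
theorem mul_prod_coord {T : Set σ} (hST : S ⊆ T) {m n : Multiset σ} (hd : P.deg m = P.deg n)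
    {u : P.invRing T} (hu : (u : P.Loc T) * algebraMap B _ (P.mon n) = algebraMap B _ (P.mon m)) :
    u * (n.map fun k => P.res hST (s.coord k)).prod =
      (m.map fun k => P.res hST (s.coord k)).prod := by
  have key : ∀ m : Multiset σ, ((m.map fun k => P.res hST (s.coord k)).prod : P.invRing T) *
      algebraMap B (P.Loc T) (P.mon (m.bind s.den)) =
      algebraMap B _ (P.mon m) * algebraMap B _ (P.mon (m.bind s.num)) := fun m => by
    have := congrArg ((Hom.id P).loc (S := S) (S' := T) fun _ hk => hST hk) (s.prod_coord_mul m)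
    rw [map_mul, map_mul, P.loc_id_algebraMap hST, P.loc_id_algebraMap hST,
      P.loc_id_algebraMap hST, ← coe_res, map_multiset_prod, Multiset.map_map] at this
    exact this
  have hmem : ∀ m : Multiset σ, (∀ k ∈ m.bind s.den, k ∈ T) ∧ ∀ k ∈ m.bind s.num, k ∈ T :=
    fun m => ⟨fun k hk => by
      obtain ⟨l, -, hl⟩ := Multiset.mem_bind.mp hk
      exact hST (s.den_mem l k hl), fun k hk => by
      obtain ⟨l, -, hl⟩ := Multiset.mem_bind.mp hk
      exact hST (s.num_mem l k hl)⟩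
  refine Subtype.ext (((P.mon_unit (hmem n).1).mul (P.mon_unit (hmem m).2)).mul_right_cancel ?_)
  have hb : algebraMap B (P.Loc T) (P.mon (m.bind s.num)) * algebraMap B _ (P.mon (n.bind s.den)) =
      algebraMap B _ (P.mon (n.bind s.num)) * algebraMap B _ (P.mon (m.bind s.den)) := by
    rw [← map_mul, ← map_mul, ← mon_add, ← mon_add, s.balanced m n hd]
  have h1 := key m
  have h2 := key n
  rw [MulMemClass.coe_mul]
  linear_combination (u : P.Loc T) * algebraMap B _ (P.mon (m.bind s.num)) * h2 +
    algebraMap B _ (P.mon (n.bind s.num)) * algebraMap B _ (P.mon (m.bind s.num)) * hu -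
    algebraMap B _ (P.mon (n.bind s.num)) * h1 -
    ((m.map fun k => P.res hST (s.coord k)).prod : P.invRing T) * hb

/-- In an invariant fraction the correcting monomials of numerator and denominator cancel by
`balanced`, and the coordinates of the denominator are `1` on the slice. -/
theorem eq_prod_coord {m n : Multiset σ} (hn : ∀ k ∈ n, k ∈ S) (hd : P.deg m = P.deg n)
    {u : P.invRing S} (hu : (u : P.Loc S) * algebraMap B _ (P.mon n) = algebraMap B _ (P.mon m)) :
    u = (m.map s.coord).prod := by
  have hres : ∀ x, P.res (subset_refl S) x = x := fun x => Subtype.ext (P.loc_id_id S x.1)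
  have := s.mul_prod_coord (subset_refl S) hd hu
  simp only [hres] at this
  rw [← this, Multiset.prod_eq_one, mul_one]
  intro x hx
  obtain ⟨k, hk, rfl⟩ := Multiset.mem_map.mp hx
  exact s.coord_eq_one (hn k hk)

theorem adjoin_range_coord : Algebra.adjoin ℂ (Set.range s.coord) = ⊤ := by
  rw [eq_top_iff]
  rintro ⟨x, hx⟩ -
  have key : ∀ x ∈ P.invRing S, x ∈ (Algebra.adjoin ℂ (Set.range s.coord)).map (P.invRing S).val := by
    intro x hx
    refine (Algebra.adjoin_le ?_ : P.invRing S ≤ _) hx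
    rintro u ⟨m, n, hn, hd, hu⟩
    refine ⟨(m.map s.coord).prod, Subalgebra.multiset_prod_mem _ fun c hc => ?_, ?_⟩
    · obtain ⟨k, -, rfl⟩ := Multiset.mem_map.mp hc
      exact Algebra.subset_adjoin ⟨k, rfl⟩
    · exact (congrArg Subtype.val (s.eq_prod_coord hn hd
        (u := ⟨u, Algebra.subset_adjoin ⟨m, n, hn, hd, hu⟩⟩) hu)).symm
  obtain ⟨y, hy, h⟩ := key x hx
  exact (Subtype.ext h : y = ⟨x, hx⟩) ▸ hy

theorem algHom_ext {A : Type} [CommRing A] [Algebra ℂ A] {ρ ρ' : P.invRing S →ₐ[ℂ] A}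
    (h : ∀ k, ρ (s.coord k) = ρ' (s.coord k)) : ρ = ρ' := by
  refine AlgHom.ext_of_adjoin_eq_top s.adjoin_range_coord ?_
  rintro _ ⟨k, rfl⟩
  exact h k

/-- A homomorphism which maps the coordinates in `S` to `1` gives a point of the slice. -/
theorem exists_lift {A : Type} [CommRing A] [Algebra ℂ A] (g : B →ₐ[ℂ] A)
    (hg : ∀ k ∈ S, g (P.coord k) = 1) :
    ∃ ρ : P.invRing S →ₐ[ℂ] A, ∀ k, ρ (s.coord k) = g (P.coord k) := by
  have hmon : ∀ m : Multiset σ, (∀ k ∈ m, k ∈ S) → g (P.mon m) = 1 := fun m hm => by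
    rw [mon, map_multiset_prod, Multiset.prod_eq_one]
    intro x hx
    rw [Multiset.map_map] at hx
    obtain ⟨k, hk, rfl⟩ := Multiset.mem_map.mp hx
    exact hg k (hm k hk)
  have hu : ∀ y : P.denoms S, IsUnit (g y) := fun y => by
    obtain ⟨n, hn, h⟩ := P.exists_mon_of_mem_denoms y.2
    rw [← h, hmon n hn]
    exact isUnit_one
  let G : P.Loc S →ₐ[ℂ] A := IsLocalization.liftAlgHom (M := P.denoms S) (f := g) hu
  have hG : ∀ b, G (algebraMap B _ b) = g b := fun b => by simp [G]
  refine ⟨G.comp (P.invRing S).val, fun k => ?_⟩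
  have := congrArg G (s.coord_mul k)
  rw [map_mul, map_mul, hG, hG, hG, hmon _ (s.den_mem k), hmon _ (s.num_mem k), mul_one,
    mul_one] at this
  exact this

theorem chartMap_mem_range_iff [Finite σ] {T : Set σ} (hS : S ∈ P.charts) (hT : T ∈ P.charts)
    (q : Spec (CommRingCat.of (P.invRing S))) :
    P.chartMap hS q ∈ Set.range (P.chartMap hT) ↔ ∀ k ∈ T, s.coord k ∉ q.asIdeal := by
  obtain ⟨m, n, hn, hm, hd⟩ := P.exists_frac hS (Set.subset_union_left (s := S) (t := T))
  have hq : q.asIdeal.IsPrime := q.isPrime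
  rw [P.chartMap_mem_range_iff hS hT q m n hn hm hd,
    s.eq_prod_coord hn hd (P.frac_spec S m n hn hd)]
  constructor
  · intro h k hk hmem
    refine h (Ideal.mem_of_dvd _ (Multiset.dvd_prod (Multiset.mem_map_of_mem _
      ((hm k).mpr (Or.inr hk)))) hmem)
  · intro h hmem
    obtain ⟨x, hx, hxq⟩ := (Ideal.IsPrime.multiset_prod_mem_iff_exists_mem hq _).mp hmem
    obtain ⟨k, hk, rfl⟩ := Multiset.mem_map.mp hx
    rcases (hm k).mp hk with hkS | hkT
    · rw [s.coord_eq_one hkS] at hxq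
      exact hq.ne_top ((Ideal.eq_top_iff_one _).mpr hxq)
    · exact h k hkT hxq

/-- Two points of slices which differ by the action of the torus define the same point of the
quotient. -/
theorem specMap_chartMap_eq [Finite σ] {S' : Set σ} (s' : P.Slice S') (hS : S ∈ P.charts)
    (hS' : S' ∈ P.charts) {A : Type} [CommRing A] [Algebra ℂ A] (τ : P.invRing S →ₐ[ℂ] A)
    (τ' : P.invRing S' →ₐ[ℂ] A) (hu : ∀ k ∈ S', IsUnit (τ (s.coord k)))
    (h : ∀ k, τ' (s'.coord k) * ((s'.den k).map fun l => τ (s.coord l)).prod =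
      ((k ::ₘ s'.num k).map fun l => τ (s.coord l)).prod) :
    Spec.map (CommRingCat.ofHom τ.toRingHom) ≫ P.chartMap hS =
      Spec.map (CommRingCat.ofHom τ'.toRingHom) ≫ P.chartMap hS' := by
  obtain ⟨m, n, hn, hm, hd⟩ := P.exists_frac hS (Set.subset_union_left (s := S) (t := S'))
  have hST : S ∪ S' ∈ P.charts := P.charts_mono hS Set.subset_union_left
  let _ : Algebra (P.invRing S) (P.invRing (S ∪ S')) := (P.res Set.subset_union_left).toRingHom.toAlgebra
  have hloc := P.isLocalization_res Set.subset_union_left m n hn hm hd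
  have hunit : IsUnit (τ.toRingHom (P.frac S m n hn hd)) := by
    rw [s.eq_prod_coord hn hd (P.frac_spec S m n hn hd), map_multiset_prod, Multiset.map_map]
    refine (Multiset.prod_induction IsUnit _ (fun _ _ => IsUnit.mul) isUnit_one fun x hx => ?_)
    obtain ⟨k, hk, rfl⟩ := Multiset.mem_map.mp hx
    rcases (hm k).mp hk with hkS | hkT
    · change IsUnit (τ (s.coord k))
      rw [s.coord_eq_one hkS, map_one]
      exact isUnit_one
    · exact hu k hkT
  -- The point `τ` lies in the intersection of the two charts. Its extension `θ` restricts to `τ'`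
  -- on the second one, which is checked on the coordinates.
  let θ : P.invRing (S ∪ S') →+* A := IsLocalization.Away.lift (P.frac S m n hn hd) hunit
  have hθ : ∀ x, θ (P.res Set.subset_union_left x) = τ x := fun x =>
    IsLocalization.Away.lift_eq (P.frac S m n hn hd) hunit x
  let θA : P.invRing (S ∪ S') →ₐ[ℂ] A := { θ with
    commutes' := fun c => by
      change θ (algebraMap ℂ _ c) = _
      rw [← (P.res (Set.subset_union_left (s := S) (t := S'))).commutes c, hθ, τ.commutes] }
  have hτ' : τ' = θA.comp (P.res Set.subset_union_right) := s'.algHom_ext fun k => by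
    change _ = θ (P.res Set.subset_union_right (s'.coord k))
    have h1 := s.mul_prod_coord Set.subset_union_left (s'.deg_eq k)
      (u := P.res Set.subset_union_right (s'.coord k)) (by
        rw [coord, P.res_frac, frac_spec])
    have h2 := congrArg θ h1
    rw [map_mul, map_multiset_prod, map_multiset_prod, Multiset.map_map, Multiset.map_map] at h2
    simp only [Function.comp_def, hθ] at h2
    have hden : IsUnit ((s'.den k).map fun l => τ (s.coord l)).prod :=
      Multiset.prod_induction IsUnit _ (fun _ _ => IsUnit.mul) isUnit_one fun x hx => by
        obtain ⟨l, hl, rfl⟩ := Multiset.mem_map.mp hx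
        exact hu l (s'.den_mem k l hl)
    exact hden.mul_right_cancel ((h k).trans h2.symm)
  have e1 : Spec.map (CommRingCat.ofHom τ.toRingHom) =
      Spec.map (CommRingCat.ofHom θ) ≫ P.specRes Set.subset_union_left := by
    rw [specRes, ← Spec.map_comp]
    congr 1
    exact CommRingCat.hom_ext (RingHom.ext fun x => (hθ x).symm)
  have e2 : Spec.map (CommRingCat.ofHom τ'.toRingHom) =
      Spec.map (CommRingCat.ofHom θ) ≫ P.specRes Set.subset_union_right := by
    rw [specRes, ← Spec.map_comp, hτ']
    rfl
  rw [e1, e2, Category.assoc, Category.assoc, P.specRes_chartMap hS hST,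
    P.specRes_chartMap hS' hST]

end Slice

end TorusAction

/-- The net exponent of `l` is additive in the monomial and is half a character of its weight, so it
depends only on the weight. The factor `2` keeps the characters integral. -/
theorem TorusAction.balanced_of_characters {σ D B : Type} [AddCommGroup D] [CommRing B]
    [Algebra ℂ B] [DecidableEq σ] (P : TorusAction σ D B) (num den : σ → Multiset σ)
    (η : σ → D →+ ℤ)
    (h : ∀ l k, η l (P.weight k) = 2 * (((den k).count l : ℤ) - (num k).count l))
    (m n : Multiset σ) (hd : P.deg m = P.deg n) :
    m.bind num + n.bind den = n.bind num + m.bind den := by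
  refine Multiset.ext.mpr fun l => ?_
  have key : ∀ m : Multiset σ,
      η l (P.deg m) = 2 * (((m.bind den).count l : ℤ) - (m.bind num).count l) := fun m => by
    induction m using Multiset.induction_on with
    | empty => simp [deg]
    | cons k m ih =>
      rw [show P.deg (k ::ₘ m) = P.weight k + P.deg m by simp [deg], map_add, ih, h]
      simp only [Multiset.cons_bind, Multiset.count_add]
      push_cast
      ring
  have h1 := key m
  have h2 := key n
  rw [hd] at h1
  simp only [Multiset.count_add]
  lia

/-! ### Explicit slices for the Stokes data -/

section Slices

/-- The exponents of the numerator of the invariant coordinates on the slice `a_j = 1`. -/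
def stokesNum (j k : Fin 4) : Multiset (Fin 4) :=
  if stokesWeight k = stokesWeight j then 0 else {j}

/-- The exponents of the denominator of the invariant coordinates on the slice `a_j = 1`. -/
def stokesDen (j k : Fin 4) : Multiset (Fin 4) :=
  if stokesWeight k = stokesWeight j then {j} else 0

/-- The exponents of the numerator of the invariant coordinates on the slice `a_j = y_i = 1`. -/
def levelNum (j : Fin 4) (i : Fin 2) : Fin 4 ⊕ Fin 2 → Multiset (Fin 4 ⊕ Fin 2) :=
  Sum.elim (fun k => (stokesNum j k).map Sum.inl) fun l =>
    if l = i ∨ stokesWeight j = ![2, -2] i then 0 else {Sum.inl j}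

/-- The exponents of the denominator of the invariant coordinates on the slice `a_j = y_i = 1`. -/
def levelDen (j : Fin 4) (i : Fin 2) : Fin 4 ⊕ Fin 2 → Multiset (Fin 4 ⊕ Fin 2) :=
  Sum.elim (fun k => (stokesDen j k).map Sum.inl) fun l =>
    if l ≠ i ∧ stokesWeight j = ![2, -2] i then {Sum.inr i, Sum.inl j} else {Sum.inr i}

/-- The character of the torus detecting the exponent of `a_j` on the slice `a_j = 1`. -/
def stokesCharacter (j l : Fin 4) : ℤ →+ ℤ :=
  if l = j then AddMonoidHom.mulLeft (![1, -1, 1, -1] j) else 0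

/-- The characters of the torus detecting the exponents of `a_j` and `y_i` on the slice
`a_j = y_i = 1`. -/
def levelCharacter (j : Fin 4) (i : Fin 2) : Fin 4 ⊕ Fin 2 → ℤ × ℤ →+ ℤ :=
  Sum.elim
    (fun l => if l = j then (AddMonoidHom.mulLeft (![1, -1, 1, -1] j)).comp
      (AddMonoidHom.fst ℤ ℤ - (AddMonoidHom.mulLeft (![-1, 1] i)).comp (AddMonoidHom.snd ℤ ℤ))
      else 0)
    fun l => if l = i then (AddMonoidHom.mulLeft 2).comp (AddMonoidHom.snd ℤ ℤ) else 0

theorem stokesCharacter_weight (j l k : Fin 4) : stokesCharacter j l (stokesWeight k) =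
    2 * (((stokesDen j k).count l : ℤ) - (stokesNum j k).count l) := by
  revert j l k
  decide

theorem levelCharacter_weight (j : Fin 4) (i : Fin 2) (l k : Fin 4 ⊕ Fin 2) :
    levelCharacter j i l (levelWeight k) =
      2 * (((levelDen j i k).count l : ℤ) - (levelNum j i k).count l) := by
  revert j i l k
  decide

/-- The slice `a_j = 1` of the space of Stokes data. -/
def monodromySlice (s α : ℂ) (j : Fin 4) : (monodromyAction s α).Slice {j} where
  num := stokesNum j
  den := stokesDen j
  num_mem := by
    change ∀ k, ∀ l ∈ stokesNum j k, l = j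
    revert j
    decide
  den_mem := by
    change ∀ k, ∀ l ∈ stokesDen j k, l = j
    revert j
    decide
  deg_eq := by
    change ∀ k, ((k ::ₘ stokesNum j k).map stokesWeight).sum = ((stokesDen j k).map stokesWeight).sum
    revert j
    decide
  num_eq k hk := if_pos (congrArg stokesWeight hk)
  den_eq k hk := by
    rw [Set.mem_singleton_iff.mp hk]
    exact if_pos rfl
  balanced := TorusAction.balanced_of_characters _ _ _ (stokesCharacter j)
    (stokesCharacter_weight j)

/-- The slice `a_j = y_i = 1` of the space of Stokes data with a vector. -/
def levelSlice (β α : ℂ) (j : Fin 4) (i : Fin 2) :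
    (levelAction β α).Slice {Sum.inl j, Sum.inr i} where
  num := levelNum j i
  den := levelDen j i
  num_mem := by
    change ∀ k, ∀ l ∈ levelNum j i k, l = Sum.inl j ∨ l = Sum.inr i
    revert j i
    decide
  den_mem := by
    change ∀ k, ∀ l ∈ levelDen j i k, l = Sum.inl j ∨ l = Sum.inr i
    revert j i
    decide
  deg_eq := by
    change ∀ k, ((k ::ₘ levelNum j i k).map levelWeight).sum =
      ((levelDen j i k).map levelWeight).sum
    revert j i
    decide
  num_eq := by
    change ∀ k, (k = Sum.inl j ∨ k = Sum.inr i) → levelNum j i k = 0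
    revert j i
    decide
  den_eq := by
    change ∀ k, (k = Sum.inl j ∨ k = Sum.inr i) → levelDen j i k = {k}
    revert j i
    decide
  balanced := TorusAction.balanced_of_characters _ _ _ (levelCharacter j i)
    (levelCharacter_weight j i)

end Slices

/-! ### The monodromy matrix and its behaviour under the torus -/

section Monodromy

variable {A : Type} [CommRing A] [Algebra ℂ A] (α : ℂ) (a : Fin 4 → A)

theorem topMonodromy_eq : topMonodromy α a =
    !![algebraMap ℂ A α * (1 + a 1 * a 2),
        algebraMap ℂ A α * (a 3 + a 1 * (1 + a 2 * a 3));
      algebraMap ℂ A α⁻¹ * (a 0 + (1 + a 0 * a 1) * a 2),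
        algebraMap ℂ A α⁻¹ * (a 0 * a 3 + (1 + a 0 * a 1) * (1 + a 2 * a 3))] := by
  simp only [topMonodromy, Matrix.mul_fin_two]
  congr! 2 <;> ring_nf

theorem topMonodromy_map {A' : Type} [CommRing A'] [Algebra ℂ A'] (φ : A →ₐ[ℂ] A') (l m : Fin 2) :
    φ (topMonodromy α a l m) = topMonodromy α (fun k => φ (a k)) l m := by
  rw [topMonodromy_eq, topMonodromy_eq]
  fin_cases l <;> fin_cases m <;> simp

variable {α}

theorem det_topMonodromy (hα : α ≠ 0) : (topMonodromy α a).det = 1 := by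
  have h : algebraMap ℂ A α * algebraMap ℂ A α⁻¹ = 1 := by
    rw [← map_mul, mul_inv_cancel₀ hα, map_one]
  rw [topMonodromy_eq, Matrix.det_fin_two_of]
  linear_combination h

variable (α)

/-- Scaling the Stokes data amounts to conjugation by a diagonal matrix. Only the ratio of its
diagonal entries enters, so no square root of `u` is required. -/
theorem topMonodromy_scale {u v : A} (h : u * v = 1) (l m : Fin 2) :
    topMonodromy α (fun k => a k * ![u, v, u, v] k) l m =
      topMonodromy α a l m * !![1, v; u, 1] l m := by
  rw [topMonodromy_eq, topMonodromy_eq]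
  fin_cases l <;> fin_cases m <;> simp
  · linear_combination algebraMap ℂ A α * a 1 * a 2 * h
  · linear_combination algebraMap ℂ A α * a 1 * a 2 * a 3 * v * h
  · linear_combination algebraMap ℂ A α⁻¹ * a 0 * a 1 * a 2 * u * h
  · linear_combination algebraMap ℂ A α⁻¹ * (a 0 * a 3 + a 0 * a 1 + a 2 * a 3 + 
      a 0 * a 1 * a 2 * a 3 * (u * v + 1)) * h

/-- The slice coordinates are the translate of the given data by the torus element that makes the
`j`-th entry equal to `1`. The sign of the weight of `a_j` decides which of `x`, `y` multiplies the
even entries. -/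
theorem exists_scale_of_slice {L : Type} [CommRing L] (A a : Fin 4 → L) (j : Fin 4) {x y : L}
    (hxy : x * y = 1) (hx : x = A j)
    (h : ∀ k, a k * ((stokesDen j k).map A).prod = A k * ((stokesNum j k).map A).prod) (k : Fin 4) :
    a k = A k * ![if stokesWeight j = 2 then y else x, if stokesWeight j = 2 then x else y,
      if stokesWeight j = 2 then y else x, if stokesWeight j = 2 then x else y] k := by
  have hj : stokesWeight j = 2 ∨ stokesWeight j = -2 := by
    clear hx h
    revert j
    decide
  have hk := h k
  have key : a k = A k * if stokesWeight k = stokesWeight j then y else x := by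
    simp only [stokesNum, stokesDen] at hk
    split_ifs at hk ⊢
    · simp only [Multiset.map_singleton, Multiset.prod_singleton, Multiset.map_zero,
        Multiset.prod_zero, mul_one] at hk
      rw [← hk, mul_assoc, ← hx, hxy, mul_one]
    · simp only [Multiset.map_singleton, Multiset.prod_singleton, Multiset.map_zero,
        Multiset.prod_zero, mul_one] at hk
      rw [hk, hx]
  rw [key]
  rcases hj with hj | hj <;> rw [hj] <;> fin_cases k <;> simp [stokesWeight]

theorem topMonodromy_slice_trace (A' : Fin 4 → A) (j : Fin 4) (hu : IsUnit (a j))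
    (h : ∀ k, A' k * ((stokesDen j k).map a).prod = a k * ((stokesNum j k).map a).prod) :
    topMonodromy α A' 0 0 + topMonodromy α A' 1 1 =
      topMonodromy α a 0 0 + topMonodromy α a 1 1 := by
  obtain ⟨⟨x, y, hxy, hyx⟩, hx : x = a j⟩ := hu
  rw [show A' = _ from funext (exists_scale_of_slice a A' j hxy hx h), topMonodromy_scale,
    topMonodromy_scale]
  · simp
  all_goals split_ifs <;> assumption

/-- Passing to the slice conjugates the matrix by a diagonal one, and moves the vector by the same
diagonal matrix and a homothety. The eigenvector equation is preserved. -/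
theorem topMonodromy_slice_mulVec (b : A) (A' a : Fin 4 ⊕ Fin 2 → A) (j : Fin 4) (i : Fin 2)
    (hu : IsUnit (a (Sum.inl j))) (hu' : IsUnit (a (Sum.inr i)))
    (h : ∀ k, A' k * ((levelDen j i k).map a).prod = a k * ((levelNum j i k).map a).prod)
    (he : ∀ l, topMonodromy α (fun k => a (Sum.inl k)) l 0 * a (Sum.inr 0) +
      topMonodromy α (fun k => a (Sum.inl k)) l 1 * a (Sum.inr 1) = b * a (Sum.inr l)) (l : Fin 2) :
    topMonodromy α (fun k => A' (Sum.inl k)) l 0 * A' (Sum.inr 0) +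
      topMonodromy α (fun k => A' (Sum.inl k)) l 1 * A' (Sum.inr 1) = b * A' (Sum.inr l) := by
  obtain ⟨⟨x, y, hxy, hyx⟩, hx : x = a (Sum.inl j)⟩ := hu
  obtain ⟨⟨z, w, hzw, hwz⟩, hz : z = a (Sum.inr i)⟩ := hu'
  have hA := exists_scale_of_slice (fun k => a (Sum.inl k)) (fun k => A' (Sum.inl k)) j hxy hx
    fun k => by
      have h := h (Sum.inl k)
      rw [levelDen, levelNum, Sum.elim_inl, Sum.elim_inl, Multiset.map_map, Multiset.map_map] at h
      exact h
  have key : ∀ l, A' (Sum.inr l) = a (Sum.inr l) *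
      (w * if l = i then 1 else if stokesWeight j = ![2, -2] i then y else x) := fun l => by
    have h := h (Sum.inr l)
    simp only [levelNum, levelDen, Sum.elim_inr] at h
    by_cases hl : l = i
    · simp only [hl, true_or, not_true_eq_false, false_and, if_false, if_true, ne_eq,
        Multiset.map_singleton, Multiset.prod_singleton, Multiset.map_zero, Multiset.prod_zero,
        mul_one, ← hz] at h ⊢
      linear_combination w * h - A' (Sum.inr i) * hzw
    · by_cases hs : stokesWeight j = ![2, -2] i
      · simp only [hl, hs, or_true, not_false_eq_true, and_self, if_true, ne_eq, if_false,
          Multiset.insert_eq_cons, Multiset.map_cons, Multiset.prod_cons,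
          Multiset.map_singleton, Multiset.prod_singleton,
          Multiset.map_zero, Multiset.prod_zero, mul_one, ← hz, ← hx] at h ⊢
        linear_combination w * y * h - A' (Sum.inr l) * (x * y * hzw + hxy)
      · simp only [hl, hs, or_false, and_false, ne_eq, if_false,
          Multiset.map_singleton, Multiset.prod_singleton, ← hz, ← hx] at h ⊢
        linear_combination w * h - A' (Sum.inr l) * hzw
  have hj : stokesWeight j = 2 ∨ stokesWeight j = -2 := by
    clear hA hx h key
    revert j
    decide
  have e0 := he 0
  have e1 := he 1
  rw [show (fun k => A' (Sum.inl k)) = _ from funext hA, topMonodromy_scale, topMonodromy_scale,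
    key, key, key]
  · rcases hj with hj | hj <;> fin_cases i <;> fin_cases l <;> simp [hj]
    · linear_combination w * e0 + topMonodromy α (fun k => a (Sum.inl k)) 0 1 * w *
        a (Sum.inr 1) * hxy
    · linear_combination w * y * e1
    · linear_combination w * x * e0
    · linear_combination w * e1 + topMonodromy α (fun k => a (Sum.inl k)) 1 0 * w *
        a (Sum.inr 0) * hxy
    · linear_combination w * e0 + topMonodromy α (fun k => a (Sum.inl k)) 0 1 * w *
        a (Sum.inr 1) * hxy
    · linear_combination w * x * e1
    · linear_combination w * y * e0
    · linear_combination w * e1 + topMonodromy α (fun k => a (Sum.inl k)) 1 0 * w *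
        a (Sum.inr 0) * hxy
  all_goals split_ifs <;> assumption

end Monodromy

/-! ### Equations satisfied by the slice coordinates -/

section Coordinates

variable (s β α : ℂ) (j : Fin 4) (i : Fin 2)

theorem monodromyAction_trace :
    (topMonodromy α (monodromyAction s α).coord).trace = algebraMap ℂ _ s := by
  have h : (Ideal.Quotient.mkₐ ℂ (monodromyIdeal s α))
      ((topMonodromy α MvPolynomial.X).trace - MvPolynomial.C s) = 0 :=
    Ideal.Quotient.eq_zero_iff_mem.mpr (Ideal.subset_span rfl)
  rw [map_sub, Matrix.trace_fin_two, map_add, topMonodromy_map, topMonodromy_map, sub_eq_zero] at h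
  rw [Matrix.trace_fin_two]
  exact h.trans ((Ideal.Quotient.mkₐ ℂ (monodromyIdeal s α)).commutes s)

theorem levelAction_mulVec (l : Fin 2) :
    (topMonodromy α fun k => (levelAction β α).coord (Sum.inl k)) l 0 *
        (levelAction β α).coord (Sum.inr 0) +
      (topMonodromy α fun k => (levelAction β α).coord (Sum.inl k)) l 1 *
        (levelAction β α).coord (Sum.inr 1) =
      algebraMap ℂ _ β * (levelAction β α).coord (Sum.inr l) := by
  have h : (Ideal.Quotient.mkₐ ℂ (levelIdeal β α))
      ((topMonodromy α stokesVar).mulVec vectorVar l - MvPolynomial.C β * vectorVar l) = 0 :=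
    Ideal.Quotient.eq_zero_iff_mem.mpr (Ideal.subset_span (Or.inr ⟨l, rfl⟩))
  rw [map_sub, Matrix.mulVec, dotProduct, Fin.sum_univ_two, map_add, map_mul, map_mul,
    topMonodromy_map, topMonodromy_map, sub_eq_zero, map_mul] at h
  exact h

theorem monodromySlice_coord_mul (k : Fin 4) :
    ((monodromySlice s α j).coord k : (monodromyAction s α).Loc {j}) *
        ((stokesDen j k).map fun k => algebraMap _ _ ((monodromyAction s α).coord k)).prod =
      algebraMap _ _ ((monodromyAction s α).coord k) *
        ((stokesNum j k).map fun k => algebraMap _ _ ((monodromyAction s α).coord k)).prod := by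
  have h := (monodromySlice s α j).coord_mul k
  rw [TorusAction.mon, TorusAction.mon, map_multiset_prod, map_multiset_prod, Multiset.map_map,
    Multiset.map_map] at h
  exact h

theorem levelSlice_coord_mul (k : Fin 4 ⊕ Fin 2) :
    ((levelSlice β α j i).coord k : (levelAction β α).Loc {Sum.inl j, Sum.inr i}) *
        ((levelDen j i k).map fun k => algebraMap _ _ ((levelAction β α).coord k)).prod =
      algebraMap _ _ ((levelAction β α).coord k) *
        ((levelNum j i k).map fun k => algebraMap _ _ ((levelAction β α).coord k)).prod := by
  have h := (levelSlice β α j i).coord_mul k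
  rw [TorusAction.mon, TorusAction.mon, map_multiset_prod, map_multiset_prod, Multiset.map_map,
    Multiset.map_map] at h
  exact h

theorem monodromySlice_trace :
    (topMonodromy α (monodromySlice s α j).coord).trace = algebraMap ℂ _ s := by
  have ht := congrArg (IsScalarTower.toAlgHom ℂ _ ((monodromyAction s α).Loc {j}))
    (monodromyAction_trace s α)
  rw [AlgHom.commutes, Matrix.trace_fin_two, map_add, topMonodromy_map, topMonodromy_map] at ht
  have h := topMonodromy_slice_trace α _ _ j (IsLocalization.map_units _
    (⟨_, Submonoid.subset_closure ⟨j, rfl, rfl⟩⟩ : (monodromyAction s α).denoms {j}))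
    (monodromySlice_coord_mul s α j)
  have e := h.trans ht
  -- The invariants embed in the localization, where `a_j` is invertible and the scaling argument is
  -- available.
  have inj : Function.Injective ((monodromyAction s α).invRing {j}).val := Subtype.val_injective
  refine inj ?_
  rw [AlgHom.commutes, Matrix.trace_fin_two, map_add, topMonodromy_map, topMonodromy_map]
  exact e

theorem levelSlice_mulVec (l : Fin 2) :
    (topMonodromy α fun k => (levelSlice β α j i).coord (Sum.inl k)) l 0 *
        (levelSlice β α j i).coord (Sum.inr 0) +
      (topMonodromy α fun k => (levelSlice β α j i).coord (Sum.inl k)) l 1 *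
        (levelSlice β α j i).coord (Sum.inr 1) =
      algebraMap ℂ _ β * (levelSlice β α j i).coord (Sum.inr l) := by
  have ht := fun l => congrArg (IsScalarTower.toAlgHom ℂ _
    ((levelAction β α).Loc {Sum.inl j, Sum.inr i})) (levelAction_mulVec β α l)
  simp only [map_mul, map_add, AlgHom.commutes, topMonodromy_map] at ht
  have h := topMonodromy_slice_mulVec α (algebraMap ℂ _ β) _ _ j i (IsLocalization.map_units _
      (⟨_, Submonoid.subset_closure ⟨Sum.inl j, Or.inl rfl, rfl⟩⟩ :
        (levelAction β α).denoms {Sum.inl j, Sum.inr i}))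
    (IsLocalization.map_units _ (⟨_, Submonoid.subset_closure ⟨Sum.inr i, Or.inr rfl, rfl⟩⟩ :
      (levelAction β α).denoms {Sum.inl j, Sum.inr i}))
    (levelSlice_coord_mul β α j i) ht l
  have inj : Function.Injective ((levelAction β α).invRing {Sum.inl j, Sum.inr i}).val :=
    Subtype.val_injective
  refine inj ?_
  rw [map_mul, map_add, map_mul, map_mul, AlgHom.commutes, topMonodromy_map, topMonodromy_map]
  exact h

end Coordinates

section Lift

variable {A : Type} [CommRing A] [Algebra ℂ A] (s β α : ℂ) (j : Fin 4) (i : Fin 2)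

theorem exists_monodromySlice_lift (a : Fin 4 → A)
    (ht : (topMonodromy α a).trace = algebraMap ℂ A s) (hj : a j = 1) :
    ∃ ρ : (monodromyAction s α).invRing {j} →ₐ[ℂ] A, ∀ k, ρ ((monodromySlice s α j).coord k) = a k := by
  have hI : monodromyIdeal s α ≤ RingHom.ker (MvPolynomial.aeval (R := ℂ) a) := by
    refine Ideal.span_le.mpr ?_
    rintro _ rfl
    change MvPolynomial.aeval a _ = 0
    rw [map_sub, Matrix.trace_fin_two, map_add, topMonodromy_map, topMonodromy_map,
      MvPolynomial.algHom_C, ← ht, Matrix.trace_fin_two, sub_eq_zero]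
    simp
  let g : MonodromyRing s α →ₐ[ℂ] A := Ideal.Quotient.liftₐ _ (MvPolynomial.aeval a) fun p hp => hI hp
  have hg : ∀ k, g ((monodromyAction s α).coord k) = a k := fun k =>
    (MvPolynomial.aeval_X a k : MvPolynomial.aeval (R := ℂ) a (MvPolynomial.X k) = a k)
  obtain ⟨ρ, hρ⟩ := (monodromySlice s α j).exists_lift g (by
    rintro k rfl
    rw [hg, hj])
  exact ⟨ρ, fun k => (hρ k).trans (hg k)⟩

theorem exists_levelSlice_lift (a : Fin 4 → A) (y : Fin 2 → A)
    (ht : (topMonodromy α a).trace = algebraMap ℂ A (β + β⁻¹))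
    (hy : ∀ l, topMonodromy α a l 0 * y 0 + topMonodromy α a l 1 * y 1 = algebraMap ℂ A β * y l)
    (hj : a j = 1) (hi : y i = 1) :
    ∃ ρ : (levelAction β α).invRing {Sum.inl j, Sum.inr i} →ₐ[ℂ] A,
      (∀ k, ρ ((levelSlice β α j i).coord (Sum.inl k)) = a k) ∧
      ∀ k, ρ ((levelSlice β α j i).coord (Sum.inr k)) = y k := by
  have hI : levelIdeal β α ≤ RingHom.ker (MvPolynomial.aeval (R := ℂ) (Sum.elim a y)) := by
    refine Ideal.span_le.mpr ?_
    rintro _ (rfl | ⟨l, rfl⟩)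
    · change MvPolynomial.aeval (Sum.elim a y) _ = 0
      rw [map_sub, Matrix.trace_fin_two, map_add, topMonodromy_map, topMonodromy_map,
        MvPolynomial.algHom_C, ← ht, Matrix.trace_fin_two, sub_eq_zero]
      simp [stokesVar]
    · change MvPolynomial.aeval (Sum.elim a y) _ = 0
      rw [map_sub, Matrix.mulVec, dotProduct, Fin.sum_univ_two, map_add, map_mul, map_mul, map_mul,
        topMonodromy_map, topMonodromy_map, MvPolynomial.algHom_C, sub_eq_zero]
      simpa [stokesVar, vectorVar] using hy l
  let g : LevelRing β α →ₐ[ℂ] A :=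
    Ideal.Quotient.liftₐ _ (MvPolynomial.aeval (Sum.elim a y)) fun p hp => hI hp
  have hg : ∀ k, g ((levelAction β α).coord k) = Sum.elim a y k := fun k =>
    (MvPolynomial.aeval_X _ k : MvPolynomial.aeval (R := ℂ) (Sum.elim a y) (MvPolynomial.X k) = _)
  obtain ⟨ρ, hρ⟩ := (levelSlice β α j i).exists_lift g (by
    rintro k (rfl | rfl)
    · exact (hg _).trans hj
    · exact (hg _).trans hi)
  exact ⟨ρ, fun k => (hρ _).trans (hg _), fun k => (hρ _).trans (hg _)⟩

end Lift

theorem Fin.two_rev_ne (i : Fin 2) : i.rev ≠ i := by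
  revert i
  decide

theorem Fin.two_eq_or_eq_rev (i k : Fin 2) : k = i ∨ k = i.rev := by
  revert i k
  decide

/-! ### Kernel charts for the level structure -/

section Charts

variable (β α : ℂ)

theorem monodromyCharts_mem (s : ℂ) (j : Fin 4) : ({j} : Set (Fin 4)) ∈ (monodromyAction s α).charts :=
  Set.singleton_nonempty j

theorem levelCharts_mem (j : Fin 4) (i : Fin 2) :
    ({Sum.inl j, Sum.inr i} : Set (Fin 4 ⊕ Fin 2)) ∈ (levelAction β α).charts :=
  ⟨⟨j, Or.inl rfl⟩, i, Or.inr rfl⟩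

theorem forgetLine_idx_mem (j : Fin 4) (i : Fin 2) :
    ∀ k ∈ ({j} : Set (Fin 4)), (forgetLine β α).idx k ∈ ({Sum.inl j, Sum.inr i} : Set (Fin 4 ⊕ Fin 2)) := by
  rintro k rfl
  exact Or.inl rfl

theorem forgetLine_inv_coord (j : Fin 4) (i : Fin 2) (k : Fin 4) :
    (forgetLine β α).inv (forgetLine_idx_mem β α j i) ((monodromySlice (β + β⁻¹) α j).coord k) =
      (levelSlice β α j i).coord (Sum.inl k) := by
  have hm : (k ::ₘ stokesNum j k).map Sum.inl =
      (Sum.inl k : Fin 4 ⊕ Fin 2) ::ₘ levelNum j i (Sum.inl k) := Multiset.map_cons _ _ _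
  refine (TorusAction.Hom.inv_frac _ _ _ _ _ _
    ((levelSlice β α j i).den_mem (Sum.inl k)) ?_).trans ?_
  · have := (levelSlice β α j i).deg_eq (Sum.inl k)
    exact (congrArg _ hm).trans this
  · refine Subtype.ext (((levelAction β α).mon_unit
      ((levelSlice β α j i).den_mem (Sum.inl k))).mul_right_cancel ?_)
    refine (TorusAction.frac_spec _ _ _ _ _ _).trans (Eq.trans ?_
      (TorusAction.frac_spec _ _ _ _ _ _).symm)
    exact congrArg (fun m => algebraMap _ _ ((levelAction β α).mon m)) hm

/-- The matrix `top - β` on the slice `a_j = 1`. -/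
noncomputable def shiftedMonodromy (j : Fin 4) :
    Matrix (Fin 2) (Fin 2) ((monodromyAction (β + β⁻¹) α).invRing {j}) :=
  topMonodromy α (monodromySlice (β + β⁻¹) α j).coord -
    algebraMap ℂ ((monodromyAction (β + β⁻¹) α).invRing {j}) β • 1

theorem shiftedMonodromy_map {A : Type} [CommRing A] [Algebra ℂ A] (j : Fin 4)
    (φ : (monodromyAction (β + β⁻¹) α).invRing {j} →ₐ[ℂ] A) (l m : Fin 2) :
    φ (shiftedMonodromy β α j l m) =
      topMonodromy α (fun k => φ ((monodromySlice (β + β⁻¹) α j).coord k)) l m -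
        if l = m then algebraMap ℂ A β else 0 := by
  rw [shiftedMonodromy, Matrix.sub_apply, map_sub, topMonodromy_map, Matrix.smul_apply,
    Matrix.one_apply]
  split_ifs <;> simp

theorem forall_shifted_iff {A : Type} [CommRing A] (T : Matrix (Fin 2) (Fin 2) A) (b : A)
    (y : Fin 2 → A) (i : Fin 2) (hi : y i = 1) :
    (∀ l, T l 0 * y 0 + T l 1 * y 1 = b * y l) ↔
      ∀ l, (T l i - if l = i then b else 0) + (T l i.rev - if l = i.rev then b else 0) * y i.rev = 0 := by
  refine forall_congr' fun l => ?_
  rw [← sub_eq_zero]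
  refine Eq.congr_left ?_
  fin_cases i <;> fin_cases l <;> simp at hi ⊢ <;> rw [hi] <;> ring

theorem shiftedMonodromy_trace_map (hβ : β * β = 1) {A : Type} [CommRing A] [Algebra ℂ A]
    (j : Fin 4) (φ : (monodromyAction (β + β⁻¹) α).invRing {j} →ₐ[ℂ] A) :
    φ (shiftedMonodromy β α j 0 0) + φ (shiftedMonodromy β α j 1 1) = 0 := by
  have h := congrArg φ (monodromySlice_trace (β + β⁻¹) α j)
  have hs : algebraMap ℂ A (β + β⁻¹) = algebraMap ℂ A β + algebraMap ℂ A β := by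
    rw [← eq_inv_of_mul_eq_one_left hβ, map_add]
  rw [Matrix.trace_fin_two, AlgHom.commutes, map_add, topMonodromy_map, topMonodromy_map, hs] at h
  rw [shiftedMonodromy_map, shiftedMonodromy_map, if_pos rfl, if_pos rfl]
  linear_combination h

/-- The determinant of `top - β` is `det top - β * trace top + β²`, that is `1 - 2 β² + β² = 0`. -/
theorem shiftedMonodromy_det_map (hβ : β * β = 1) (hα : α ≠ 0) {A : Type} [CommRing A] [Algebra ℂ A]
    (j : Fin 4) (φ : (monodromyAction (β + β⁻¹) α).invRing {j} →ₐ[ℂ] A) :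
    φ (shiftedMonodromy β α j 0 0) * φ (shiftedMonodromy β α j 1 1) =
      φ (shiftedMonodromy β α j 0 1) * φ (shiftedMonodromy β α j 1 0) := by
  have ht := congrArg φ (monodromySlice_trace (β + β⁻¹) α j)
  have hs : algebraMap ℂ A (β + β⁻¹) = algebraMap ℂ A β + algebraMap ℂ A β := by
    rw [← eq_inv_of_mul_eq_one_left hβ, map_add]
  rw [Matrix.trace_fin_two, AlgHom.commutes, map_add, topMonodromy_map, topMonodromy_map, hs] at ht
  have hd := det_topMonodromy (fun k => φ ((monodromySlice (β + β⁻¹) α j).coord k)) hα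
  rw [Matrix.det_fin_two] at hd
  have hb := congrArg (algebraMap ℂ A) hβ
  rw [map_mul, map_one] at hb
  rw [shiftedMonodromy_map, shiftedMonodromy_map, shiftedMonodromy_map, shiftedMonodromy_map,
    if_pos rfl, if_pos rfl, if_neg zero_ne_one, if_neg one_ne_zero]
  linear_combination hd - algebraMap ℂ A β * ht - hb

theorem levelSlice_slope (j : Fin 4) (i l : Fin 2) :
    (forgetLine β α).inv (forgetLine_idx_mem β α j i) (shiftedMonodromy β α j l i) +
      (forgetLine β α).inv (forgetLine_idx_mem β α j i) (shiftedMonodromy β α j l i.rev) *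
        (levelSlice β α j i).coord (Sum.inr i.rev) = 0 := by
  rw [shiftedMonodromy_map, shiftedMonodromy_map]
  simp only [forgetLine_inv_coord]
  exact (forall_shifted_iff _ _ (fun k => (levelSlice β α j i).coord (Sum.inr k)) i
    ((levelSlice β α j i).coord_eq_one (Or.inr rfl))).mp (levelSlice_mulVec β α j i) l

theorem exists_level_lift {A : Type} [CommRing A] [Algebra ℂ A] (j : Fin 4) (i : Fin 2)
    (ρ : (monodromyAction (β + β⁻¹) α).invRing {j} →ₐ[ℂ] A) (t : A)
    (h : ∀ l, ρ (shiftedMonodromy β α j l i) + ρ (shiftedMonodromy β α j l i.rev) * t = 0) :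
    ∃ τ : (levelAction β α).invRing {Sum.inl j, Sum.inr i} →ₐ[ℂ] A,
      τ.comp ((forgetLine β α).inv (forgetLine_idx_mem β α j i)) = ρ ∧
      τ ((levelSlice β α j i).coord (Sum.inr i.rev)) = t := by
  let y : Fin 2 → A := fun l => if l = i then 1 else t
  have hi : y i = 1 := if_pos rfl
  have hi' : y i.rev = t := if_neg (Fin.two_rev_ne i)
  simp only [shiftedMonodromy_map] at h
  rw [← hi'] at h
  obtain ⟨τ, h1, h2⟩ := exists_levelSlice_lift β α j i
    (fun k => ρ ((monodromySlice (β + β⁻¹) α j).coord k)) y (by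
      have h := congrArg ρ (monodromySlice_trace (β + β⁻¹) α j)
      rw [AlgHom.commutes, Matrix.trace_fin_two, map_add, topMonodromy_map, topMonodromy_map] at h
      rwa [Matrix.trace_fin_two])
    ((forall_shifted_iff _ _ y i hi).mpr h)
    (by rw [(monodromySlice (β + β⁻¹) α j).coord_eq_one rfl, map_one]) hi
  refine ⟨τ, (monodromySlice (β + β⁻¹) α j).algHom_ext fun k => ?_, (h2 _).trans hi'⟩
  rw [AlgHom.comp_apply, forgetLine_inv_coord, h1]

theorem exists_polynomial_slope (j : Fin 4) (i : Fin 2)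
    (x : (levelAction β α).invRing {Sum.inl j, Sum.inr i}) :
    ∃ p : Polynomial ((monodromyAction (β + β⁻¹) α).invRing {j}),
      p.eval₂ ((forgetLine β α).inv (forgetLine_idx_mem β α j i)).toRingHom
        ((levelSlice β α j i).coord (Sum.inr i.rev)) = x := by
  have hx : x ∈ Algebra.adjoin ℂ (Set.range (levelSlice β α j i).coord) := by
    rw [TorusAction.Slice.adjoin_range_coord]
    trivial
  induction hx using Algebra.adjoin_induction with
  | mem x hx =>
    obtain ⟨k | k, rfl⟩ := hx
    · refine ⟨Polynomial.C ((monodromySlice (β + β⁻¹) α j).coord k), ?_⟩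
      rw [Polynomial.eval₂_C]
      exact forgetLine_inv_coord β α j i k
    · rcases Fin.two_eq_or_eq_rev i k with rfl | rfl
      · exact ⟨1, by rw [Polynomial.eval₂_one, (levelSlice β α j k).coord_eq_one (Or.inr rfl)]⟩
      · exact ⟨Polynomial.X, Polynomial.eval₂_X _ _⟩
  | algebraMap c =>
    refine ⟨Polynomial.C (algebraMap ℂ _ c), ?_⟩
    rw [Polynomial.eval₂_C]
    exact AlgHom.commutes _ c
  | add x y _ _ hx hy =>
    obtain ⟨p, rfl⟩ := hx
    obtain ⟨q, rfl⟩ := hy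
    exact ⟨p + q, Polynomial.eval₂_add _ _⟩
  | mul x y _ _ hx hy =>
    obtain ⟨p, rfl⟩ := hx
    obtain ⟨q, rfl⟩ := hy
    exact ⟨p * q, Polynomial.eval₂_mul _ _⟩

theorem levelChart_mem_range_iff (j j' : Fin 4) (i i' : Fin 2)
    (q : Spec (CommRingCat.of ((levelAction β α).invRing {Sum.inl j, Sum.inr i}))) :
    (levelAction β α).chartMap (levelCharts_mem β α j i) q ∈
        Set.range ((levelAction β α).chartMap (levelCharts_mem β α j' i')) ↔
      (levelSlice β α j i).coord (Sum.inl j') ∉ q.asIdeal ∧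
        (levelSlice β α j i).coord (Sum.inr i') ∉ q.asIdeal := by
  refine ((levelSlice β α j i).chartMap_mem_range_iff (levelCharts_mem β α j i)
    (levelCharts_mem β α j' i') q).trans ⟨fun h => ⟨h _ (Or.inl rfl), h _ (Or.inr rfl)⟩, ?_⟩
  rintro ⟨h1, h2⟩ k (rfl | rfl) <;> assumption

theorem levelSlice_one_notMem {j : Fin 4} {i : Fin 2} {k : Fin 4 ⊕ Fin 2}
    (hk : k = Sum.inl j ∨ k = Sum.inr i)
    (q : Spec (CommRingCat.of ((levelAction β α).invRing {Sum.inl j, Sum.inr i}))) :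
    (levelSlice β α j i).coord k ∉ q.asIdeal := by
  rw [(levelSlice β α j i).coord_eq_one hk]
  exact fun h => q.isPrime.ne_top ((Ideal.eq_top_iff_one _).mpr h)

/-- The vectors with coordinates `1, t` and `t⁻¹, 1` span the same line, so the two points of slices
differ by a homothety of the vector. -/
theorem levelChart_overlap {A : Type} [CommRing A] [Algebra ℂ A] (j : Fin 4) (i : Fin 2)
    (τ : (levelAction β α).invRing {Sum.inl j, Sum.inr i} →ₐ[ℂ] A)
    (τ' : (levelAction β α).invRing {Sum.inl j, Sum.inr i.rev} →ₐ[ℂ] A)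
    (h : τ.comp ((forgetLine β α).inv (forgetLine_idx_mem β α j i)) =
      τ'.comp ((forgetLine β α).inv (forgetLine_idx_mem β α j i.rev)))
    (hs : τ ((levelSlice β α j i).coord (Sum.inr i.rev)) *
      τ' ((levelSlice β α j i.rev).coord (Sum.inr i.rev.rev)) = 1) :
    Spec.map (CommRingCat.ofHom τ.toRingHom) ≫
        (levelAction β α).chartMap (levelCharts_mem β α j i) =
      Spec.map (CommRingCat.ofHom τ'.toRingHom) ≫
        (levelAction β α).chartMap (levelCharts_mem β α j i.rev) := by
  have hc : ∀ k, τ' ((levelSlice β α j i.rev).coord (Sum.inl k)) =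
      τ ((levelSlice β α j i).coord (Sum.inl k)) := fun k => by
    have := DFunLike.congr_fun h ((monodromySlice (β + β⁻¹) α j).coord k)
    rw [AlgHom.comp_apply, AlgHom.comp_apply, forgetLine_inv_coord, forgetLine_inv_coord] at this
    exact this.symm
  have h1 : τ ((levelSlice β α j i).coord (Sum.inl j)) = 1 := by
    rw [(levelSlice β α j i).coord_eq_one (Or.inl rfl), map_one]
  have h2 : τ ((levelSlice β α j i).coord (Sum.inr i)) = 1 := by
    rw [(levelSlice β α j i).coord_eq_one (Or.inr rfl), map_one]
  have h3 : τ' ((levelSlice β α j i.rev).coord (Sum.inr i.rev)) = 1 := by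
    rw [(levelSlice β α j i.rev).coord_eq_one (Or.inr rfl), map_one]
  rw [Fin.rev_rev] at hs
  have hi : i ≠ i.rev := (Fin.two_rev_ne i).symm
  refine (levelSlice β α j i).specMap_chartMap_eq (levelSlice β α j i.rev) _ _ τ τ' ?_ ?_
  · rintro k (rfl | rfl)
    · rw [h1]
      exact isUnit_one
    · exact IsUnit.of_mul_eq_one _ hs
  · rintro (k | k)
    · change _ * (((stokesDen j k).map Sum.inl).map _).prod =
        ((Sum.inl k ::ₘ (stokesNum j k).map Sum.inl).map _).prod
      rw [Multiset.map_cons, Multiset.prod_cons, hc, stokesDen, stokesNum]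
      split_ifs <;> simp [h1]
    · rcases Fin.two_eq_or_eq_rev i k with rfl | rfl
      · change _ * ((if k ≠ k.rev ∧ _ then {Sum.inr k.rev, Sum.inl j} else {Sum.inr k.rev} :
            Multiset (Fin 4 ⊕ Fin 2)).map _).prod =
          ((Sum.inr k ::ₘ if k = k.rev ∨ _ then 0 else {Sum.inl j}).map _).prod
        by_cases hw : stokesWeight j = ![2, -2] k.rev
        · rw [if_pos ⟨hi, hw⟩, if_pos (Or.inr hw)]
          simp only [Multiset.insert_eq_cons, Multiset.map_cons, Multiset.prod_cons,
            Multiset.map_singleton, Multiset.prod_singleton, Multiset.map_zero, Multiset.prod_zero,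
            h1, h2, mul_one]
          rw [mul_comm, hs]
        · rw [if_neg fun h => hw h.2, if_neg fun h => h.elim hi hw]
          simp only [Multiset.map_cons, Multiset.prod_cons,
            Multiset.map_singleton, Multiset.prod_singleton, h1, h2, mul_one]
          rw [mul_comm, hs]
      · rw [(levelSlice β α j i.rev).den_eq _ (Or.inr rfl), (levelSlice β α j i.rev).num_eq _ (Or.inr rfl),
          h3]
        simp

/-- The charts of `𝓡⁺(β, α) ⟶ 𝓡[β + β⁻¹, α]` given by the slices. -/
noncomputable def levelKernelCharts (hβ : β * β = 1) (hα : α ≠ 0) :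
    KernelCharts (levelMap β α) (Fin 4) where
  base j := CommRingCat.of ((monodromyAction (β + β⁻¹) α).invRing {j})
  line j i := CommRingCat.of ((levelAction β α).invRing {Sum.inl j, Sum.inr i})
  baseMap j := (monodromyAction (β + β⁻¹) α).chartMap (monodromyCharts_mem α _ j)
  lineMap j i := (levelAction β α).chartMap (levelCharts_mem β α j i)
  ring j i := CommRingCat.ofHom ((forgetLine β α).inv (forgetLine_idx_mem β α j i)).toRingHom
  mat j := shiftedMonodromy β α j
  slope j i := (levelSlice β α j i).coord (Sum.inr i.rev)
  isOpenImmersion_baseMap _ := TorusAction.isOpenImmersion_chartMap _ _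
  isOpenImmersion_lineMap _ _ := TorusAction.isOpenImmersion_chartMap _ _
  exists_mem_range_baseMap y := by
    obtain ⟨S, hS, q, rfl⟩ := (monodromyAction (β + β⁻¹) α).exists_chartMap_eq y
    obtain ⟨j, hj⟩ := hS
    exact ⟨j, (monodromyAction (β + β⁻¹) α).range_chartMap_subset (monodromyCharts_mem α _ j) _
      (Set.singleton_subset_iff.mpr hj) ⟨q, rfl⟩⟩
  lineMap_comp j i := (forgetLine β α).chartMap_quotientMap _ _ _
  exists_mem_range_lineMap j x hx := by
    obtain ⟨S, hS, q, rfl⟩ := (levelAction β α).exists_chartMap_eq x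
    obtain ⟨⟨k, hk⟩, ⟨i, hi⟩⟩ := hS
    obtain ⟨q', hq'⟩ := (levelAction β α).range_chartMap_subset (levelCharts_mem β α k i)
      ⟨⟨k, hk⟩, ⟨i, hi⟩⟩ (Set.insert_subset hk (Set.singleton_subset_iff.mpr hi)) ⟨q, rfl⟩
    refine ⟨i, ?_⟩
    rw [← hq'] at hx ⊢
    refine (levelChart_mem_range_iff β α k j i i q').mpr
      ⟨?_, levelSlice_one_notMem β α (Or.inr rfl) q'⟩
    -- The function `a_j` on the chart of `x` is pulled back from the slice `k`, so it is nonzero at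
    -- `x` exactly when the image of `x` lies in the slice `j`.
    have e := congrArg (fun φ : Spec (CommRingCat.of
      ((levelAction β α).invRing {Sum.inl k, Sum.inr i})) ⟶ monodromySpace (β + β⁻¹) α => φ q')
      ((forgetLine β α).chartMap_quotientMap (monodromyCharts_mem α _ k) (levelCharts_mem β α k i)
        (forgetLine_idx_mem β α k i))
    have hx' : (monodromyAction (β + β⁻¹) α).chartMap (monodromyCharts_mem α _ k)
        (Spec.map (CommRingCat.ofHom
          ((forgetLine β α).inv (forgetLine_idx_mem β α k i)).toRingHom) q') ∈
        Set.range ((monodromyAction (β + β⁻¹) α).chartMap (monodromyCharts_mem α _ j)) := by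
      obtain ⟨z, hz⟩ := hx
      exact ⟨z, hz.trans e⟩
    have := ((monodromySlice (β + β⁻¹) α k).chartMap_mem_range_iff _ _ _).mp hx' j rfl
    rw [← forgetLine_inv_coord]
    exact this
  mat_trace j := shiftedMonodromy_trace_map β α hβ j (AlgHom.id ℂ _)
  mat_det j := shiftedMonodromy_det_map β α hβ hα j (AlgHom.id ℂ _)
  slope_spec j i l := levelSlice_slope β α j i l
  slope_lift j i A ρ t h := by
    -- The ring `A` is arbitrary and receives its `ℂ`-algebra structure through the given
    -- homomorphism.
    let _ : Algebra ℂ A := (ρ.hom.comp (algebraMap ℂ _)).toAlgebra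
    let ρ' : (monodromyAction (β + β⁻¹) α).invRing {j} →ₐ[ℂ] A :=
      { ρ.hom with commutes' := fun _ => rfl }
    obtain ⟨τ, h1, h2⟩ := exists_level_lift β α j i ρ' t h
    exact ⟨CommRingCat.ofHom τ.toRingHom, CommRingCat.hom_ext (congrArg AlgHom.toRingHom h1), h2⟩
  slope_generates j i x := exists_polynomial_slope β α j i x
  mem_range_rev j i q := by
    refine (levelChart_mem_range_iff β α j j i i.rev q).trans ?_
    exact and_iff_right (levelSlice_one_notMem β α (Or.inl rfl) q)
  overlap j i A τ τ' h hs := by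
    let _ : Algebra ℂ A := (τ.hom.comp (algebraMap ℂ _)).toAlgebra
    let t : (levelAction β α).invRing {Sum.inl j, Sum.inr i} →ₐ[ℂ] A :=
      { τ.hom with commutes' := fun _ => rfl }
    have hh : ∀ x, τ.hom ((forgetLine β α).inv (forgetLine_idx_mem β α j i) x) =
        τ'.hom ((forgetLine β α).inv (forgetLine_idx_mem β α j i.rev) x) := fun x =>
      congrArg (fun f => f.hom x) h
    let t' : (levelAction β α).invRing {Sum.inl j, Sum.inr i.rev} →ₐ[ℂ] A :=
      { τ'.hom with
        commutes' := fun c => by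
          have := hh (algebraMap ℂ _ c)
          rw [AlgHom.commutes, AlgHom.commutes] at this
          exact this.symm }
    exact levelChart_overlap β α j i t t' (AlgHom.ext hh) hs

end Charts

/-! ### Stokes data with scalar monodromy -/

section ScalarMonodromy

/-- The Stokes data with `a_j = 1` for which `top` is the scalar `β`, where `β = ±1`. -/
noncomputable def scalarStokes (β α : ℂ) : Fin 4 → Fin 4 → ℂ :=
  ![![1, β * α - 1, -(β * α⁻¹), β * α - (β * α) ^ 2],
    ![β * α - 1, 1, β * α⁻¹ - 1, -(β * α)],
    ![-(β * α), β * α⁻¹ - 1, 1, β * α - 1],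
    ![β * α - (β * α) ^ 2, -(β * α⁻¹), β * α - 1, 1]]

variable {β α : ℂ}

theorem scalarStokes_self (j : Fin 4) : scalarStokes β α j j = 1 := by
  fin_cases j <;> simp [scalarStokes]

theorem topMonodromy_eq_of_stokes_relations (hβ : β * β = 1) (hα : α ≠ 0) {a : Fin 4 → ℂ}
    (h1 : 1 + a 1 * a 2 = β * α⁻¹) (h2 : a 3 = -(β * α) * a 1) (h3 : a 0 = -(β * α) * a 2)
    (l m : Fin 2) : topMonodromy α a l m = if l = m then β else 0 := by
  have h : α * α⁻¹ = 1 := mul_inv_cancel₀ hα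
  rw [topMonodromy_eq]
  generalize α⁻¹ = c at *
  have e : (1 + a 0 * a 1) = β * α := by
    rw [h3]
    linear_combination -β * α * h1 - β * β * h - hβ
  have e' : (1 + a 2 * a 3) = β * α := by
    rw [h2]
    linear_combination -β * α * h1 - β * β * h - hβ
  fin_cases l <;> fin_cases m <;> simp
  · linear_combination α * h1 + β * h
  · right
    rw [e', h2]
    ring
  · right
    rw [e, h3]
    ring
  · rw [e, e', h2, h3]
    linear_combination c * α * α * h1 + β * (c * α + 1) * h +
      c * α * α * (a 1 * a 2 + 1) * hβ

theorem topMonodromy_scalarStokes (hβ : β * β = 1) (hα : α ≠ 0) (j : Fin 4) (l m : Fin 2) :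
    topMonodromy α (scalarStokes β α j) l m = if l = m then β else 0 := by
  have h : β * α * (β * α⁻¹) = 1 := by
    rw [mul_mul_mul_comm, hβ, mul_inv_cancel₀ hα, one_mul]
  refine topMonodromy_eq_of_stokes_relations hβ hα ?_ ?_ ?_ l m <;>
    fin_cases j <;> simp only [scalarStokes] <;> generalize β * α = d at * <;>
    generalize β * α⁻¹ = g at * <;> simp
  all_goals first | linear_combination h | linear_combination -h | ring

variable {A : Type} [CommRing A] [Algebra ℂ A] {a : Fin 4 → A}

/-- The upper left entry gives `1 + a 1 * a 2`. Substituting it in the off-diagonal entries makes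
these linear, and `β * α` is inverse to `β * α⁻¹`. -/
theorem stokes_relations_of_scalar (hβ : β * β = 1) (hα : α ≠ 0)
    (h : ∀ l m, topMonodromy α a l m = if l = m then algebraMap ℂ A β else 0) :
    1 + a 1 * a 2 = algebraMap ℂ A (β * α⁻¹) ∧ a 3 = - algebraMap ℂ A (β * α) * a 1 ∧
      a 0 = - algebraMap ℂ A (β * α) * a 2 := by
  have hu : algebraMap ℂ A α * algebraMap ℂ A α⁻¹ = 1 := by
    rw [← map_mul, mul_inv_cancel₀ hα, map_one]
  have hb : algebraMap ℂ A β * algebraMap ℂ A β = 1 := by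
    rw [← map_mul, hβ, map_one]
  have h00 := h 0 0
  have h01 := h 0 1
  have h10 := h 1 0
  simp only [topMonodromy_eq, Matrix.of_apply, Matrix.cons_val', Matrix.cons_val_zero,
    Matrix.cons_val_one, Matrix.cons_val_fin_one, if_true, zero_ne_one, one_ne_zero,
    if_false] at h00 h01 h10
  rw [map_mul, map_mul]
  generalize algebraMap ℂ A β = b at *
  generalize algebraMap ℂ A α = c at *
  generalize algebraMap ℂ A α⁻¹ = c' at *
  have e : 1 + a 1 * a 2 = b * c' := by
    linear_combination c' * h00 - (1 + a 1 * a 2) * hu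
  refine ⟨e, ?_, ?_⟩
  · linear_combination b * h01 - b * c * a 3 * e - a 3 * hu * b * b - a 3 * hb
  · linear_combination b * c * c * h10 - (a 0 * (1 + a 1 * a 2) + a 2) * b * c * hu -
      b * c * a 0 * e - a 0 * hu * b * b - a 0 * hb

/-- For `a j = 1` the three relations have a unique solution over every `ℂ`-algebra. Hence the zero
scheme of `top - β` on a slice is a reduced point or empty. -/
theorem eq_scalarStokes (hβ : β * β = 1) (hα : α ≠ 0) {j : Fin 4} (hj : a j = 1)
    (h : ∀ l m, topMonodromy α a l m = if l = m then algebraMap ℂ A β else 0) (k : Fin 4) :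
    a k = algebraMap ℂ A (scalarStokes β α j k) := by
  obtain ⟨h1, h2, h3⟩ := stokes_relations_of_scalar hβ hα h
  have hu : algebraMap ℂ A (β * α) * algebraMap ℂ A (β * α⁻¹) = 1 := by
    rw [← map_mul, mul_mul_mul_comm, hβ, mul_inv_cancel₀ hα, one_mul, map_one]
  have key : ∀ j, a j = 1 → ∀ k, a k =
      ![![1, algebraMap ℂ A (β * α) - 1, -algebraMap ℂ A (β * α⁻¹),
          algebraMap ℂ A (β * α) - algebraMap ℂ A (β * α) ^ 2],
        ![algebraMap ℂ A (β * α) - 1, 1, algebraMap ℂ A (β * α⁻¹) - 1, -algebraMap ℂ A (β * α)],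
        ![-algebraMap ℂ A (β * α), algebraMap ℂ A (β * α⁻¹) - 1, 1, algebraMap ℂ A (β * α) - 1],
        ![algebraMap ℂ A (β * α) - algebraMap ℂ A (β * α) ^ 2, -algebraMap ℂ A (β * α⁻¹),
          algebraMap ℂ A (β * α) - 1, 1]] j k := by
    generalize algebraMap ℂ A (β * α) = d at *
    generalize algebraMap ℂ A (β * α⁻¹) = g at *
    intro j hj
    have e0 : j = 0 → a 2 = - g ∧ a 1 = d - 1 := by
      rintro rfl
      have e : a 2 = - g := by linear_combination -a 2 * hu + g * h3 - g * hj
      exact ⟨e, by linear_combination d * a 1 * e - d * h1 - (1 + a 1) * hu⟩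
    have e1 : j = 1 → a 2 = g - 1 := by
      rintro rfl
      linear_combination h1 - a 2 * hj
    have e2 : j = 2 → a 1 = g - 1 := by
      rintro rfl
      linear_combination h1 - a 1 * hj
    have e3 : j = 3 → a 1 = - g ∧ a 2 = d - 1 := by
      rintro rfl
      have e : a 1 = - g := by linear_combination -a 1 * hu + g * h2 - g * hj
      exact ⟨e, by linear_combination d * a 2 * e - d * h1 - (1 + a 2) * hu⟩
    intro k
    fin_cases j <;> fin_cases k <;> simp at hj e0 e1 e2 e3 ⊢
    · exact hj
    · exact e0.2
    · exact e0.1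
    · linear_combination h2 - d * e0.2
    · linear_combination h3 - d * e1 - hu
    · exact hj
    · exact e1
    · linear_combination h2 - d * hj
    · linear_combination h3 - d * hj
    · exact e2
    · exact hj
    · linear_combination h2 - d * e2 - hu
    · linear_combination h3 - d * e3.2
    · exact e3.1
    · exact e3.2
    · exact hj
  have e := key j hj k
  rw [e, scalarStokes]
  fin_cases j <;> fin_cases k <;> simp

end ScalarMonodromy

/-! ### The slices are surfaces -/

section Surface

variable {β : ℂ} (α : ℂ)

theorem not_algebraicIndependent_coord (s : ℂ) (hα : α ≠ 0) (j : Fin 4) :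
    ¬ AlgebraicIndependent ℂ fun l : Fin 3 => (monodromySlice s α j).coord (j.succAbove l) := by
  intro h
  -- The trace equation with `a_j = 1` substituted is the relation between the other three
  -- coordinates.
  let F : MvPolynomial (Fin 3) ℂ :=
    (topMonodromy α (j.insertNth (α := fun _ => MvPolynomial (Fin 3) ℂ) 1 MvPolynomial.X)).trace -
      MvPolynomial.C s
  have hF : ∀ {A : Type} [CommRing A] [Algebra ℂ A] (a : Fin 4 → A) (_ : a j = 1),
      MvPolynomial.aeval (fun l => a (j.succAbove l)) F =
        (topMonodromy α a).trace - algebraMap ℂ A s := by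
    intro A _ _ a hj
    have e : (fun k => MvPolynomial.aeval (R := ℂ) (fun l => a (j.succAbove l))
        (j.insertNth (α := fun _ => MvPolynomial (Fin 3) ℂ) 1 MvPolynomial.X k)) = a := by
      funext k
      revert k
      rw [Fin.forall_iff_succAbove j]
      simp [hj]
    rw [map_sub, Matrix.trace_fin_two, map_add, topMonodromy_map, topMonodromy_map, e,
      MvPolynomial.algHom_C, Matrix.trace_fin_two]
  have h0 : F = 0 := by
    refine (injective_iff_map_eq_zero _).mp h F ?_
    rw [hF _ ((monodromySlice s α j).coord_eq_one rfl), monodromySlice_trace, sub_self]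
  have hs : ∀ a : Fin 4 → ℂ, a j = 1 → (topMonodromy α a).trace = s := fun a hj => by
    have := hF a hj
    rw [h0, map_zero] at this
    exact (sub_eq_zero.mp this.symm)
  -- If the relation were trivial, the trace would be constant on the slice. The two points compared
  -- below have traces differing by `α` or `α⁻¹`.
  have key : ∀ a b : Fin 4 → ℂ, a j = 1 → b j = 1 →
      (topMonodromy α a).trace = (topMonodromy α b).trace := fun a b ha hb =>
    (hs a ha).trans (hs b hb).symm
  simp only [topMonodromy_eq, Matrix.trace_fin_two_of] at key
  fin_cases j
  · simpa [hα] using key ![1, 0, 0, 1] ![1, 0, 0, 0] rfl rfl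
  · simpa [hα] using key ![0, 1, 1, 0] ![0, 1, 0, 0] rfl rfl
  · simpa [hα] using key ![0, 1, 1, 0] ![0, 0, 1, 0] rfl rfl
  · simpa [hα] using key ![1, 0, 0, 1] ![0, 0, 0, 1] rfl rfl

theorem adjoin_range_coord_succAbove (s : ℂ) (j : Fin 4) :
    Algebra.adjoin ℂ (Set.range fun l : Fin 3 => (monodromySlice s α j).coord (j.succAbove l)) = ⊤ := by
  rw [eq_top_iff, ← (monodromySlice s α j).adjoin_range_coord]
  refine Algebra.adjoin_le ?_
  rintro _ ⟨k, rfl⟩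
  revert k
  rw [Fin.forall_iff_succAbove j]
  refine ⟨?_, fun l => Algebra.subset_adjoin ⟨l, rfl⟩⟩
  rw [(monodromySlice s α j).coord_eq_one rfl]
  exact one_mem _

theorem coord_sub_algebraMap_mem (hβ : β * β = 1) (hα : α ≠ 0) (j k : Fin 4)
    (I : Ideal ((monodromyAction (β + β⁻¹) α).invRing {j}))
    (hI : ∀ l m, shiftedMonodromy β α j l m ∈ I) :
    (monodromySlice (β + β⁻¹) α j).coord k - algebraMap ℂ _ (scalarStokes β α j k) ∈ I := by
  refine Ideal.Quotient.eq.mp ?_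
  have h1 : ∀ l m, Ideal.Quotient.mkₐ ℂ I (shiftedMonodromy β α j l m) = 0 := fun l m =>
    Ideal.Quotient.eq_zero_iff_mem.mpr (hI l m)
  have h2 := shiftedMonodromy_map (A := (monodromyAction (β + β⁻¹) α).invRing {j} ⧸ I) β α j
    (Ideal.Quotient.mkₐ ℂ I)
  have h := fun l m => sub_eq_zero.mp ((h2 l m).symm.trans (h1 l m))
  exact eq_scalarStokes hβ hα (by rw [(monodromySlice (β + β⁻¹) α j).coord_eq_one rfl, map_one]) h k

/-- Modulo `I` the monodromy is scalar, so every coordinate is congruent to a constant, and the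
coordinates generate the ring. -/
theorem exists_sub_algebraMap_mem (hβ : β * β = 1) (hα : α ≠ 0) (j : Fin 4)
    (I : Ideal ((monodromyAction (β + β⁻¹) α).invRing {j}))
    (hI : ∀ l m, shiftedMonodromy β α j l m ∈ I) (r : (monodromyAction (β + β⁻¹) α).invRing {j}) :
    ∃ c : ℂ, r - algebraMap ℂ _ c ∈ I := by
  have hr : r ∈ ((⊥ : Subalgebra ℂ _).comap (Ideal.Quotient.mkₐ ℂ I)) := by
    refine (?_ : (⊤ : Subalgebra ℂ _) ≤ _) trivial
    rw [← (monodromySlice (β + β⁻¹) α j).adjoin_range_coord]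
    refine Algebra.adjoin_le ?_
    rintro _ ⟨k, rfl⟩
    exact Algebra.mem_bot.mpr ⟨scalarStokes β α j k,
      (Ideal.Quotient.eq.mpr (coord_sub_algebraMap_mem α hβ hα j k I hI)).symm⟩
  obtain ⟨c, hc⟩ := Algebra.mem_bot.mp hr
  exact ⟨c, Ideal.Quotient.eq.mp hc.symm⟩

theorem chartMap_monodromySpaceToSpec (s : ℂ) (j : Fin 4) :
    (monodromyAction s α).chartMap (monodromyCharts_mem α s j) ≫ monodromySpaceToSpec s α =
      Spec.map (CommRingCat.ofHom (algebraMap ℂ ((monodromyAction s α).invRing {j}))) :=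
  colimit.ι_desc _ _

theorem exists_adjoin_eq_top_of_toAlgebra {R : Type} [CommRing R] [Algebra ℂ R] {n : ℕ}
    (b : Fin n → R) (h : Algebra.adjoin ℂ (Set.range b) = ⊤) (h' : ¬ AlgebraicIndependent ℂ b) :
    letI := (algebraMap ℂ R).toAlgebra
    ∃ b : Fin n → R, Algebra.adjoin ℂ (Set.range b) = ⊤ ∧ ¬ AlgebraicIndependent ℂ b := by
  have e : (algebraMap ℂ R).toAlgebra = (inferInstance : Algebra ℂ R) :=
    Algebra.algebra_ext _ _ fun _ => rfl
  rw [e]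
  exact ⟨b, h, h'⟩

theorem shiftedMonodromy_mem_span (hβ : β * β = 1) (j : Fin 4) (l m : Fin 2) :
    shiftedMonodromy β α j l m ∈ Ideal.span {shiftedMonodromy β α j 0 0,
      shiftedMonodromy β α j 0 1, shiftedMonodromy β α j 1 0} := by
  have h00 : shiftedMonodromy β α j 0 0 ∈ Ideal.span {shiftedMonodromy β α j 0 0,
    shiftedMonodromy β α j 0 1, shiftedMonodromy β α j 1 0} := Ideal.subset_span (by simp)
  fin_cases l <;> fin_cases m
  · exact h00
  · exact Ideal.subset_span (by simp)
  · exact Ideal.subset_span (by simp)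
  · have h := shiftedMonodromy_trace_map β α hβ j (AlgHom.id ℂ _)
    rw [AlgHom.id_apply, AlgHom.id_apply] at h
    change shiftedMonodromy β α j 1 1 ∈ _
    rw [eq_neg_of_add_eq_zero_right h]
    exact neg_mem h00

theorem levelKernelCharts_isSurfaceOver (hβ : β * β = 1) (hα : α ≠ 0) :
    (levelKernelCharts β α hβ hα).IsSurfaceOver (monodromySpaceToSpec (β + β⁻¹) α) where
  exists_algebra j := by
    refine ⟨algebraMap ℂ ((monodromyAction (β + β⁻¹) α).invRing {j}),
      chartMap_monodromySpaceToSpec α _ j, ?_, fun r => ?_⟩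
    · exact exists_adjoin_eq_top_of_toAlgebra
        (R := (monodromyAction (β + β⁻¹) α).invRing {j}) _ (adjoin_range_coord_succAbove α _ j)
        (not_algebraicIndependent_coord α _ hα j)
    · exact exists_sub_algebraMap_mem α hβ hα j _ (shiftedMonodromy_mem_span α hβ j) r

end Surface

/-! ### Equations for an eigenvector in the two charts -/

section Eigenvector

variable {A : Type} [CommRing A] [Algebra ℂ A] {β α : ℂ}

theorem algebraMap_mul_inv_eq_one (hβ : β * β = 1) (hα : α ≠ 0) :
    algebraMap ℂ A (β * α) * algebraMap ℂ A (β * α⁻¹) = 1 := by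
  rw [← map_mul, mul_mul_mul_comm, hβ, mul_inv_cancel₀ hα, one_mul, map_one]

/-- Apply the Stokes matrices to `(1, t)` one after another. The first coordinate of the eigenvector
equation fixes the value that `a 0` multiplies in the second, which thus becomes linear in `a 0`
with unit coefficient. -/
theorem mulVec_one_iff (hβ : β * β = 1) (hα : α ≠ 0) (a : Fin 4 → A) (t : A) :
    (∀ l, topMonodromy α a l 0 * 1 + topMonodromy α a l 1 * t = algebraMap ℂ A β * ![1, t] l) ↔
      1 + a 3 * t + a 1 * (t + a 2 * (1 + a 3 * t)) = algebraMap ℂ A (β * α⁻¹) ∧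
        t + a 2 * (1 + a 3 * t) + algebraMap ℂ A (β * α⁻¹) * a 0 = algebraMap ℂ A (β * α) * t := by
  have hu : algebraMap ℂ A α * algebraMap ℂ A α⁻¹ = 1 := by
    rw [← map_mul, mul_inv_cancel₀ hα, map_one]
  have hb : algebraMap ℂ A β * algebraMap ℂ A β = 1 := by rw [← map_mul, hβ, map_one]
  rw [Fin.forall_fin_two, topMonodromy_eq, map_mul, map_mul]
  generalize algebraMap ℂ A β = b at *
  generalize algebraMap ℂ A α = c at *
  generalize algebraMap ℂ A α⁻¹ = c' at *
  simp only [Matrix.of_apply, Matrix.cons_val', Matrix.cons_val_zero, Matrix.cons_val_one,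
    Matrix.cons_val_fin_one]
  constructor
  · rintro ⟨h0, h1⟩
    have e : 1 + a 3 * t + a 1 * (t + a 2 * (1 + a 3 * t)) = b * c' := by
      linear_combination c' * h0 - (1 + a 3 * t + a 1 * (t + a 2 * (1 + a 3 * t))) * hu
    refine ⟨e, ?_⟩
    linear_combination c * h1 - a 0 * e - (t + a 2 * (1 + a 3 * t) +
      a 0 * (1 + a 3 * t + a 1 * (t + a 2 * (1 + a 3 * t)))) * hu
  · rintro ⟨e, h1⟩
    constructor
    · linear_combination c * e + b * hu
    · linear_combination c' * h1 + c' * a 0 * e + b * t * hu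

theorem mulVec_iff_one (hβ : β * β = 1) (hα : α ≠ 0) (a : Fin 4 → A) (t : A) :
    (∀ l, topMonodromy α a l 0 * t + topMonodromy α a l 1 * 1 = algebraMap ℂ A β * ![t, 1] l) ↔
      t + a 3 + a 1 * (1 + a 2 * (t + a 3)) = algebraMap ℂ A (β * α⁻¹) * t ∧
        1 + a 2 * (t + a 3) + algebraMap ℂ A (β * α⁻¹) * a 0 * t = algebraMap ℂ A (β * α) := by
  have hu : algebraMap ℂ A α * algebraMap ℂ A α⁻¹ = 1 := by
    rw [← map_mul, mul_inv_cancel₀ hα, map_one]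
  have hb : algebraMap ℂ A β * algebraMap ℂ A β = 1 := by rw [← map_mul, hβ, map_one]
  rw [Fin.forall_fin_two, topMonodromy_eq, map_mul, map_mul]
  generalize algebraMap ℂ A β = b at *
  generalize algebraMap ℂ A α = c at *
  generalize algebraMap ℂ A α⁻¹ = c' at *
  simp only [Matrix.of_apply, Matrix.cons_val', Matrix.cons_val_zero, Matrix.cons_val_one,
    Matrix.cons_val_fin_one]
  constructor
  · rintro ⟨h0, h1⟩
    have e : t + a 3 + a 1 * (1 + a 2 * (t + a 3)) = b * c' * t := by
      linear_combination c' * h0 - (t + a 3 + a 1 * (1 + a 2 * (t + a 3))) * hu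
    refine ⟨e, ?_⟩
    linear_combination c * h1 - a 0 * e - (1 + a 2 * (t + a 3) +
      a 0 * (t + a 3 + a 1 * (1 + a 2 * (t + a 3)))) * hu
  · rintro ⟨e, h1⟩
    constructor
    · linear_combination c * e + b * t * hu
    · linear_combination c' * h1 + c' * a 0 * e + b * hu

/-- A vector with a unit coordinate is part of a basis. One eigenvalue is `β` and the determinant is
`1`, so the other diagonal entry is `β⁻¹`. The trace equation is therefore redundant on the charts.
-/
theorem trace_topMonodromy_of_mulVec (hβ : β * β = 1) (hα : α ≠ 0) (a : Fin 4 → A) (y : Fin 2 → A)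
    (i : Fin 2) (hi : y i = 1)
    (h : ∀ l, topMonodromy α a l 0 * y 0 + topMonodromy α a l 1 * y 1 = algebraMap ℂ A β * y l) :
    (topMonodromy α a).trace = algebraMap ℂ A (β + β⁻¹) := by
  have hb : algebraMap ℂ A β * algebraMap ℂ A β = 1 := by rw [← map_mul, hβ, map_one]
  have hd := det_topMonodromy a hα
  rw [Matrix.det_fin_two] at hd
  have h0 := h 0
  have h1 := h 1
  rw [Matrix.trace_fin_two, ← eq_inv_of_mul_eq_one_left hβ, map_add]
  generalize algebraMap ℂ A β = b at *
  generalize topMonodromy α a = T at *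
  fin_cases i
  · rw [show y 0 = 1 from hi] at *
    linear_combination -hb * (T 1 1 - T 0 1 * y 1 - b) + b * hd + h0 * (1 - b * T 1 1) +
      b * T 0 1 * h1 - b * hb
  · rw [show y 1 = 1 from hi] at *
    linear_combination -hb * (T 0 0 - T 1 0 * y 0 - b) + b * hd + h1 * (1 - b * T 0 0) +
      b * T 1 0 * h0 - b * hb

/-- An eigenvector of a monodromy matrix defines a homomorphism from a chart of the level space. -/
theorem exists_levelSlice_lift_of_mulVec (hβ : β * β = 1) (hα : α ≠ 0) (j : Fin 4) (i : Fin 2)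
    (a : Fin 4 → A) (y : Fin 2 → A)
    (hy : ∀ l, topMonodromy α a l 0 * y 0 + topMonodromy α a l 1 * y 1 = algebraMap ℂ A β * y l)
    (hj : a j = 1) (hi : y i = 1) :
    ∃ ρ : (levelAction β α).invRing {Sum.inl j, Sum.inr i} →ₐ[ℂ] A,
      (∀ k, ρ ((levelSlice β α j i).coord (Sum.inl k)) = a k) ∧
      ∀ k, ρ ((levelSlice β α j i).coord (Sum.inr k)) = y k :=
  exists_levelSlice_lift β α j i a y (trace_topMonodromy_of_mulVec hβ hα a y i hi hy) hy hj hi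

end Eigenvector

/-! ### Infinitesimal lifting of eigenvectors -/

section Lifting

variable {B : Type} [CommRing B] {I : Ideal B}

theorem exists_sum_mul_sub_one_mem {n : ℕ} (c : Fin n → B)
    (h : Ideal.span (Set.range c) ⊔ I = ⊤) : ∃ x : Fin n → B, ∑ k, x k * c k - 1 ∈ I := by
  obtain ⟨y, hy, z, hz, e⟩ := Submodule.mem_sup.mp ((Ideal.eq_top_iff_one _).mp h)
  obtain ⟨x, hx⟩ := (Ideal.mem_span_range_iff_exists_fun).mp hy
  exact ⟨x, by rw [hx, ← e, sub_add_cancel_left]; exact neg_mem hz⟩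

/-- The second equation determines `a 0`. What remains is one equation in `a 1, a 2, a 3, t`, solved
by a Newton step that is exact because `I` squares to zero. The condition `a j = 1` may be lost here
and is restored by rescaling. -/
theorem exists_lift_mulVec_one (hI : ∀ x ∈ I, ∀ y ∈ I, x * y = 0) {g d : B} (hdg : d * g = 1)
    (a : Fin 4 → B) (t : B) {j : Fin 4} (hj : a j = 1)
    (h1 : 1 + a 3 * t + a 1 * (t + a 2 * (1 + a 3 * t)) - g ∈ I)
    (h2 : t + a 2 * (1 + a 3 * t) + g * a 0 - d * t ∈ I) :
    ∃ (a' : Fin 4 → B) (t' : B), (∀ k, a' k - a k ∈ I) ∧ t' - t ∈ I ∧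
      1 + a' 3 * t' + a' 1 * (t' + a' 2 * (1 + a' 3 * t')) = g ∧
      t' + a' 2 * (1 + a' 3 * t') + g * a' 0 = d * t' := by
  obtain ⟨p, hp⟩ : ∃ p, p = 1 + a 3 * t := ⟨_, rfl⟩
  obtain ⟨w, hw⟩ : ∃ w, w = t + a 2 * p := ⟨_, rfl⟩
  rw [← hp, ← hw] at h1 h2
  -- The partial derivatives of `p + a 1 * w - g` with respect to `a 1, a 2, a 3, t`.
  let c : Fin 4 → B := ![w, a 1 * p, t * (1 + a 1 * a 2), a 3 + a 1 * (1 + a 2 * a 3)]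
  have hc : Ideal.span (Set.range c) ⊔ I = ⊤ := by
    set J := Ideal.span (Set.range c) ⊔ I
    have m1 : p + a 1 * w - g ∈ J := Ideal.mem_sup_right h1
    have m2 : w + g * a 0 - d * t ∈ J := Ideal.mem_sup_right h2
    have mc : ∀ k, c k ∈ J := fun k => Ideal.mem_sup_left (Ideal.subset_span ⟨k, rfl⟩)
    have mw : w ∈ J := mc 0
    have ma1p : a 1 * p ∈ J := mc 1
    have mt' : t * (1 + a 1 * a 2) ∈ J := mc 2
    have m3' : a 3 + a 1 * (1 + a 2 * a 3) ∈ J := mc 3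
    have mp : p - g ∈ J := by
      rw [show p - g = (p + a 1 * w - g) - a 1 * w by ring]
      exact J.sub_mem m1 (J.mul_mem_left _ mw)
    have ma1 : a 1 ∈ J := by
      rw [show a 1 = d * (a 1 * p) - a 1 * d * (p - g) by linear_combination - a 1 * hdg]
      exact J.sub_mem (J.mul_mem_left _ ma1p) (J.mul_mem_left _ mp)
    have mt : t ∈ J := by
      rw [show t = t * (1 + a 1 * a 2) - t * a 2 * a 1 by ring]
      exact J.sub_mem mt' (J.mul_mem_left _ ma1)
    have ma3 : a 3 ∈ J := by
      rw [show a 3 = a 3 + a 1 * (1 + a 2 * a 3) - (1 + a 2 * a 3) * a 1 by ring]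
      exact J.sub_mem m3' (J.mul_mem_left _ ma1)
    have ma2 : a 2 ∈ J := by
      rw [show a 2 = w - t - a 2 * a 3 * t by rw [hw, hp]; ring]
      exact J.sub_mem (J.sub_mem mw mt) (J.mul_mem_left _ mt)
    have ma0 : a 0 ∈ J := by
      rw [show a 0 = d * (w + g * a 0 - d * t) - d * w + d * d * t by
        linear_combination - a 0 * hdg]
      exact J.add_mem (J.sub_mem (J.mul_mem_left _ m2) (J.mul_mem_left _ mw)) (J.mul_mem_left _ mt)
    -- If all derivatives vanished, so would every `a k`, contrary to `a j = 1`.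
    refine (Ideal.eq_top_iff_one _).mpr (hj ▸ ?_)
    fin_cases j <;> assumption
  obtain ⟨x, hx⟩ := exists_sum_mul_sub_one_mem c hc
  obtain ⟨e, he⟩ : ∃ e, e = p + a 1 * w - g := ⟨_, rfl⟩
  have heI : e ∈ I := he ▸ h1
  have hee := hI e heI e heI
  have hex := hI e heI _ hx
  simp only [c, Fin.sum_univ_four, Matrix.cons_val] at hex
  have ht' : t - e * x 3 - t ∈ I := by
    rw [show t - e * x 3 - t = -(x 3) * e by ring]
    exact I.mul_mem_left _ heI
  have hp' : 1 + (a 3 - e * x 2) * (t - e * x 3) = p - e * (x 2 * t + a 3 * x 3) := by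
    linear_combination -hp + x 2 * x 3 * hee
  have hw' : t - e * x 3 + (a 2 - e * x 1) * (p - e * (x 2 * t + a 3 * x 3)) =
      w - e * (x 3 + x 1 * p + a 2 * (x 2 * t + a 3 * x 3)) := by
    linear_combination -hw + x 1 * (x 2 * t + a 3 * x 3) * hee
  -- Each variable moves by `-e * x`, where `∑ x k * c k` is `1` modulo `I`. The entry at `0` is
  -- read off from the second equation.
  refine ⟨![d * (d * (t - e * x 3) - (w - e * (x 3 + x 1 * p + a 2 * (x 2 * t + a 3 * x 3)))),
    a 1 - e * x 0, a 2 - e * x 1, a 3 - e * x 2], t - e * x 3, ?_, ht', ?_, ?_⟩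
  · rw [Fin.forall_fin_succ, Fin.forall_fin_succ, Fin.forall_fin_succ, Fin.forall_fin_succ]
    simp only [Matrix.cons_val]
    refine ⟨?_, ?_, ?_, ?_, fun k => k.elim0⟩
    · change d * (d * (t - e * x 3) -
        (w - e * (x 3 + x 1 * p + a 2 * (x 2 * t + a 3 * x 3)))) - a 0 ∈ I
      rw [show d * (d * (t - e * x 3) - (w - e * (x 3 + x 1 * p + a 2 * (x 2 * t + a 3 * x 3)))) - a 0 =
        -d * (w + g * a 0 - d * t) + d * (x 3 + x 1 * p + a 2 * (x 2 * t + a 3 * x 3) - d * x 3) * e by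
          linear_combination a 0 * hdg]
      exact I.add_mem (I.mul_mem_left _ h2) (I.mul_mem_left _ heI)
    · change a 1 - e * x 0 - a 1 ∈ I
      rw [show a 1 - e * x 0 - a 1 = -(x 0) * e by ring]
      exact I.mul_mem_left _ heI
    · change a 2 - e * x 1 - a 2 ∈ I
      rw [show a 2 - e * x 1 - a 2 = -(x 1) * e by ring]
      exact I.mul_mem_left _ heI
    · change a 3 - e * x 2 - a 3 ∈ I
      rw [show a 3 - e * x 2 - a 3 = -(x 2) * e by ring]
      exact I.mul_mem_left _ heI
  · simp only [Matrix.cons_val]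
    rw [hp', hw']
    linear_combination -he - hex + x 0 * (x 3 + x 1 * p + a 2 * (x 2 * t + a 3 * x 3)) * hee
  · simp only [Matrix.cons_val]
    rw [hp', hw']
    linear_combination (d * (t - e * x 3) - (w - e * (x 3 + x 1 * p + a 2 * (x 2 * t + a 3 * x 3)))) * hdg

/-- With `p = t + a 3` as a variable in place of `a 3`, the first equation gives `t = d * v`. The
second becomes `w + a 0 * v = d` in `a 0, a 1, a 2, p`, and a Newton step solves it. -/
theorem exists_lift_mulVec_one_right (hI : ∀ x ∈ I, ∀ y ∈ I, x * y = 0) {g d : B} (hdg : d * g = 1)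
    (a : Fin 4 → B) (t : B) {j : Fin 4} (hj : a j = 1)
    (h1 : t + a 3 + a 1 * (1 + a 2 * (t + a 3)) - g * t ∈ I)
    (h2 : 1 + a 2 * (t + a 3) + g * a 0 * t - d ∈ I) :
    ∃ (a' : Fin 4 → B) (t' : B), (∀ k, a' k - a k ∈ I) ∧ t' - t ∈ I ∧
      t' + a' 3 + a' 1 * (1 + a' 2 * (t' + a' 3)) = g * t' ∧
      1 + a' 2 * (t' + a' 3) + g * a' 0 * t' = d := by
  obtain ⟨p, hp⟩ : ∃ p, p = t + a 3 := ⟨_, rfl⟩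
  obtain ⟨w, hw⟩ : ∃ w, w = 1 + a 2 * p := ⟨_, rfl⟩
  obtain ⟨v, hv⟩ : ∃ v, v = p + a 1 * w := ⟨_, rfl⟩
  rw [← hp, ← hw] at h1 h2
  rw [← hv] at h1
  -- The partial derivatives of `w + a 0 * v` with respect to `a 1, a 2, p, a 0`, in this order.
  let c : Fin 4 → B := ![a 0 * w, p * (1 + a 0 * a 1), a 2 * (1 + a 0 * a 1) + a 0, v]
  have hc : Ideal.span (Set.range c) ⊔ I = ⊤ := by
    set J := Ideal.span (Set.range c) ⊔ I
    have m1 : v - g * t ∈ J := Ideal.mem_sup_right h1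
    have m2 : w + g * a 0 * t - d ∈ J := Ideal.mem_sup_right h2
    have mc : ∀ k, c k ∈ J := fun k => Ideal.mem_sup_left (Ideal.subset_span ⟨k, rfl⟩)
    have m0w : a 0 * w ∈ J := mc 0
    have mp' : p * (1 + a 0 * a 1) ∈ J := mc 1
    have m2' : a 2 * (1 + a 0 * a 1) + a 0 ∈ J := mc 2
    have mv : v ∈ J := mc 3
    have mt : t ∈ J := by
      rw [show t = d * v - d * (v - g * t) by linear_combination -t * hdg]
      exact J.sub_mem (J.mul_mem_left _ mv) (J.mul_mem_left _ m1)
    have mw : w - d ∈ J := by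
      rw [show w - d = (w + g * a 0 * t - d) - g * a 0 * t by ring]
      exact J.sub_mem m2 (J.mul_mem_left _ mt)
    have ma0 : a 0 ∈ J := by
      rw [show a 0 = g * (a 0 * w) - g * a 0 * (w - d) by linear_combination -a 0 * hdg]
      exact J.sub_mem (J.mul_mem_left _ m0w) (J.mul_mem_left _ mw)
    have mp : p ∈ J := by
      rw [show p = p * (1 + a 0 * a 1) - p * a 1 * a 0 by ring]
      exact J.sub_mem mp' (J.mul_mem_left _ ma0)
    have ma2 : a 2 ∈ J := by
      rw [show a 2 = a 2 * (1 + a 0 * a 1) + a 0 - (a 2 * a 1 + 1) * a 0 by ring]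
      exact J.sub_mem m2' (J.mul_mem_left _ ma0)
    have ma1 : a 1 ∈ J := by
      rw [show a 1 = g * (v - p) - g * a 1 * (w - d) by linear_combination -a 1 * hdg - g * hv]
      exact J.sub_mem (J.mul_mem_left _ (J.sub_mem mv mp)) (J.mul_mem_left _ mw)
    have ma3 : a 3 ∈ J := by
      rw [show a 3 = p - t by rw [hp]; ring]
      exact J.sub_mem mp mt
    refine (Ideal.eq_top_iff_one _).mpr (hj ▸ ?_)
    fin_cases j <;> assumption
  obtain ⟨x, hx⟩ := exists_sum_mul_sub_one_mem c hc
  obtain ⟨e, he⟩ : ∃ e, e = w + a 0 * v - d := ⟨_, rfl⟩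
  have heI : e ∈ I := by
    rw [he, show w + a 0 * v - d = (w + g * a 0 * t - d) + a 0 * (v - g * t) by ring]
    exact I.add_mem h2 (I.mul_mem_left _ h1)
  have hee := hI e heI e heI
  have hex := hI e heI _ hx
  simp only [c, Fin.sum_univ_four, Matrix.cons_val] at hex
  obtain ⟨r, hr⟩ : ∃ r, r = x 1 * p + a 2 * x 2 := ⟨_, rfl⟩
  obtain ⟨q, hq⟩ : ∃ q, q = x 2 + x 0 * w + a 1 * r := ⟨_, rfl⟩
  have hw' : 1 + (a 2 - e * x 1) * (p - e * x 2) = w - e * r := by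
    linear_combination -hw + x 1 * x 2 * hee + e * hr
  have hv' : p - e * x 2 + (a 1 - e * x 0) * (w - e * r) = v - e * q := by
    linear_combination -hv + x 0 * r * hee + e * hq
  have htI : d * (v - e * q) - t ∈ I := by
    rw [show d * (v - e * q) - t = d * (v - g * t) - d * q * e by linear_combination t * hdg]
    exact I.sub_mem (I.mul_mem_left _ h1) (I.mul_mem_left _ heI)
  have hpt : d * (v - e * q) + (p - e * x 2 - d * (v - e * q)) = p - e * x 2 := by ring
  -- The entry at `3` is the corrected `p` minus the corrected `t`.
  refine ⟨![a 0 - e * x 3, a 1 - e * x 0, a 2 - e * x 1, p - e * x 2 - d * (v - e * q)],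
    d * (v - e * q), ?_, htI, ?_, ?_⟩
  · rw [Fin.forall_fin_succ, Fin.forall_fin_succ, Fin.forall_fin_succ, Fin.forall_fin_succ]
    refine ⟨?_, ?_, ?_, ?_, fun k => k.elim0⟩
    · change a 0 - e * x 3 - a 0 ∈ I
      rw [show a 0 - e * x 3 - a 0 = -(x 3) * e by ring]
      exact I.mul_mem_left _ heI
    · change a 1 - e * x 0 - a 1 ∈ I
      rw [show a 1 - e * x 0 - a 1 = -(x 0) * e by ring]
      exact I.mul_mem_left _ heI
    · change a 2 - e * x 1 - a 2 ∈ I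
      rw [show a 2 - e * x 1 - a 2 = -(x 1) * e by ring]
      exact I.mul_mem_left _ heI
    · change p - e * x 2 - d * (v - e * q) - a 3 ∈ I
      rw [show p - e * x 2 - d * (v - e * q) - a 3 = -(x 2) * e - (d * (v - e * q) - t) by
        rw [hp]; ring]
      exact I.sub_mem (I.mul_mem_left _ heI) htI
  · simp only [Matrix.cons_val]
    rw [hpt, hw', hv']
    linear_combination -(v - e * q) * hdg
  · simp only [Matrix.cons_val]
    rw [hpt, hw']
    linear_combination (a 0 - e * x 3) * (v - e * q) * hdg - he - hex + x 3 * q * hee -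
      e * a 0 * hq - e * (1 + a 0 * a 1) * hr

variable [Algebra ℂ B] {α β : ℂ}

/-- The torus moves a solution with `a j` congruent to `1` onto the slice. The factors needed are
congruent to `1`, so nothing changes modulo `I`. -/
theorem exists_normalized_mulVec (hI : ∀ x ∈ I, ∀ y ∈ I, x * y = 0) (a : Fin 4 → B) (y : Fin 2 → B)
    (j : Fin 4) (i : Fin 2) (hj : a j - 1 ∈ I) (hi : y i = 1) {b : B}
    (h : ∀ l, topMonodromy α a l 0 * y 0 + topMonodromy α a l 1 * y 1 = b * y l) :
    ∃ (a' : Fin 4 → B) (y' : Fin 2 → B), a' j = 1 ∧ y' i = 1 ∧ (∀ k, a' k - a k ∈ I) ∧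
      (∀ l, y' l - y l ∈ I) ∧
      ∀ l, topMonodromy α a' l 0 * y' 0 + topMonodromy α a' l 1 * y' 1 = b * y' l := by
  obtain ⟨z, hz⟩ : ∃ z, z = a j := ⟨_, rfl⟩
  -- Since `(z - 1)² = 0`, the inverse of `z = 1 + (z - 1)` is `1 - (z - 1)`.
  have hzz : (2 - z) * z = 1 := by
    have := hI _ hj _ hj
    rw [← hz] at this
    linear_combination -this
  have hu : ∃ u v : B, u * v = 1 ∧ u - 1 ∈ I ∧ v - 1 ∈ I ∧ a j * ![u, v, u, v] j = 1 := by
    have m1 : z - 1 ∈ I := hz ▸ hj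
    have m2 : 2 - z - 1 ∈ I := by
      rw [show 2 - z - 1 = -(z - 1) by ring]
      exact neg_mem m1
    rw [← hz]
    have hj' : (j = 0 ∨ j = 2) ∨ (j = 1 ∨ j = 3) := by
      clear * -
      revert j
      decide
    rcases hj' with hj' | hj'
    · refine ⟨2 - z, z, hzz, m2, m1, ?_⟩
      rcases hj' with rfl | rfl <;> simp only [Matrix.cons_val] <;> linear_combination hzz
    · refine ⟨z, 2 - z, by linear_combination hzz, m1, m2, ?_⟩
      rcases hj' with rfl | rfl <;> simp only [Matrix.cons_val] <;> linear_combination hzz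
  obtain ⟨u, v, huv, mu, mv, hj1⟩ := hu
  have hmul : ∀ x z : B, z - 1 ∈ I → x * z - x ∈ I := fun x z hz => by
    rw [show x * z - x = x * (z - 1) by ring]
    exact I.mul_mem_left _ hz
  have hk : ∀ k, a k * ![u, v, u, v] k - a k ∈ I := by
    intro k
    refine hmul _ _ ?_
    fin_cases k <;> assumption
  have h0 := h 0
  have h1 := h 1
  fin_cases i
  · refine ⟨fun k => a k * ![u, v, u, v] k, ![y 0, y 1 * u], hj1, hi, hk, ?_, ?_⟩
    · rw [Fin.forall_fin_two]
      exact ⟨by simp, hmul _ _ mu⟩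
    · simp only [Fin.forall_fin_two, topMonodromy_scale α a huv, Matrix.of_apply, Matrix.cons_val',
        Matrix.cons_val_zero, Matrix.cons_val_one, Matrix.cons_val_fin_one]
      constructor
      · linear_combination h0 + topMonodromy α a 0 1 * y 1 * huv
      · linear_combination u * h1
  · refine ⟨fun k => a k * ![u, v, u, v] k, ![y 0 * v, y 1], hj1, hi, hk, ?_, ?_⟩
    · rw [Fin.forall_fin_two]
      exact ⟨hmul _ _ mv, by simp⟩
    · simp only [Fin.forall_fin_two, topMonodromy_scale α a huv, Matrix.of_apply, Matrix.cons_val',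
        Matrix.cons_val_zero, Matrix.cons_val_one, Matrix.cons_val_fin_one]
      constructor
      · linear_combination v * h0
      · linear_combination h1 + topMonodromy α a 1 0 * y 0 * huv

theorem exists_lift_mulVec (hβ : β * β = 1) (hα : α ≠ 0) (hI : ∀ x ∈ I, ∀ y ∈ I, x * y = 0)
    (j : Fin 4) (i : Fin 2) (a : Fin 4 → B ⧸ I) (y : Fin 2 → B ⧸ I) (hj : a j = 1) (hi : y i = 1)
    (h : ∀ l, topMonodromy α a l 0 * y 0 + topMonodromy α a l 1 * y 1 =
      algebraMap ℂ (B ⧸ I) β * y l) :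
    ∃ (a' : Fin 4 → B) (y' : Fin 2 → B), a' j = 1 ∧ y' i = 1 ∧
      (∀ k, Ideal.Quotient.mk I (a' k) = a k) ∧ (∀ l, Ideal.Quotient.mk I (y' l) = y l) ∧
      ∀ l, topMonodromy α a' l 0 * y' 0 + topMonodromy α a' l 1 * y' 1 = algebraMap ℂ B β * y' l := by
  obtain ⟨b, hb, hbj⟩ : ∃ b : Fin 4 → B, (∀ k, Ideal.Quotient.mk I (b k) = a k) ∧ b j = 1 := by
    choose b hb using fun k => Ideal.Quotient.mk_surjective (a k)
    refine ⟨Function.update b j 1, fun k => ?_, Function.update_self ..⟩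
    rcases eq_or_ne k j with rfl | hk
    · rw [Function.update_self, map_one, hj]
    · rw [Function.update_of_ne hk, hb]
  obtain ⟨t, ht⟩ := Ideal.Quotient.mk_surjective (y i.rev)
  suffices H : ∃ (a' : Fin 4 → B) (y' : Fin 2 → B), a' j - 1 ∈ I ∧ y' i = 1 ∧
      (∀ k, Ideal.Quotient.mk I (a' k) = a k) ∧ (∀ l, Ideal.Quotient.mk I (y' l) = y l) ∧
      ∀ l, topMonodromy α a' l 0 * y' 0 + topMonodromy α a' l 1 * y' 1 =
        algebraMap ℂ B β * y' l by
    obtain ⟨a', y', h1, h2, h3, h4, h5⟩ := H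
    obtain ⟨a'', y'', h1', h2', h3', h4', h5'⟩ := exists_normalized_mulVec hI a' y' j i h1 h2 h5
    exact ⟨a'', y'', h1', h2', fun k => (Ideal.Quotient.eq.mpr (h3' k)).trans (h3 k),
      fun k => (Ideal.Quotient.eq.mpr (h4' k)).trans (h4 k), h5'⟩
  have hu := algebraMap_mul_inv_eq_one (A := B) hβ hα
  fin_cases i
  · have hy0 : y 0 = 1 := hi
    have hy1 : Ideal.Quotient.mk I t = y 1 := ht
    have hy : y = ![1, y 1] := by
      funext l
      fin_cases l
      · exact hy0
      · rfl
    rw [hy] at h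
    obtain ⟨h1, h2⟩ := (mulVec_one_iff hβ hα a (y 1)).mp h
    obtain ⟨a', t', ha', ht', e1, e2⟩ := exists_lift_mulVec_one hI hu b t hbj
      (Ideal.Quotient.eq.mp (by
        simp only [map_add, map_mul (Ideal.Quotient.mk I), map_one, hb, hy1]
        exact h1))
      (Ideal.Quotient.eq.mp (by
        simp only [map_add, map_mul (Ideal.Quotient.mk I), map_one, hb, hy1]
        exact h2))
    refine ⟨a', ![1, t'], hbj ▸ ha' j, rfl, fun k => (Ideal.Quotient.eq.mpr (ha' k)).trans (hb k),
      ?_, (mulVec_one_iff hβ hα a' t').mpr ⟨e1, e2⟩⟩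
    rw [Fin.forall_fin_two]
    exact ⟨(map_one _).trans hy0.symm, (Ideal.Quotient.eq.mpr ht').trans hy1⟩
  · have hy0 : y 1 = 1 := hi
    have hy1 : Ideal.Quotient.mk I t = y 0 := ht
    have hy : y = ![y 0, 1] := by
      funext l
      fin_cases l
      · rfl
      · exact hy0
    rw [hy] at h
    obtain ⟨h1, h2⟩ := (mulVec_iff_one hβ hα a (y 0)).mp h
    obtain ⟨a', t', ha', ht', e1, e2⟩ := exists_lift_mulVec_one_right hI hu b t hbj
      (Ideal.Quotient.eq.mp (by
        simp only [map_add, map_mul (Ideal.Quotient.mk I), map_one, hb, hy1]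
        exact h1))
      (Ideal.Quotient.eq.mp (by
        simp only [map_add, map_mul (Ideal.Quotient.mk I), map_one, hb, hy1]
        exact h2))
    refine ⟨a', ![t', 1], hbj ▸ ha' j, rfl, fun k => (Ideal.Quotient.eq.mpr (ha' k)).trans (hb k),
      ?_, (mulVec_iff_one hβ hα a' t').mpr ⟨e1, e2⟩⟩
    rw [Fin.forall_fin_two]
    exact ⟨(Ideal.Quotient.eq.mpr ht').trans hy1, (map_one _).trans hy0.symm⟩

end Lifting

/-! ### Smoothness of the level space -/

section Smooth

variable {α β : ℂ}

/-- Homomorphisms from the chart are eigenvectors with `a j = y i = 1`, since the trace equation is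
redundant, and those lift along square-zero ideals. -/
theorem smooth_level_invRing (hβ : β * β = 1) (hα : α ≠ 0) (j : Fin 4) (i : Fin 2) :
    Algebra.Smooth ℂ ((levelAction β α).invRing {Sum.inl j, Sum.inr i}) where
  formallySmooth := by
    refine Algebra.FormallySmooth.of_comp_surjective fun B _ _ I hI φ => ?_
    have hI' : ∀ x ∈ I, ∀ y ∈ I, x * y = 0 := fun x hx y hy => by
      have := Ideal.mul_mem_mul hx hy
      rwa [← pow_two, hI] at this
    have he := fun l => congrArg φ (levelSlice_mulVec β α j i l)
    simp only [map_add, map_mul, AlgHom.commutes, topMonodromy_map] at he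
    obtain ⟨a, y, hj, hi, ha, hy, h⟩ := exists_lift_mulVec hβ hα hI' j i
      (fun k => φ ((levelSlice β α j i).coord (Sum.inl k)))
      (fun k => φ ((levelSlice β α j i).coord (Sum.inr k)))
      (by rw [(levelSlice β α j i).coord_eq_one (Or.inl rfl), map_one])
      (by rw [(levelSlice β α j i).coord_eq_one (Or.inr rfl), map_one]) he
    obtain ⟨ψ, h1, h2⟩ := exists_levelSlice_lift_of_mulVec hβ hα j i a y h hj hi
    refine ⟨ψ, (levelSlice β α j i).algHom_ext ?_⟩
    rintro (k | k)
    · exact (congrArg (Ideal.Quotient.mk I) (h1 k)).trans (ha k)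
    · exact (congrArg (Ideal.Quotient.mk I) (h2 k)).trans (hy k)
  finitePresentation := by
    refine Algebra.FinitePresentation.of_finiteType.mp ⟨?_⟩
    rw [← (levelSlice β α j i).adjoin_range_coord]
    exact Subalgebra.fg_def.mpr ⟨_, Set.finite_range _, rfl⟩

theorem KernelCharts.smooth_comp {X Y Z : Scheme.{0}} {f : X ⟶ Y} {J : Type}
    (C : KernelCharts f J) (p : Y ⟶ Z)
    (h : ∀ j i, Smooth (Spec.map (C.ring j i) ≫ C.baseMap j ≫ p)) : Smooth (f ≫ p) := by
  have hP : IsZariskiLocalAtSource @Smooth.{0} :=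
    HasRingHomProperty.instIsZariskiLocalAtSource (P := @Smooth)
  have hop := C.isOpenImmersion_lineMap
  refine hP.of_iSup_eq_top (fun ji : J × Fin 2 => (C.lineMap ji.1 ji.2).opensRange) ?_ fun ji => ?_
  · refine top_le_iff.mp fun x _ => ?_
    obtain ⟨j, hj⟩ := C.exists_mem_range_baseMap (f x)
    obtain ⟨i, hi⟩ := C.exists_mem_range_lineMap j x hj
    exact TopologicalSpace.Opens.mem_iSup.mpr ⟨(j, i), hi⟩
  · have hs := h ji.1 ji.2
    rw [← Category.assoc, ← C.lineMap_comp, Category.assoc] at hs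
    rw [← Scheme.Hom.isoOpensRange_inv_comp, Category.assoc]
    infer_instance

theorem smooth_levelMap_comp (hβ : β * β = 1) (hα : α ≠ 0) :
    Smooth (levelMap β α ≫ monodromySpaceToSpec (β + β⁻¹) α) := by
  refine (levelKernelCharts β α hβ hα).smooth_comp _ fun j i => ?_
  have e : Spec.map ((levelKernelCharts β α hβ hα).ring j i) ≫
      (levelKernelCharts β α hβ hα).baseMap j ≫ monodromySpaceToSpec (β + β⁻¹) α =
      Spec.map (CommRingCat.ofHom
        (algebraMap ℂ ((levelAction β α).invRing {Sum.inl j, Sum.inr i}))) := by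
    refine (congrArg (_ ≫ ·) (chartMap_monodromySpaceToSpec α (β + β⁻¹) j)).trans ?_
    refine (Spec.map_comp _ _).symm.trans (congrArg Spec.map (CommRingCat.hom_ext ?_))
    exact RingHom.ext fun c =>
      ((forgetLine β α).inv (forgetLine_idx_mem β α j i)).commutes c
  rw [e]
  refine (HasRingHomProperty.Spec_iff (P := @Smooth)).mpr ?_
  exact (RingHom.smooth_algebraMap).mpr (smooth_level_invRing hβ hα j i)

end Smooth

/-! ### Density of the non-scalar locus by tangent vectors -/

/-- In a reduced Jacobson ring some maximal ideal avoids `r`, and by the Nullstellensatz its residue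
field is `ℂ`. -/
theorem exists_algHom_apply_ne_zero {R : Type} [CommRing R] [Algebra ℂ R] [Algebra.FiniteType ℂ R]
    [IsReduced R] {r : R} (hr : r ≠ 0) : ∃ x : R →ₐ[ℂ] ℂ, x r ≠ 0 := by
  have hJ : IsJacobsonRing R := isJacobsonRing_of_finiteType (A := ℂ)
  have h : r ∉ Ideal.jacobson (⊥ : Ideal R) := by
    rw [← Ideal.radical_eq_jacobson]
    rintro ⟨n, hn⟩
    exact hr (IsReduced.eq_zero r ⟨n, hn⟩)
  rw [Ideal.jacobson, Submodule.mem_sInf] at h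
  push Not at h
  obtain ⟨P, ⟨-, hP⟩, hrP⟩ : ∃ P : Ideal R, P ∈ {J : Ideal R | ⊥ ≤ J ∧ J.IsMaximal} ∧ r ∉ P := h
  have hmax : P.IsMaximal := hP
  let _ : Field (R ⧸ P) := Ideal.Quotient.field P
  have hfin : Module.Finite ℂ (R ⧸ P) := finite_of_finite_type_of_isJacobsonRing ℂ (R ⧸ P)
  have hbij := IsAlgClosed.algebraMap_bijective_of_isIntegral (k := ℂ) (K := R ⧸ P)
  let e := AlgEquiv.ofBijective (Algebra.ofId ℂ (R ⧸ P)) hbij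
  refine ⟨e.symm.toAlgHom.comp (Ideal.Quotient.mkₐ ℂ P), fun h => hrP ?_⟩
  exact Ideal.Quotient.eq_zero_iff_mem.mp ((map_eq_zero_iff e.symm e.symm.injective).mp h)

/-- A function which annihilates an ideal with a nonzero first order deformation at every point
of its zero locus vanishes. -/
theorem eq_zero_of_forall_exists_dualNumber {R : Type} [CommRing R] [Algebra ℂ R]
    [Algebra.FiniteType ℂ R] [IsReduced R] (s : Set R)
    (hs : ∀ x : R →ₐ[ℂ] ℂ, (∀ n ∈ s, x n = 0) →
      ∃ θ : R →ₐ[ℂ] DualNumber ℂ, (∀ r, (θ r).fst = x r) ∧ ∃ n ∈ s, θ n ≠ 0)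
    {r : R} (hr : ∀ n ∈ s, r * n = 0) : r = 0 := by
  by_contra h
  obtain ⟨x, hx⟩ := exists_algHom_apply_ne_zero h
  obtain ⟨θ, hθ, n, hn, hne⟩ := hs x fun n hn => by
    have := congrArg x (hr n hn)
    rw [map_mul, map_zero] at this
    exact (mul_eq_zero.mp this).resolve_left hx
  -- As `r` is nonzero at `x`, its image is a unit of the dual numbers and cannot annihilate `θ n`.
  have hu : IsUnit (θ r) := by
    rw [TrivSqZeroExt.isUnit_iff_isUnit_fst, hθ]
    exact IsUnit.mk0 _ hx
  have := congrArg θ (hr n hn)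
  rw [map_mul, map_zero] at this
  exact hne (hu.mul_right_eq_zero.mp this)

/-- A nonzero function `r` has a nonzero product with some matrix entry. The ring is reduced, so
some prime omits this product, and it gives a point of the basic open set of `r` over the locus. -/
theorem KernelCharts.dense_preimage_locus {X Y : Scheme.{0}} {f : X ⟶ Y} {J : Type}
    (C : KernelCharts f J) (hred : ∀ j i, _root_.IsReduced (C.line j i))
    (h : ∀ j i (r : C.line j i), (∀ l m, r * C.ring j i (C.mat j l m) = 0) → r = 0) :
    Dense ((f ⁻¹ᵁ C.locus : X.Opens) : Set X) := by
  rw [dense_iff_inter_open]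
  rintro O hO ⟨x, hx⟩
  obtain ⟨j, hj⟩ := C.exists_mem_range_baseMap (f x)
  obtain ⟨i, q, rfl⟩ := C.exists_mem_range_lineMap j x hj
  obtain ⟨_, ⟨r, rfl⟩, hqr, hrO⟩ := PrimeSpectrum.isTopologicalBasis_basic_opens.exists_subset_of_mem_open
    (show q ∈ C.lineMap j i ⁻¹' O from hx) (hO.preimage (C.lineMap j i).continuous)
  have hr : r ≠ 0 := by
    rintro rfl
    exact hqr (zero_mem _)
  have : ∃ l m, r * C.ring j i (C.mat j l m) ≠ 0 := by
    by_contra! hc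
    exact hr (h j i r hc)
  obtain ⟨l, m, hlm⟩ := this
  have hred := hred j i
  have hnil : ¬ IsNilpotent (r * C.ring j i (C.mat j l m)) := fun hn => hlm (hn.eq_zero)
  rw [← mem_nilradical, nilradical_eq_sInf, Submodule.mem_sInf] at hnil
  push Not at hnil
  obtain ⟨Q, hQ, hrQ⟩ : ∃ Q : Ideal (C.line j i), Q ∈ {J : Ideal (C.line j i) | J.IsPrime} ∧
    r * C.ring j i (C.mat j l m) ∉ Q := hnil
  have hQ : Q.IsPrime := hQ
  let q' : Spec (C.line j i) := ⟨Q, hQ⟩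
  refine ⟨C.lineMap j i q', hrO fun hmem => hrQ (Q.mul_mem_right _ hmem), ?_⟩
  change f (C.lineMap j i q') ∈ C.locus
  rw [← Scheme.Hom.comp_apply, C.lineMap_comp, Scheme.Hom.comp_apply, C.baseMap_mem_locus]
  exact ⟨l, m, fun hmem => hrQ (Q.mul_mem_left _ hmem)⟩

section Tangent

/-- This is the linearization of the eigenvector equations at a scalar point with `t` held fixed.
The two linear conditions on `δ`, with `δ j = 0`, are solved by their `2 × 2` minors. On this
solution the derivative of the upper right entry is a unit for every `t`. -/
theorem exists_tangent_one {g d : ℂ} (hdg : d * g = 1) {c : Fin 4 → ℂ} {t : ℂ}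
    (h1 : 1 + c 1 * c 2 = g) (h2 : c 3 = -d * c 1) (h3 : c 0 = -d * c 2) {j : Fin 4}
    (hj : c j = 1) : ∃ δ : Fin 4 → ℂ, δ j = 0 ∧
      t * δ 3 + c 1 * (c 2 * t * δ 3 + (1 + c 3 * t) * δ 2) + (t + c 2 * (1 + c 3 * t)) * δ 1 = 0 ∧
      c 2 * t * δ 3 + (1 + c 3 * t) * δ 2 + g * δ 0 = 0 ∧
      δ 3 + δ 1 * (1 + c 2 * c 3) + c 1 * (δ 2 * c 3 + c 2 * δ 3) ≠ 0 := by
  have hg : g ≠ 0 := right_ne_zero_of_mul_eq_one hdg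
  -- The derivative of the upper right entry of `top`, divided by `α` and simplified by the scalar
  -- relations.
  have hN : ∀ x y z : ℂ, z + x * (1 + c 2 * c 3) + c 1 * (y * c 3 + c 2 * z) =
      g * z + d * x + c 1 * c 3 * y := fun x y z => by
    linear_combination c 2 * x * h2 + (z - d * x) * h1 + x * hdg * (-1)
  have hd : d = g⁻¹ := eq_inv_of_mul_eq_one_left hdg
  obtain ⟨p, hp⟩ : ∃ p, p = 1 + c 3 * t := ⟨_, rfl⟩
  obtain ⟨w, hw⟩ : ∃ w, w = t + c 2 * p := ⟨_, rfl⟩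
  rw [← hp, ← hw]
  fin_cases j
  · have hj : c 0 = 1 := hj
    have e2 : c 2 = -g := by linear_combination -c 2 * hdg + g * h3 - g * hj
    have e1 : c 1 = d - 1 := by linear_combination d * c 1 * e2 - d * h1 - (1 + c 1) * hdg
    -- The minors of the two conditions. In the other cases they appear up to the unit `-g`.
    refine ⟨![0, -t * p, g * t * w, p * w], rfl, ?_, ?_, ?_⟩ <;> simp only [Matrix.cons_val]
    · linear_combination (t * p * w * c 1) * e2
    · linear_combination (t * p * w) * e2
    · rw [hN]
      refine ne_of_eq_of_ne (b := -g ^ 2) ?_ (by simpa using hg)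
      simp only [hw, hp, h2, e1, e2, hd]
      field_simp
      ring
  · have hj : c 1 = 1 := hj
    have e2 : c 2 = g - 1 := by linear_combination h1 - c 2 * hj
    refine ⟨![d * t * p, 0, -g * t, p], rfl, ?_, ?_, ?_⟩ <;> simp only [Matrix.cons_val]
    · linear_combination (t * p * (c 2 - g)) * hj + t * p * e2
    · linear_combination t * p * e2 + t * p * hdg
    · rw [hN]
      refine ne_of_eq_of_ne (b := g) ?_ (by simpa using hg)
      simp only [hp, h2, hj, hd]
      field_simp
      ring
  · have hj : c 2 = 1 := hj
    have e1 : c 1 = g - 1 := by linear_combination h1 - c 1 * hj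
    refine ⟨![-d * t * w, -g * t, 0, w], rfl, ?_, ?_, ?_⟩ <;> simp only [Matrix.cons_val]
    · linear_combination t * w * (c 1 * hj) + t * w * e1
    · linear_combination t * w * hj - t * w * hdg
    · rw [hN]
      refine ne_of_eq_of_ne (b := g) ?_ (by simpa using hg)
      simp only [hw, hp, h2, hj, e1, hd]
      field_simp
      ring
  · have hj : c 3 = 1 := hj
    have e1 : c 1 = -g := by linear_combination -c 1 * hdg + g * h2 - g * hj
    have e2 : c 2 = d - 1 := by linear_combination d * c 2 * e1 - d * h1 - (1 + c 2) * hdg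
    refine ⟨![-d * p * w, g * p, w, 0], rfl, ?_, ?_, ?_⟩ <;> simp only [Matrix.cons_val]
    · linear_combination (p * w) * e1
    · linear_combination -(p * w) * hdg
    · rw [hN]
      refine ne_of_eq_of_ne (b := g) ?_ (by simpa using hg)
      simp only [hw, hp, e1, e2, hj, hd]
      field_simp
      ring

/-- The same minors, up to sign, for the vector `(t, 1)`. The derivative of the lower left entry of
`top` comes out as `±α⁻¹`. -/
theorem exists_tangent_one_right {g d : ℂ} (hdg : d * g = 1) {c : Fin 4 → ℂ} {t : ℂ}
    (h1 : 1 + c 1 * c 2 = g) (h2 : c 3 = -d * c 1) (h3 : c 0 = -d * c 2) {j : Fin 4}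
    (hj : c j = 1) : ∃ δ : Fin 4 → ℂ, δ j = 0 ∧
      δ 3 + c 1 * (c 2 * δ 3 + (t + c 3) * δ 2) + (1 + c 2 * (t + c 3)) * δ 1 = 0 ∧
      c 2 * δ 3 + (t + c 3) * δ 2 + g * δ 0 * t = 0 ∧
      δ 0 + (δ 0 * c 1 + c 0 * δ 1) * c 2 + (1 + c 0 * c 1) * δ 2 ≠ 0 := by
  have hg : g ≠ 0 := right_ne_zero_of_mul_eq_one hdg
  have hd : d = g⁻¹ := eq_inv_of_mul_eq_one_left hdg
  obtain ⟨p, hp⟩ : ∃ p, p = t + c 3 := ⟨_, rfl⟩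
  obtain ⟨w, hw⟩ : ∃ w, w = 1 + c 2 * p := ⟨_, rfl⟩
  rw [← hp, ← hw]
  fin_cases j
  · have hj : c 0 = 1 := hj
    have e2 : c 2 = -g := by linear_combination -c 2 * hdg + g * h3 - g * hj
    have e1 : c 1 = d - 1 := by linear_combination d * c 1 * e2 - d * h1 - (1 + c 1) * hdg
    refine ⟨![0, -p, g * w, p * w], rfl, ?_, ?_, ?_⟩ <;> simp only [Matrix.cons_val]
    · linear_combination p * w * c 1 * e2
    · linear_combination p * w * e2
    · refine ne_of_eq_of_ne (b := 1) ?_ one_ne_zero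
      simp only [hw, hp, h2, hj, e1, e2, hd]
      field_simp
      ring
  · have hj : c 1 = 1 := hj
    have e2 : c 2 = g - 1 := by linear_combination h1 - c 2 * hj
    refine ⟨![p, 0, -g ^ 2 * t, g * t * p], rfl, ?_, ?_, ?_⟩ <;> simp only [Matrix.cons_val]
    · linear_combination g * t * p * (c 2 - g) * hj + g * t * p * e2
    · linear_combination g * t * p * e2
    · refine ne_of_eq_of_ne (b := -1) ?_ (by simp)
      simp only [hp, h2, h3, hj, e2, hd]
      field_simp
      ring
  · have hj : c 2 = 1 := hj
    have e1 : c 1 = g - 1 := by linear_combination h1 - c 1 * hj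
    refine ⟨![w, g ^ 2 * t, 0, -g * t * w], rfl, ?_, ?_, ?_⟩ <;> simp only [Matrix.cons_val]
    · linear_combination -(g * t * w) * c 1 * hj - g * t * w * e1
    · linear_combination -(g * t * w) * hj
    · refine ne_of_eq_of_ne (b := 1) ?_ one_ne_zero
      simp only [hw, hp, h2, h3, hj, e1, hd]
      field_simp
      ring
  · have hj : c 3 = 1 := hj
    have e1 : c 1 = -g := by linear_combination -c 1 * hdg + g * h2 - g * hj
    have e2 : c 2 = d - 1 := by linear_combination d * c 2 * e1 - d * h1 - (1 + c 2) * hdg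
    refine ⟨![p * w, -g ^ 2 * t * p, -g * t * w, 0], rfl, ?_, ?_, ?_⟩ <;> simp only [Matrix.cons_val]
    · linear_combination -(p * g * t * w) * e1
    · ring
    · refine ne_of_eq_of_ne (b := 1) ?_ one_ne_zero
      simp only [hw, hp, h3, hj, e1, e2, hd]
      field_simp
      ring

variable {α β : ℂ}

theorem topMonodromy_zero_one {A : Type} [CommRing A] [Algebra ℂ A] (a : Fin 4 → A) :
    topMonodromy α a 0 1 = algebraMap ℂ A α * (a 3 + a 1 * (1 + a 2 * a 3)) := by
  rw [topMonodromy_eq]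
  rfl

theorem topMonodromy_one_zero {A : Type} [CommRing A] [Algebra ℂ A] (a : Fin 4 → A) :
    topMonodromy α a 1 0 = algebraMap ℂ A α⁻¹ * (a 0 + (1 + a 0 * a 1) * a 2) := by
  rw [topMonodromy_eq]
  rfl

/-- First order deformations of eigenvectors of scalar monodromy matrices. -/
theorem exists_dualNumber_mulVec (hβ : β * β = 1) (hα : α ≠ 0) (j : Fin 4) (i : Fin 2)
    (c : Fin 4 → ℂ) (y : Fin 2 → ℂ) (hj : c j = 1) (hi : y i = 1)
    (hc : ∀ l m, topMonodromy α c l m = if l = m then β else 0) :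
    ∃ (a : Fin 4 → DualNumber ℂ) (b : Fin 2 → DualNumber ℂ), a j = 1 ∧ b i = 1 ∧
      (∀ k, (a k).fst = c k) ∧ (∀ k, (b k).fst = y k) ∧
      (∀ l, topMonodromy α a l 0 * b 0 + topMonodromy α a l 1 * b 1 =
        algebraMap ℂ (DualNumber ℂ) β * b l) ∧
      topMonodromy α a i i.rev ≠ 0 := by
  have hdg := algebraMap_mul_inv_eq_one (A := ℂ) hβ hα
  obtain ⟨h1, h2, h3⟩ := stokes_relations_of_scalar (A := ℂ) hβ hα hc
  simp only [Algebra.algebraMap_self_apply] at hdg h1 h2 h3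
  have hα' : α⁻¹ ≠ 0 := inv_ne_zero hα
  have hmap : ∀ z : ℂ, algebraMap ℂ (DualNumber ℂ) z = TrivSqZeroExt.inl z := fun _ => rfl
  rcases Fin.two_eq_or_eq_rev 0 i with rfl | rfl
  · have hi : y 0 = 1 := hi
    obtain ⟨δ, hδ, d1, d2, hne⟩ := exists_tangent_one (t := y 1) hdg h1 h2 h3 hj
    -- Only the Stokes data move to first order. The line is kept constant.
    refine ⟨fun k => TrivSqZeroExt.inl (c k) + TrivSqZeroExt.inr (δ k),
      ![1, TrivSqZeroExt.inl (y 1)], by simp [hj, hδ], rfl, fun k => by simp, ?_, ?_, fun h => hne ?_⟩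
    · rw [Fin.forall_fin_two]
      exact ⟨hi.symm, rfl⟩
    · refine (mulVec_one_iff hβ hα _ _).mpr ⟨?_, ?_⟩ <;> simp only [hmap] <;>
        refine TrivSqZeroExt.ext ?_ ?_ <;> simp
      · linear_combination (1 + y 1 * c 3) * h1 + y 1 * (β * α⁻¹) * h2 - y 1 * c 1 * hdg
      · linear_combination d1
      · linear_combination y 1 * c 2 * h2 - (β * α) * y 1 * h1 - y 1 * hdg + (β * α⁻¹) * h3 - c 2 * hdg
      · linear_combination d2
    · rw [show (0 : Fin 2).rev = 1 from rfl, topMonodromy_zero_one, hmap] at h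
      have := congrArg TrivSqZeroExt.snd h
      simp [hα] at this
      linear_combination this
  · have hi : y 1 = 1 := hi
    obtain ⟨δ, hδ, d1, d2, hne⟩ := exists_tangent_one_right (t := y 0) hdg h1 h2 h3 hj
    refine ⟨fun k => TrivSqZeroExt.inl (c k) + TrivSqZeroExt.inr (δ k),
      ![TrivSqZeroExt.inl (y 0), 1], by simp [hj, hδ], rfl, fun k => by simp, ?_, ?_, fun h => hne ?_⟩
    · rw [Fin.forall_fin_two]
      exact ⟨rfl, hi.symm⟩
    · refine (mulVec_iff_one hβ hα _ _).mpr ⟨?_, ?_⟩ <;> simp only [hmap] <;>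
        refine TrivSqZeroExt.ext ?_ ?_ <;> simp
      · linear_combination (y 0 + c 3) * h1 + (β * α⁻¹) * h2 - c 1 * hdg
      · linear_combination d1
      · linear_combination c 2 * h2 - (β * α) * h1 - hdg + y 0 * (β * α⁻¹) * h3 - y 0 * c 2 * hdg
      · linear_combination d2
    · rw [show (0 : Fin 2).rev.rev = 0 from rfl, show (0 : Fin 2).rev = 1 from rfl,
        topMonodromy_one_zero, hmap] at h
      have := congrArg TrivSqZeroExt.snd h
      simp [hα] at this
      linear_combination this

end Tangent

section Density

variable {α β : ℂ}

theorem finiteType_levelRing (j : Fin 4) (i : Fin 2) :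
    Algebra.FiniteType ℂ ((levelAction β α).invRing {Sum.inl j, Sum.inr i}) :=
  ⟨by
    rw [← (levelSlice β α j i).adjoin_range_coord]
    exact Subalgebra.fg_def.mpr ⟨_, Set.finite_range _, rfl⟩⟩

theorem isReduced_levelRing (hβ : β * β = 1) (hα : α ≠ 0) (j : Fin 4) (i : Fin 2) :
    _root_.IsReduced ((levelAction β α).invRing {Sum.inl j, Sum.inr i}) := by
  have := smooth_level_invRing hβ hα j i
  exact Algebra.Smooth.isReduced ℂ

theorem exists_dualNumber_shiftedMonodromy (hβ : β * β = 1) (hα : α ≠ 0) (j : Fin 4) (i : Fin 2)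
    (x : (levelAction β α).invRing {Sum.inl j, Sum.inr i} →ₐ[ℂ] ℂ)
    (hx : ∀ l m, x ((forgetLine β α).inv (forgetLine_idx_mem β α j i)
      (shiftedMonodromy β α j l m)) = 0) :
    ∃ θ : (levelAction β α).invRing {Sum.inl j, Sum.inr i} →ₐ[ℂ] DualNumber ℂ,
      (∀ r, (θ r).fst = x r) ∧
      θ ((forgetLine β α).inv (forgetLine_idx_mem β α j i)
        (shiftedMonodromy β α j i i.rev)) ≠ 0 := by
  have h1 : x ((levelSlice β α j i).coord (Sum.inl j)) = 1 := by
    rw [(levelSlice β α j i).coord_eq_one (Or.inl rfl), map_one]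
  have h2 : x ((levelSlice β α j i).coord (Sum.inr i)) = 1 := by
    rw [(levelSlice β α j i).coord_eq_one (Or.inr rfl), map_one]
  obtain ⟨a, b, haj, hbi, ha, hb, hab, hne⟩ := exists_dualNumber_mulVec hβ hα j i
    (fun k => x ((levelSlice β α j i).coord (Sum.inl k)))
    (fun k => x ((levelSlice β α j i).coord (Sum.inr k))) h1 h2 fun l m => by
      have h := hx l m
      rw [← AlgHom.comp_apply, shiftedMonodromy_map, sub_eq_zero] at h
      simpa only [AlgHom.comp_apply, forgetLine_inv_coord, Algebra.algebraMap_self_apply] using h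
  obtain ⟨θ, hθa, hθb⟩ := exists_levelSlice_lift_of_mulVec hβ hα j i a b hab haj hbi
  refine ⟨θ, fun r => ?_, ?_⟩
  · have : (TrivSqZeroExt.fstHom ℂ ℂ ℂ).comp θ = x := by
      refine (levelSlice β α j i).algHom_ext ?_
      rintro (k | k)
      · exact (congrArg TrivSqZeroExt.fst (hθa k)).trans (ha k)
      · exact (congrArg TrivSqZeroExt.fst (hθb k)).trans (hb k)
    exact DFunLike.congr_fun this r
  · rw [← AlgHom.comp_apply, shiftedMonodromy_map, if_neg (Fin.two_rev_ne i).symm, sub_zero]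
    simpa only [AlgHom.comp_apply, forgetLine_inv_coord, hθa] using hne

theorem dense_levelMap_preimage_locus (hβ : β * β = 1) (hα : α ≠ 0) :
    Dense ((levelMap β α ⁻¹ᵁ (levelKernelCharts β α hβ hα).locus :
      (levelSpace β α).Opens) : Set (levelSpace β α)) := by
  refine KernelCharts.dense_preimage_locus _ (isReduced_levelRing hβ hα) fun j i r hr => ?_
  have := finiteType_levelRing (β := β) (α := α) j i
  have := isReduced_levelRing hβ hα j i
  refine eq_zero_of_forall_exists_dualNumber
    (R := (levelAction β α).invRing {Sum.inl j, Sum.inr i})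
    (Set.range fun lm : Fin 2 × Fin 2 => (forgetLine β α).inv (forgetLine_idx_mem β α j i)
      (shiftedMonodromy β α j lm.1 lm.2)) (fun x hx => ?_) ?_
  · obtain ⟨θ, h1, h2⟩ := exists_dualNumber_shiftedMonodromy hβ hα j i x
      fun l m => hx _ ⟨(l, m), rfl⟩
    exact ⟨θ, h1, _, ⟨(i, i.rev), rfl⟩, h2⟩
  · rintro _ ⟨lm, rfl⟩
    exact hr lm.1 lm.2

end Density

/-! ### Counting the singular points -/

section ScalarPoint

variable {α β : ℂ}

theorem existsUnique_scalarPoint (hβ : β * β = 1) (hα : α ≠ 0) (j : Fin 4) :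
    ∃! p : Spec (CommRingCat.of ((monodromyAction (β + β⁻¹) α).invRing {j})),
      ∀ l m, shiftedMonodromy β α j l m ∈ p.asIdeal := by
  obtain ⟨ρ, hρ⟩ := exists_monodromySlice_lift (β + β⁻¹) α j (scalarStokes β α j) (by
    rw [Matrix.trace_fin_two, topMonodromy_scalarStokes hβ hα, topMonodromy_scalarStokes hβ hα,
      if_pos rfl, if_pos rfl, ← eq_inv_of_mul_eq_one_left hβ]
    rfl) (scalarStokes_self j)
  refine existsUnique_of_exists_of_unique
    ⟨⟨RingHom.ker ρ.toRingHom, RingHom.ker_isPrime _⟩, fun l m => ?_⟩ fun p q hp hq => ?_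
  · change ρ (shiftedMonodromy β α j l m) = 0
    rw [shiftedMonodromy_map, funext hρ, topMonodromy_scalarStokes hβ hα]
    exact sub_self _
  · have key : ∀ p q : Spec (CommRingCat.of ((monodromyAction (β + β⁻¹) α).invRing {j})),
        (∀ l m, shiftedMonodromy β α j l m ∈ p.asIdeal) →
        (∀ l m, shiftedMonodromy β α j l m ∈ q.asIdeal) → p.asIdeal ≤ q.asIdeal := by
      intro p q hp hq r hr
      -- Working modulo the intersection provides one constant for both primes. It lies in `p`, so
      -- it is zero, and `r` lies in `q`.
      obtain ⟨c, hc⟩ := exists_sub_algebraMap_mem α hβ hα j (p.asIdeal ⊓ q.asIdeal)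
        (fun l m => ⟨hp l m, hq l m⟩) r
      have hcp : algebraMap ℂ ((monodromyAction (β + β⁻¹) α).invRing {j}) c ∈ p.asIdeal :=
        (Submodule.sub_mem_iff_right _ hr).mp hc.1
      have hc0 : c = 0 := by
        by_contra h
        exact p.isPrime.ne_top (Ideal.eq_top_of_isUnit_mem _ hcp ((IsUnit.mk0 c h).map _))
      have := hc.2
      rwa [hc0, map_zero, sub_zero] at this
    exact PrimeSpectrum.ext (le_antisymm (key p q hp hq) (key q p hq hp))

theorem coord_mem_scalarPoint_iff (hβ : β * β = 1) (hα : α ≠ 0) (j k : Fin 4)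
    (p : Spec (CommRingCat.of ((monodromyAction (β + β⁻¹) α).invRing {j})))
    (hp : ∀ l m, shiftedMonodromy β α j l m ∈ p.asIdeal) :
    (monodromySlice (β + β⁻¹) α j).coord k ∈ p.asIdeal ↔ scalarStokes β α j k = 0 := by
  have h := coord_sub_algebraMap_mem α hβ hα j k p.asIdeal hp
  constructor
  · intro hk
    by_contra h0
    exact p.isPrime.ne_top (Ideal.eq_top_of_isUnit_mem _
      ((Submodule.sub_mem_iff_right _ hk).mp h) ((IsUnit.mk0 _ h0).map _))
  · intro h0
    rwa [h0, map_zero, sub_zero] at h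

/-- The singular points of `𝓡[β + β⁻¹, α]` are the scalar points of the slices. -/
theorem exists_scalarPoints (hβ : β * β = 1) (hα : α ≠ 0) :
    ∃ y : Fin 4 → monodromySpace (β + β⁻¹) α,
      (∀ j, IsSingularPoint (monodromySpaceToSpec (β + β⁻¹) α) (y j)) ∧
      (∀ z, IsSingularPoint (monodromySpaceToSpec (β + β⁻¹) α) z → ∃ j, z = y j) ∧
      ∀ j k, y j = y k ↔ scalarStokes β α j k ≠ 0 := by
  let C := levelKernelCharts β α hβ hα
  have hsing := ((levelKernelCharts_isSurfaceOver α hβ hα).isMinimalResolution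
    (smooth_levelMap_comp hβ hα) (dense_levelMap_preimage_locus hβ hα)).2.2
  choose p hp hu using existsUnique_scalarPoint (α := α) hβ hα
  have hchart : ∀ z j, IsSingularPoint (monodromySpaceToSpec (β + β⁻¹) α) z →
      z ∈ Set.range (C.baseMap j) → z = C.baseMap j (p j) := by
    rintro _ j hz ⟨q, rfl⟩
    rw [hsing, KernelCharts.baseMap_mem_locus] at hz
    push Not at hz
    rw [hu j q hz]
  have hy : ∀ j, IsSingularPoint (monodromySpaceToSpec (β + β⁻¹) α) (C.baseMap j (p j)) := by
    intro j
    rw [hsing]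
    exact fun h => let ⟨l, m, hlm⟩ := (C.baseMap_mem_locus (p j)).mp h
      hlm (hp j l m)
  refine ⟨fun j => C.baseMap j (p j), hy, fun z hz => ?_, fun j k => ?_⟩
  · obtain ⟨j, hj⟩ := C.exists_mem_range_baseMap z
    exact ⟨j, hchart z j hz hj⟩
  · have h1 : C.baseMap j (p j) ∈ Set.range (C.baseMap k) ↔ scalarStokes β α j k ≠ 0 := by
      refine ((monodromySlice (β + β⁻¹) α j).chartMap_mem_range_iff (monodromyCharts_mem α _ j)
        (monodromyCharts_mem α _ k) (p j)).trans ?_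
      have := not_iff_not.mpr (coord_mem_scalarPoint_iff hβ hα j k (p j) (hp j))
      exact ⟨fun h => this.mp (h k rfl), fun h l hl => hl ▸ this.mpr h⟩
    rw [← h1]
    exact ⟨fun h => ⟨p k, h.symm⟩, hchart _ k (hy j)⟩

theorem scalarStokes_ne_zero (hβ : β * β = 1) (hα : α ≠ 0) (h : α ≠ β) (j k : Fin 4) :
    scalarStokes β α j k ≠ 0 := by
  have hb : β ≠ 0 := left_ne_zero_of_mul_eq_one hβ
  have h1 : β * α ≠ 0 := mul_ne_zero hb hα
  have h2 : β * α⁻¹ ≠ 0 := mul_ne_zero hb (inv_ne_zero hα)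
  have h3 : β * α - 1 ≠ 0 := fun h' =>
    h (mul_left_cancel₀ hb ((sub_eq_zero.mp h').trans hβ.symm))
  have h4 : β * α⁻¹ - 1 ≠ 0 := fun h' =>
    h (((mul_inv_eq_one₀ hα).mp (sub_eq_zero.mp h')).symm)
  have h5 : β * α - (β * α) ^ 2 ≠ 0 := by
    rw [show β * α - (β * α) ^ 2 = -(β * α * (β * α - 1)) by ring]
    exact neg_ne_zero.mpr (mul_ne_zero h1 h3)
  have h6 : (1 : ℂ) ≠ 0 := one_ne_zero
  have h7 := neg_ne_zero.mpr h1
  have h8 := neg_ne_zero.mpr h2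
  fin_cases j <;> fin_cases k <;> assumption

/-- For `α = β` both `β * α` and `β * α⁻¹` equal `1`, so precisely the entries at odd distance from
the diagonal vanish. -/
theorem scalarStokes_self_ne_zero_iff (hβ : β * β = 1) (j k : Fin 4) :
    scalarStokes β β j k ≠ 0 ↔ (k = j ∨ k = j + 2) := by
  have hb : β ≠ 0 := left_ne_zero_of_mul_eq_one hβ
  fin_cases j <;> fin_cases k <;> simp [scalarStokes, hβ, hb]

end ScalarPoint

theorem lemma1p1 (β α : ℂ) (hβ : β = 1 ∨ β = -1) (hα : α ≠ 0) :
    IsMinimalResolution (monodromySpaceToSpec (β + β⁻¹) α) (levelMap β α) ∧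
    (∀ U : (monodromySpace (β + β⁻¹) α).Opens,
      Smooth (U.ι ≫ monodromySpaceToSpec (β + β⁻¹) α) → IsIso (levelMap β α ∣_ U)) ∧
    (α ≠ β → ∃! y, IsSingularPoint (monodromySpaceToSpec (β + β⁻¹) α) y) ∧
    (α = β → {y | IsSingularPoint (monodromySpaceToSpec (β + β⁻¹) α) y}.ncard = 2) := by
  have hβ : β * β = 1 := by rcases hβ with rfl | rfl <;> norm_num
  obtain ⟨hres, hiso, -⟩ := (levelKernelCharts_isSurfaceOver α hβ hα).isMinimalResolution
    (smooth_levelMap_comp hβ hα) (dense_levelMap_preimage_locus hβ hα)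
  obtain ⟨y, hy, hz, hne⟩ := exists_scalarPoints hβ hα
  refine ⟨hres, hiso, fun h => ⟨y 0, hy 0, fun z h' => ?_⟩, ?_⟩
  · obtain ⟨j, rfl⟩ := hz z h'
    exact (hne j 0).mpr (scalarStokes_ne_zero hβ hα h j 0)
  · rintro rfl
    have he : ∀ j k, y j = y k ↔ k = j ∨ k = j + 2 := fun j k =>
      (hne j k).trans (scalarStokes_self_ne_zero_iff hβ j k)
    -- The points of slices `0, 2` coincide, as do those of slices `1, 3`, and the two classes are
    -- distinct.
    have : {y | IsSingularPoint (monodromySpaceToSpec (α + α⁻¹) α) y} = {y 0, y 1} := by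
      refine Set.Subset.antisymm (fun z h' => ?_) ?_
      · obtain ⟨j, rfl⟩ := hz z h'
        simp only [Set.mem_insert_iff, Set.mem_singleton_iff, he]
        clear h'
        revert j
        decide
      · rintro _ (rfl | rfl)
        exacts [hy 0, hy 1]
    rw [this, Set.ncard_pair]
    exact fun h => absurd ((he 0 1).mp h) (by decide)
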